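/- A unit disk is a closed disk of radius $1$ in the plane. In the problem $k$-CDUDC one is given a set $P$ of $n\ge 1$ points, a set $D$ of $m$ unit disks, both in the plane, and an integer $k\ge 1$. A $c$-colorable cover is a set $D'\subseteq D$ covering all points of $P$ together with a coloring of $D'$ by at most $c$ colors in which any two distinct disks that intersect receive different colors. A $\rho$-approximation algorithm for $k$-CDUDC returns, on every input that admits a $k$-colorable cover, a $\rho k$-colorable cover (the set and its coloring). For a grid width $1\le\tau\le 5$ let $$\rho=\begin{cases}4&\text{if }\tau\ge 2,\\ 6&\text{if }\tfrac85\le\tau<2,\\ 7&\text{if }\sqrt2\le\tau<\tfrac85,\\ 9&\text{if }1\le\tau<\sqrt2,\end{cases}\qquad \alpha=\begin{cases}4&\text{if }\tau=1,\\ 5&\text{if }\sqrt2\le\tau\le\tfrac85,\\ 7&\text{if }\tau=2,\\ 10&\text{if }\tau=3,\\ 14&\text{if }\tau=4,\\ 17&\text{if }\tau=5,\end{cases}$$ and at the remaining values of $\tau$ let $\alpha$ be the largest number of pairwise disjoint unit disks that can all intersect a $\tau\times\tau$ square. Then there is an algorithm on the real RAM (unit-cost arithmetic and comparisons on reals; unit-cost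 addition, subtraction, comparison and indirect addressing on integers; no rounding) that, given $\tau$ together with $P$, $D$ and $k$, is a $\rho$-approximation algorithm for $k$-CDUDC and runs in $O(m^{\alpha k}\,n\log(k+1))$ time, with an absolute constant in the $O$. -/

import Mathlib

noncomputable section

namespace CDUDC

/-! ### Unit disks, colourable covers -/

abbrev Plane : Type := EuclideanSpace ℝ (Fin 2)

/-- The closed disk of radius `1` around `c`. -/
def unitDisk (c : Plane) : Set Plane := Metric.closedBall c 1

/-- An input of the problem: a set of `n` points, a set of `m` unit disks (given by their centres),
both enumerated without repetition, and the parameter `k`. -/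
structure Input where
  n : ℕ
  m : ℕ
  k : ℕ
  point : Fin n → Plane
  center : Fin m → Plane
  point_injective : Function.Injective point
  center_injective : Function.Injective center

/-- The disks with index in `S` cover all points, and `χ` colours them with colours from
`{1, …, c}` so that distinct disks of the same colour are disjoint. -/
def Input.IsColoredCover (I : Input) (c : ℕ) (S : Set (Fin I.m)) (χ : Fin I.m → ℕ) : Prop :=
  (∀ i : Fin I.n, ∃ j ∈ S, I.point i ∈ unitDisk (I.center j)) ∧
  (∀ j ∈ S, 1 ≤ χ j ∧ χ j ≤ c) ∧
  (∀ j ∈ S, ∀ j' ∈ S, j ≠ j' → χ j = χ j' →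
    Disjoint (unitDisk (I.center j)) (unitDisk (I.center j')))

/-- Some subset of the given disks is a `c`-colourable cover of the given points. -/
def Input.HasColorableCover (I : Input) (c : ℕ) : Prop :=
  ∃ (S : Set (Fin I.m)) (χ : Fin I.m → ℕ), I.IsColoredCover c S χ

/-! ### The parameters attached to a grid width -/

/-- The approximation factor for grid width `τ` (used for `1 ≤ τ ≤ 5` only). -/
def rho (τ : ℝ) : ℕ :=
  if 2 ≤ τ then 4 else if 8 / 5 ≤ τ then 6 else if √2 ≤ τ then 7 else 9

/-- The closed grid cell `[0, τ] × [0, τ]`. -/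
def cell (τ : ℝ) : Set Plane := {z | ∀ i, 0 ≤ z i ∧ z i ≤ τ}

/-- `a` is the largest number of pairwise disjoint unit disks that all meet a `τ × τ` cell. -/
def IsPackingNumber (τ : ℝ) (a : ℕ) : Prop :=
  IsGreatest {c : ℕ | ∃ S : Finset Plane, S.card = c ∧ (S : Set Plane).PairwiseDisjoint unitDisk ∧
    ∀ z ∈ S, (unitDisk z ∩ cell τ).Nonempty} a

/-- The grid widths at which the exponent has a tabulated value. -/
def Tabulated (τ : ℝ) : Prop :=
  τ = 1 ∨ (√2 ≤ τ ∧ τ ≤ 8 / 5) ∨ τ = 2 ∨ τ = 3 ∨ τ = 4 ∨ τ = 5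

/-- `a` is the exponent for grid width `τ`: the tabulated value where there is one, and the packing
number of the `τ × τ` cell at the remaining widths. -/
def IsExponent (τ : ℝ) (a : ℕ) : Prop :=
  (τ = 1 ∧ a = 4) ∨ (√2 ≤ τ ∧ τ ≤ 8 / 5 ∧ a = 5) ∨ (τ = 2 ∧ a = 7) ∨ (τ = 3 ∧ a = 10) ∨
  (τ = 4 ∧ a = 14) ∨ (τ = 5 ∧ a = 17) ∨ (¬ Tabulated τ ∧ IsPackingNumber τ a)

/-! ### The real RAM

Programs work on integer and real variables and on integer and real arrays with random access; a
program is a finite object and so mentions finitely many of them. Every instruction and every test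
takes one unit of time. The integers (natural numbers) can be added, subtracted and compared; the
reals can be added, subtracted, multiplied, divided and compared. There are no roots, no rounding,
and no other passage from reals to integers than a comparison. -/

/-- The contents of the memory: variables, and arrays `name ↦ index ↦ entry`. -/
structure Store where
  intVar : ℕ → ℕ
  realVar : ℕ → ℝ
  intArr : ℕ → ℕ → ℕ
  realArr : ℕ → ℕ → ℝ

/-- Elementary instructions; the first argument is the target, except in the two `Store`
instructions. -/
inductive Instr
  | intConst (x c : ℕ)
  | intAdd (x y z : ℕ)
  | intSub (x y z : ℕ)
  | intLoad (x a i : ℕ)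
  | intStore (a i y : ℕ)
  | realConst (x : ℕ) (c : ℚ)
  | realAdd (x y z : ℕ)
  | realSub (x y z : ℕ)
  | realMul (x y z : ℕ)
  | realDiv (x y z : ℕ)
  | realLoad (x a i : ℕ)
  | realStore (a i y : ℕ)

/-- Overwrite the entry of array `a` at index `i`. -/
def setEntry {β : Type} (A : ℕ → ℕ → β) (a i : ℕ) (v : β) : ℕ → ℕ → β :=
  Function.update A a (Function.update (A a) i v)

/-- The effect of an instruction. Subtraction of integers is truncated at `0`; division by `0`
gives `0`. -/
def Instr.exec (σ : Store) : Instr → Store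
  | .intConst x c => { σ with intVar := Function.update σ.intVar x c }
  | .intAdd x y z => { σ with intVar := Function.update σ.intVar x (σ.intVar y + σ.intVar z) }
  | .intSub x y z => { σ with intVar := Function.update σ.intVar x (σ.intVar y - σ.intVar z) }
  | .intLoad x a i => { σ with intVar := Function.update σ.intVar x (σ.intArr a (σ.intVar i)) }
  | .intStore a i y => { σ with intArr := setEntry σ.intArr a (σ.intVar i) (σ.intVar y) }
  | .realConst x c => { σ with realVar := Function.update σ.realVar x (c : ℝ) }
  | .realAdd x y z => { σ with realVar := Function.update σ.realVar x (σ.realVar y + σ.realVar z) }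
  | .realSub x y z => { σ with realVar := Function.update σ.realVar x (σ.realVar y - σ.realVar z) }
  | .realMul x y z => { σ with realVar := Function.update σ.realVar x (σ.realVar y * σ.realVar z) }
  | .realDiv x y z => { σ with realVar := Function.update σ.realVar x (σ.realVar y / σ.realVar z) }
  | .realLoad x a i => { σ with realVar := Function.update σ.realVar x (σ.realArr a (σ.intVar i)) }
  | .realStore a i y => { σ with realArr := setEntry σ.realArr a (σ.intVar i) (σ.realVar y) }

/-- Tests on variables. -/
inductive Test
  | intLe (x y : ℕ)
  | realLe (x y : ℕ)

def Test.Holds (σ : Store) : Test → Prop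
  | .intLe x y => σ.intVar x ≤ σ.intVar y
  | .realLe x y => σ.realVar x ≤ σ.realVar y

/-- Programs. -/
inductive Prog
  | instr (i : Instr)
  | seq (p q : Prog)
  | ite (b : Test) (p q : Prog)
  | loop (b : Test) (p : Prog)

/-- `Runs p σ t σ'`: started in `σ`, the program `p` halts in `σ'` after exactly `t` steps.
`loop b p` repeats `p` while `b` holds. -/
inductive Runs : Prog → Store → ℕ → Store → Prop
  | instr (i : Instr) (σ : Store) : Runs (.instr i) σ 1 (i.exec σ)
  | seq {p q : Prog} {σ σ₁ σ₂ : Store} {t u : ℕ} :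
      Runs p σ t σ₁ → Runs q σ₁ u σ₂ → Runs (.seq p q) σ (t + u) σ₂
  | iteTrue {b : Test} {p q : Prog} {σ σ₁ : Store} {t : ℕ} :
      b.Holds σ → Runs p σ t σ₁ → Runs (.ite b p q) σ (t + 1) σ₁
  | iteFalse {b : Test} {p q : Prog} {σ σ₁ : Store} {t : ℕ} :
      ¬ b.Holds σ → Runs q σ t σ₁ → Runs (.ite b p q) σ (t + 1) σ₁
  | loopDone {b : Test} {p : Prog} {σ : Store} :
      ¬ b.Holds σ → Runs (.loop b p) σ 1 σ
  | loopStep {b : Test} {p : Prog} {σ σ₁ σ₂ : Store} {t u : ℕ} :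
      b.Holds σ → Runs p σ t σ₁ → Runs (.loop b p) σ₁ u σ₂ → Runs (.loop b p) σ (t + u + 1) σ₂

/-- Coordinate `i` of a finite sequence of points, continued by zeros. -/
def coords {r : ℕ} (f : Fin r → Plane) (i : Fin 2) (j : ℕ) : ℝ :=
  if h : j < r then f ⟨j, h⟩ i else 0

/-- The initial store on grid width `τ` and input `I`: integer variables `0, 1, 2` hold `n, m, k`,
real variable `0` holds `τ`, real arrays `0, 1` hold the coordinates of the points, and real arrays
`2, 3` those of the centres. Everything else is `0`. -/
def initStore (τ : ℝ) (I : Input) : Store where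
  intVar x := if x = 0 then I.n else if x = 1 then I.m else if x = 2 then I.k else 0
  realVar x := if x = 0 then τ else 0
  intArr _ _ := 0
  realArr a :=
    if a = 0 then coords I.point 0 else if a = 1 then coords I.point 1
    else if a = 2 then coords I.center 0 else if a = 3 then coords I.center 1 else fun _ => 0

/-- The colour of disk `j` as read off integer array `0` of the final store. -/
def outColor (I : Input) (σ : Store) (j : Fin I.m) : ℕ := σ.intArr 0 j

/-- The disks selected in the final store: those with a nonzero colour. -/
def outDisks (I : Input) (σ : Store) : Set (Fin I.m) := {j | outColor I σ j ≠ 0}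

end CDUDC

end

noncomputable section

namespace CDUDC

/-! ### Geometry of a thin strip -/

/-! The algorithm cuts the plane into horizontal strips instead of grid cells. The lowest untreated
point is the bottom of the next strip, of height `h`, so no rounding is needed to place the strips.
In each strip the points are covered with `k` colours by disks whose centres lie at most `1` below
or above the strip. Strips are assigned cyclically to `cls` classes, each with its own palette of
`k` colours. Since `cls * h = 4 + h`, centres chosen for different strips of one class differ in
height by more than `2`, so `cls * k` colours suffice (`Task.Colored.recolor`). The choice is `h =
4/3`, `cls = 4` if `2 ≤ τ * τ`, and `h = 1/2`, `cls = 9` otherwise; both agree with `rho`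
(`le_rho`).

A strip is solved by a sweep from left to right that remembers only the last `A` disks of each
colour, with `A = 4` for `h = 4/3` and `A = 3` for `h = 1/2`. Two packing facts make this lossless.
A new disk disjoint from the last three of its colour is disjoint from all earlier ones
(`far_of_far_three`). A disk covering a point is still among the last `A` of its colour as long as
no disk beyond the reach of the point has been added (`exists_dig`). Both rest on `five_points` and
`four_points`. Hence what is remembered determines which additions are allowed (`Allowed.congr`),
and a search through at most `(m + 1) ^ (A * k) + 1` states finds a solution of the strip if there
is one (`Solves.exists_complete`).

Per point of the strip, a state is treated in time of order `m * k²`. If `k < m`, then `(m + 1) ^ (A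
* k)` is at most `3 ^ A * m ^ (A * k)` and `m * k² ≤ 2 * m ^ k`, so the search costs `O(m ^ ((A + 1)
* k))` per point, and `A + 1 ≤ α` by `IsExponent.lt`. If `m ≤ k`, every disk gets its own colour.
Different strips have different points, so the searches add up to a factor `n`. The overhead `O(n)`
per strip is harmless because there are at most `5 * m` strips, by a potential argument
(`Task.potential_add_le`). The logarithmic factor in the bound is not needed.

The algorithm is written out as a program. It is verified with total correctness statements `Ends`
that carry a step bound, and with a frame rule `Same` for the memory a program leaves alone. The
queue of the search is tied to a list of partial solutions that exists only in the proof
(`QueueInv`). -/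

/-- The squared distance of `(x, y)` and `(u, v)`. -/
def sqd (x y u v : ℝ) : ℝ := (x - u) * (x - u) + (y - v) * (y - v)

lemma sqd_comm (x y u v : ℝ) : sqd x y u v = sqd u v x y := by
  unfold sqd; ring

/-- Two points at distance more than `2` with ordinates differing by at most `5/3` have abscissae
differing by more than `1`. -/
lemma one_lt_of_four_lt_sqd {x y u v : ℝ} (hfar : 4 < sqd x y u v) (hx : u ≤ x)
    (h₁ : y - v ≤ 5 / 3) (h₂ : v - y ≤ 5 / 3) : 1 < x - u := by
  unfold sqd at hfar
  -- This leaves `4 - 25/9 = 11/9 > 1` for the square of the difference of the abscissae.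
  have : (y - v) * (y - v) ≤ 25 / 9 := by nlinarith
  by_contra! h
  nlinarith

/-- Among five points, sorted by abscissa, in a rectangle of height `10/3`, such that all pairs but
the extreme one are at distance more than `2`, the extreme pair is so as well. -/
lemma five_points {lo x₀ y₀ x₁ y₁ x₂ y₂ x₃ y₃ x₄ y₄ : ℝ}
    (hx₀ : x₁ ≤ x₀) (hx₁ : x₂ ≤ x₁) (hx₂ : x₃ ≤ x₂) (hx₃ : x₄ ≤ x₃)
    (hy₀ : lo ≤ y₀ ∧ y₀ ≤ lo + 10 / 3) (hy₁ : lo ≤ y₁ ∧ y₁ ≤ lo + 10 / 3)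
    (hy₂ : lo ≤ y₂ ∧ y₂ ≤ lo + 10 / 3) (hy₃ : lo ≤ y₃ ∧ y₃ ≤ lo + 10 / 3)
    (hy₄ : lo ≤ y₄ ∧ y₄ ≤ lo + 10 / 3)
    (h₀₁ : 4 < sqd x₀ y₀ x₁ y₁) (h₀₂ : 4 < sqd x₀ y₀ x₂ y₂) (h₀₃ : 4 < sqd x₀ y₀ x₃ y₃)
    (h₁₂ : 4 < sqd x₁ y₁ x₂ y₂) (h₁₃ : 4 < sqd x₁ y₁ x₃ y₃) (h₁₄ : 4 < sqd x₁ y₁ x₄ y₄)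
    (h₂₃ : 4 < sqd x₂ y₂ x₃ y₃) (h₂₄ : 4 < sqd x₂ y₂ x₄ y₄) (h₃₄ : 4 < sqd x₃ y₃ x₄ y₄) :
    2 < x₀ - x₄ := by
  have key : ∀ {x y u v : ℝ}, 4 < sqd x y u v → u ≤ x → (lo ≤ y ∧ y ≤ lo + 10 / 3) →
      (lo ≤ v ∧ v ≤ lo + 10 / 3) →
      ((y ≤ lo + 5 / 3 ∧ v ≤ lo + 5 / 3) ∨ (lo + 5 / 3 ≤ y ∧ lo + 5 / 3 ≤ v)) → 1 < x - u := by
    intro x y u v hf hx hy hv h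
    apply one_lt_of_four_lt_sqd hf hx <;> rcases h with h | h <;> linarith [h.1, h.2, hy.1, hy.2]
  have k₀₁ := key h₀₁ hx₀ hy₀ hy₁
  have k₀₂ := key h₀₂ (hx₁.trans hx₀) hy₀ hy₂
  have k₀₃ := key h₀₃ (hx₂.trans (hx₁.trans hx₀)) hy₀ hy₃
  have k₁₂ := key h₁₂ hx₁ hy₁ hy₂
  have k₁₃ := key h₁₃ (hx₂.trans hx₁) hy₁ hy₃
  have k₁₄ := key h₁₄ (hx₃.trans (hx₂.trans hx₁)) hy₁ hy₄
  have k₂₃ := key h₂₃ hx₂ hy₂ hy₃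
  have k₂₄ := key h₂₄ (hx₃.trans hx₂) hy₂ hy₄
  have k₃₄ := key h₃₄ hx₃ hy₃ hy₄
  clear key h₀₁ h₀₂ h₀₃ h₁₂ h₁₃ h₁₄ h₂₃ h₂₄ h₃₄ hy₀ hy₁ hy₂ hy₃ hy₄
  -- Three of the five points lie in the same half of height `5/3`. Consecutive ones among the three
  -- are more than `1` apart horizontally, and neither of these two pairs is the extreme pair, about
  -- which nothing is assumed.
  rcases le_total y₀ (lo + 5 / 3) with a₀ | a₀ <;> rcases le_total y₁ (lo + 5 / 3) with a₁ | a₁ <;>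
  rcases le_total y₂ (lo + 5 / 3) with a₂ | a₂ <;> rcases le_total y₃ (lo + 5 / 3) with a₃ | a₃ <;>
  rcases le_total y₄ (lo + 5 / 3) with a₄ | a₄ <;>
  simp only [a₀, a₁, a₂, a₃, a₄, and_self, true_or, or_true, forall_const] at * <;> linarith

/-- Pythagoras with rational constants: in the applications `(e, c)` is a rational point just inside
the circle of radius `2`, and one coordinate difference of two far points is known to be at most
`c`. -/
lemma lt_of_four_lt {a b c e : ℝ} (h : 4 < a * a + b * b) (h₁ : -c ≤ b) (h₂ : b ≤ c) (ha : 0 ≤ a)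
    (hce : e * e + c * c ≤ 4) : e < a := by
  have hb : b * b ≤ c * c := abs_le_iff_mul_self_le.1 (abs_le.2 ⟨h₁, h₂⟩ |>.trans (le_abs_self c))
  by_contra! h'
  linarith [mul_self_le_mul_self ha h']

/-- Let `q` be the leftmost of four points of a `2 × 5/2` rectangle at mutual distance more than
`2`, two of them, `q` included, in the lower half. Then `q` has distance more than `1` from the
middle segment. -/
lemma lower_left_far {lo px py qx qy rx ry ux uy vx vy : ℝ}
    (hq : px - 1 ≤ qx) (hqr : qx ≤ rx) (hqv : qx ≤ vx) (hvu : vx ≤ ux)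
    (hr : rx ≤ px + 1) (hu : ux ≤ px + 1)
    (hqy : lo - 1 ≤ qy ∧ qy ≤ lo + 1 / 4) (hry : lo - 1 ≤ ry ∧ ry ≤ lo + 1 / 4)
    (huy : lo + 1 / 4 ≤ uy ∧ uy ≤ lo + 3 / 2) (hvy : lo + 1 / 4 ≤ vy ∧ vy ≤ lo + 3 / 2)
    (fqr : 4 < sqd qx qy rx ry) (fuv : 4 < sqd ux uy vx vy) (fqv : 4 < sqd qx qy vx vy)
    (fru : 4 < sqd rx ry ux uy) (hpy : lo ≤ py) : 1 < sqd qx qy px py := by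
  unfold sqd at *
  -- The halves have height `5/4`, and `39/25` is just below `√(4 - (5/4)²)`.
  have step₁ : 39 / 25 < rx - qx :=
    lt_of_four_lt (c := 5 / 4) (by linarith) (b := ry - qy) (by linarith) (by linarith) (by linarith)
      (by norm_num)
  have step₂ : 39 / 25 < ux - vx :=
    lt_of_four_lt (c := 5 / 4) fuv (by linarith) (by linarith) (by linarith) (by norm_num)
  -- As the rectangle has width `2`, the points `q, v` lie in its leftmost `2 - 39/25 = 11/25`, and
  -- `r, u` in its rightmost; these two pairs are therefore almost vertical.
  have step₃ : 39 / 20 < vy - qy :=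
    lt_of_four_lt (c := 11 / 25) (b := vx - qx) (by linarith) (by linarith) (by linarith)
      (by linarith) (by norm_num)
  have step₄ : 39 / 20 < uy - ry :=
    lt_of_four_lt (c := 11 / 25) (b := ux - rx) (by linarith) (by linarith) (by linarith)
      (by linarith) (by norm_num)
  -- The height is `5/2`, so `q` and `r` both lie in the lowest `5/2 - 39/20 = 11/20`, which
  -- improves the first estimate of their horizontal distance.
  have step₅ : 48 / 25 < rx - qx :=
    lt_of_four_lt (c := 11 / 20) (b := ry - qy) (by linarith) (by linarith) (by linarith)
      (by linarith) (by norm_num)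
  -- So `q` is at least `23/25` to the left of the point and at least `9/20` below it, and `(23/25)²
  -- + (9/20)² > 1`.
  have h₁ : (23 / 25) * (23 / 25) ≤ (px - qx) * (px - qx) :=
    mul_self_le_mul_self (by norm_num) (by linarith)
  have h₂ : (9 / 20) * (9 / 20) ≤ (py - qy) * (py - qy) :=
    mul_self_le_mul_self (by norm_num) (by linarith)
  norm_num at h₁ h₂
  linarith

/-- Two points at distance more than `2` in the same half of a strip of height `5/2` have abscissae
differing by more than `1`. -/
lemma one_lt_of_same_half {lo x y u v : ℝ} (hfar : 4 < sqd x y u v) (hx : u ≤ x)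
    (hy : lo - 1 ≤ y ∧ y ≤ lo + 3 / 2) (hv : lo - 1 ≤ v ∧ v ≤ lo + 3 / 2)
    (h : (y ≤ lo + 1 / 4 ∧ v ≤ lo + 1 / 4) ∨ (lo + 1 / 4 ≤ y ∧ lo + 1 / 4 ≤ v)) : 1 < x - u := by
  apply one_lt_of_four_lt_sqd hfar hx <;> rcases h with h | h <;>
    linarith [h.1, h.2, hy.1, hy.2, hv.1, hv.2]

/-- Three points in one half would have two successive gaps above `1` and exceed the width `2`. So
each half holds two of the points, which is the situation of `lower_left_far`. -/
lemma four_points_lower {lo px py x₀ y₀ x₁ y₁ x₂ y₂ x₃ y₃ : ℝ}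
    (hx₀ : x₁ ≤ x₀) (hx₁ : x₂ ≤ x₁) (hx₂ : x₃ ≤ x₂) (hp₀ : x₀ ≤ px + 1) (hp₃ : px - 1 ≤ x₃)
    (hy₀ : lo - 1 ≤ y₀ ∧ y₀ ≤ lo + 3 / 2) (hy₁ : lo - 1 ≤ y₁ ∧ y₁ ≤ lo + 3 / 2)
    (hy₂ : lo - 1 ≤ y₂ ∧ y₂ ≤ lo + 3 / 2) (hy₃ : lo - 1 ≤ y₃ ∧ y₃ ≤ lo + 3 / 2)
    (h₀₁ : 4 < sqd x₀ y₀ x₁ y₁) (h₀₂ : 4 < sqd x₀ y₀ x₂ y₂) (h₀₃ : 4 < sqd x₀ y₀ x₃ y₃)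
    (h₁₂ : 4 < sqd x₁ y₁ x₂ y₂) (h₁₃ : 4 < sqd x₁ y₁ x₃ y₃) (h₂₃ : 4 < sqd x₂ y₂ x₃ y₃)
    (hpy : lo ≤ py) (hlow : y₃ ≤ lo + 1 / 4) : 1 < sqd x₃ y₃ px py := by
  have k₀₁ := one_lt_of_same_half h₀₁ hx₀ hy₀ hy₁
  have k₀₂ := one_lt_of_same_half h₀₂ (hx₁.trans hx₀) hy₀ hy₂
  have k₀₃ := one_lt_of_same_half h₀₃ (hx₂.trans (hx₁.trans hx₀)) hy₀ hy₃
  have k₁₂ := one_lt_of_same_half h₁₂ hx₁ hy₁ hy₂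
  have k₁₃ := one_lt_of_same_half h₁₃ (hx₂.trans hx₁) hy₁ hy₃
  have k₂₃ := one_lt_of_same_half h₂₃ hx₂ hy₂ hy₃
  rw [sqd_comm] at h₀₃ h₁₃ h₂₃
  have hy₃' : lo - 1 ≤ y₃ ∧ y₃ ≤ lo + 1 / 4 := ⟨hy₃.1, hlow⟩
  rcases le_total y₀ (lo + 1 / 4) with a₀ | a₀ <;> rcases le_total y₁ (lo + 1 / 4) with a₁ | a₁ <;>
    rcases le_total y₂ (lo + 1 / 4) with a₂ | a₂ <;>
    simp only [a₀, a₁, a₂, hlow, and_self, true_or, or_true, forall_const] at k₀₁ k₀₂ k₀₃ k₁₂ k₁₃ k₂₃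
  · linarith
  · linarith
  · linarith
  · exact lower_left_far hp₃ (by linarith) (by linarith) hx₁ hp₀ (by linarith) hy₃' ⟨hy₀.1, a₀⟩
      ⟨a₁, hy₁.2⟩ ⟨a₂, hy₂.2⟩ h₀₃ h₁₂ h₂₃ h₀₁ hpy
  · linarith
  · exact lower_left_far hp₃ (by linarith) hx₂ (by linarith) (by linarith) hp₀ hy₃' ⟨hy₁.1, a₁⟩
      ⟨a₀, hy₀.2⟩ ⟨a₂, hy₂.2⟩ h₁₃ h₀₂ h₂₃ (by rwa [sqd_comm]) hpy
  · exact lower_left_far hp₃ (by linarith) (by linarith) hx₀ (by linarith) hp₀ hy₃' ⟨hy₂.1, a₂⟩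
      ⟨a₀, hy₀.2⟩ ⟨a₁, hy₁.2⟩ h₂₃ h₀₁ h₁₃ (by rwa [sqd_comm]) hpy
  · linarith

lemma sqd_neg (x y u v : ℝ) : sqd x (-y) u (-v) = sqd x y u v := by
  unfold sqd; ring

/-- The leftmost of four points of a `2 × 5/2` rectangle at mutual distance more than `2` is at
distance more than `1` from the middle segment. -/
lemma four_points {lo px py x₀ y₀ x₁ y₁ x₂ y₂ x₃ y₃ : ℝ}
    (hx₀ : x₁ ≤ x₀) (hx₁ : x₂ ≤ x₁) (hx₂ : x₃ ≤ x₂) (hp₀ : x₀ ≤ px + 1)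
    (hy₀ : lo - 1 ≤ y₀ ∧ y₀ ≤ lo + 3 / 2) (hy₁ : lo - 1 ≤ y₁ ∧ y₁ ≤ lo + 3 / 2)
    (hy₂ : lo - 1 ≤ y₂ ∧ y₂ ≤ lo + 3 / 2) (hy₃ : lo - 1 ≤ y₃ ∧ y₃ ≤ lo + 3 / 2)
    (h₀₁ : 4 < sqd x₀ y₀ x₁ y₁) (h₀₂ : 4 < sqd x₀ y₀ x₂ y₂) (h₀₃ : 4 < sqd x₀ y₀ x₃ y₃)
    (h₁₂ : 4 < sqd x₁ y₁ x₂ y₂) (h₁₃ : 4 < sqd x₁ y₁ x₃ y₃) (h₂₃ : 4 < sqd x₂ y₂ x₃ y₃)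
    (hpy : lo ≤ py ∧ py ≤ lo + 1 / 2) : 1 < sqd x₃ y₃ px py := by
  by_contra! hcov
  have hp₃ : px - 1 ≤ x₃ := by
    by_contra! h
    unfold sqd at hcov
    nlinarith [mul_self_nonneg (y₃ - py)]
  refine hcov.not_gt ?_
  rcases le_total y₃ (lo + 1 / 4) with h | h
  · exact four_points_lower hx₀ hx₁ hx₂ hp₀ hp₃ hy₀ hy₁ hy₂ hy₃ h₀₁ h₀₂ h₀₃ h₁₂ h₁₃ h₂₃ hpy.1 h
  -- Reflection in the horizontal axis moves the leftmost point to the lower half; the strip then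
  -- starts at `-(lo + 1/2)`.
  · rw [← sqd_neg]
    rw [← sqd_neg] at h₀₁ h₀₂ h₀₃ h₁₂ h₁₃ h₂₃
    refine four_points_lower (lo := -(lo + 1 / 2)) hx₀ hx₁ hx₂ hp₀ hp₃ ?_ ?_ ?_ ?_
      h₀₁ h₀₂ h₀₃ h₁₂ h₁₃ h₂₃ (by linarith) (by linarith) <;> constructor <;> linarith

/-! ### Sweeping a strip

A partial solution is the list of the pairs (disk, colour) chosen so far, the most recent first; the
disks are chosen from left to right. Only the last `A` disks of each colour are remembered. -/

/-- A strip `lo ≤ y ≤ lo + h` with its points, the centres `(X d, Y d)` of the disks `d < m`, the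
number `k` of colours and the number `A` of remembered disks. The index `m` is a dummy disk. -/
structure Strip where
  k : ℕ
  m : ℕ
  A : ℕ
  X : ℕ → ℝ
  Y : ℕ → ℝ
  lo : ℝ
  h : ℝ
  pts : Set (ℝ × ℝ)

namespace Strip

variable (G : Strip)

/-- The disks of colour `j`. -/
def ofColor (tr : List (ℕ × ℕ)) (j : ℕ) : List ℕ := (tr.filter (fun q => q.2 = j)).map Prod.fst

/-- The disk of colour `j` remembered at place `t`. -/
def slot (tr : List (ℕ × ℕ)) (j t : ℕ) : ℕ := if t < G.A then (ofColor tr j).getD t G.m else G.m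

/-- The remembered disks as one sequence, four places for each colour. -/
def dig (tr : List (ℕ × ℕ)) (i : ℕ) : ℕ := G.slot tr (i / 4) (i % 4)

/-- The most recent disk. -/
def cur (tr : List (ℕ × ℕ)) : ℕ := (tr.map Prod.fst).headD G.m

/-- The remembered disks cover the points that no disk to the right of `x` can cover. -/
def CoveredBefore (tr : List (ℕ × ℕ)) (x : ℝ) : Prop :=
  ∀ p ∈ G.pts, G.X (G.cur tr) ≤ p.1 + 1 → p.1 + 1 < x →
    ∃ i < 4 * G.k, sqd (G.X (G.dig tr i)) (G.Y (G.dig tr i)) p.1 p.2 ≤ 1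

/-- The disk `d` may be added with colour `j`. -/
structure Allowed (tr : List (ℕ × ℕ)) (d j : ℕ) : Prop where
  disk : d < G.m
  color : j < G.k
  low : G.lo - 1 ≤ G.Y d
  high : G.Y d ≤ G.lo + G.h + 1
  right : G.X (G.cur tr) ≤ G.X d
  covered : G.CoveredBefore tr (G.X d)
  far : ∀ t < 4, 4 < sqd (G.X (G.slot tr j t)) (G.Y (G.slot tr j t)) (G.X d) (G.Y d)

inductive Good : List (ℕ × ℕ) → Prop
  | nil : Good []
  | cons {tr : List (ℕ × ℕ)} {d j : ℕ} : Good tr → G.Allowed tr d j → Good ((d, j) :: tr)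

/-- What is assumed of the parameters; `B` is a bound for all abscissae. -/
structure Admissible (B : ℝ) : Prop where
  kpos : 1 ≤ G.k
  mem : (G.A = 3 ∧ G.h = 1 / 2) ∨ (G.A = 4 ∧ G.h = 4 / 3)
  dummy : G.X G.m = -B
  left : ∀ d < G.m, -B + 10 ≤ G.X d
  pts_left : ∀ p ∈ G.pts, -B + 10 ≤ p.1
  pts_right : ∀ p ∈ G.pts, p.1 + 10 ≤ B
  pts_low : ∀ p ∈ G.pts, G.lo ≤ p.2
  pts_high : ∀ p ∈ G.pts, p.2 ≤ G.lo + G.h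

/-! ### Bookkeeping of the remembered disks -/

variable {G} {B : ℝ}

lemma Admissible.three_le (hG : G.Admissible B) : 3 ≤ G.A := by
  rcases hG.mem with h | h <;> omega

lemma Admissible.le_four (hG : G.Admissible B) : G.A ≤ 4 := by
  rcases hG.mem with h | h <;> omega

lemma Admissible.h_le (hG : G.Admissible B) : G.h ≤ 4 / 3 := by
  rcases hG.mem with h | h <;> norm_num [h.2]

lemma mem_ofColor {tr : List (ℕ × ℕ)} {j d : ℕ} : d ∈ ofColor tr j ↔ (d, j) ∈ tr := by
  simp [ofColor]

lemma ofColor_cons (tr : List (ℕ × ℕ)) (d j i : ℕ) :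
    ofColor ((d, j) :: tr) i = if i = j then d :: ofColor tr i else ofColor tr i := by
  by_cases h : i = j
  · simp [ofColor, h]
  · simp [ofColor, h, Ne.symm h]

lemma slot_nil (j t : ℕ) : G.slot [] j t = G.m := by
  simp [slot, ofColor]

/-- A new disk moves the remembered disks of its colour one place on, and the one in the last place
is forgotten. `shiftState` performs this in memory. -/
lemma slot_cons (tr : List (ℕ × ℕ)) (d j i t : ℕ) :
    G.slot ((d, j) :: tr) i t = if i = j then
      (if t < G.A then (if t = 0 then d else G.slot tr j (t - 1)) else G.m) else G.slot tr i t := by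
  unfold slot
  rw [ofColor_cons]
  by_cases h : i = j
  · subst h
    by_cases ht : t < G.A
    · cases t with
      | zero => simp [ht]
      | succ t => simp [ht, show t < G.A by omega]
    · simp [ht]
  · simp [h]

lemma slot_mem {tr : List (ℕ × ℕ)} {j t : ℕ} (h : G.slot tr j t ≠ G.m) :
    (G.slot tr j t, j) ∈ tr := by
  unfold slot at h ⊢
  split_ifs at h ⊢ with ht
  · rw [← mem_ofColor]
    by_cases hl : t < (ofColor tr j).length
    · rw [List.getD_eq_getElem _ _ hl]
      exact List.getElem_mem hl
    · rw [List.getD_eq_default _ _ (by omega)] at h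
      exact absurd rfl h
  · exact absurd rfl h

lemma Good.bounds {tr : List (ℕ × ℕ)} (h : G.Good tr) : ∀ q ∈ tr, q.1 < G.m ∧ q.2 < G.k ∧
    G.lo - 1 ≤ G.Y q.1 ∧ G.Y q.1 ≤ G.lo + G.h + 1 := by
  induction h with
  | nil => simp
  | cons _ ha ih =>
    intro q hq
    rcases List.mem_cons.1 hq with rfl | hq
    · exact ⟨ha.disk, ha.color, ha.low, ha.high⟩
    · exact ih q hq

lemma Good.slot_le {tr : List (ℕ × ℕ)} (h : G.Good tr) (j t : ℕ) : G.slot tr j t ≤ G.m := by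
  by_cases hs : G.slot tr j t = G.m
  · exact hs.le
  · exact (h.bounds _ (slot_mem hs)).1.le

lemma Good.le_cur {tr : List (ℕ × ℕ)} (h : G.Good tr) : ∀ q ∈ tr, G.X q.1 ≤ G.X (G.cur tr) := by
  induction h with
  | nil => simp
  | cons _ ha ih =>
    intro q hq
    rcases List.mem_cons.1 hq with rfl | hq
    · exact le_rfl
    · exact (ih q hq).trans ha.right

lemma Good.sorted {tr : List (ℕ × ℕ)} (h : G.Good tr) :
    tr.Pairwise (fun a b => G.X b.1 ≤ G.X a.1) := by
  induction h with
  | nil => simp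
  | cons hg ha ih => exact List.pairwise_cons.2 ⟨fun q hq => (hg.le_cur q hq).trans ha.right, ih⟩

/-! ### Soundness of the sweep -/

/-- Remembering three disks of a colour suffices to keep all of them disjoint. -/
lemma far_of_far_three {l : List ℕ} {d : ℕ} {lo : ℝ} {X Y : ℕ → ℝ}
    (hs : l.Pairwise (fun a b => X b ≤ X a)) (hf : l.Pairwise (fun a b => 4 < sqd (X a) (Y a) (X b) (Y b)))
    (hd : ∀ a ∈ l, X a ≤ X d) (hY : ∀ a ∈ l, lo ≤ Y a ∧ Y a ≤ lo + 10 / 3)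
    (hYd : lo ≤ Y d ∧ Y d ≤ lo + 10 / 3)
    (h3 : ∀ t < 3, ∀ ht : t < l.length, 4 < sqd (X d) (Y d) (X l[t]) (Y l[t])) :
    ∀ a ∈ l, 4 < sqd (X d) (Y d) (X a) (Y a) := by
  match l, hs, hf, hd, hY, h3 with
  | [], _, _, _, _, _ => simp
  | [a], _, _, _, _, h3 => simpa using h3 0 (by norm_num)
  | [a, b], _, _, _, _, h3 =>
    have h0 := h3 0 (by norm_num)
    have h1 := h3 1 (by norm_num)
    simp at h0 h1
    simp [h0, h1]
  | a :: b :: c :: l, hs, hf, hd, hY, h3 =>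
    have h0 := h3 0 (by norm_num)
    have h1 := h3 1 (by norm_num)
    have h2 := h3 2 (by norm_num)
    simp at h0 h1 h2
    intro e he
    simp only [List.mem_cons] at he
    rcases he with rfl | rfl | rfl | he
    · exact h0
    · exact h1
    · exact h2
    · simp only [List.pairwise_cons, List.mem_cons, forall_eq_or_imp] at hs hf hd hY
      obtain ⟨⟨sab, sac, sa⟩, ⟨sbc, sb⟩, sc, -⟩ := hs
      obtain ⟨⟨fab, fac, fa⟩, ⟨fbc, fb⟩, fc, -⟩ := hf
      have := five_points hd.1 sab sbc (sc e he) hYd hY.1 hY.2.1 hY.2.2.1 (hY.2.2.2 e he) h0 h1 h2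
        fab fac (fa e he) fbc (fb e he) (fc e he)
      unfold sqd
      nlinarith [mul_self_nonneg (Y d - Y e)]

lemma ofColor_pairwise {R : ℕ → ℕ → Prop} {tr : List (ℕ × ℕ)} {j : ℕ}
    (h : tr.Pairwise (fun a b => a.2 = j → b.2 = j → R a.1 b.1)) : (ofColor tr j).Pairwise R := by
  unfold ofColor
  rw [List.pairwise_map, List.pairwise_filter]
  simpa using h

/-- An addition is tested only against remembered disks; since at least three are remembered and the
centres lie in a window of height `h + 2 ≤ 10/3`, `far_of_far_three` extends the test to the whole
colour class. -/
lemma Good.far (hG : G.Admissible B) {tr : List (ℕ × ℕ)} (h : G.Good tr) :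
    tr.Pairwise (fun a b => a.2 = b.2 → 4 < sqd (G.X a.1) (G.Y a.1) (G.X b.1) (G.Y b.1)) := by
  induction h with
  | nil => simp
  | @cons tr d j hg ha ih =>
    refine List.pairwise_cons.2 ⟨?_, ih⟩
    rintro ⟨a, i⟩ hq (rfl : j = i)
    have hh := hG.h_le
    have hb : ∀ a ∈ ofColor tr j, _ := fun a ha => hg.bounds _ (mem_ofColor.1 ha)
    refine far_of_far_three (lo := G.lo - 1) (l := ofColor tr j)
      (ofColor_pairwise (hg.sorted.imp fun h _ _ => h))
      (ofColor_pairwise (ih.imp fun h h₁ h₂ => h (h₁.trans h₂.symm)))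
      (fun a h => (hg.le_cur _ (mem_ofColor.1 h)).trans ha.right)
      (fun a h => ⟨(hb a h).2.2.1, by linarith [(hb a h).2.2.2]⟩)
      ⟨ha.low, by linarith [ha.high]⟩ (fun t ht hl => ?_) a (mem_ofColor.2 hq)
    have := ha.far t (by omega)
    have h3 := hG.three_le
    unfold slot at this
    rwa [if_pos (by omega), List.getD_eq_getElem _ _ hl, sqd_comm] at this

lemma Admissible.dummy_far (hG : G.Admissible B) {p : ℝ × ℝ} (hp : p ∈ G.pts) :
    1 < sqd (G.X G.m) (G.Y G.m) p.1 p.2 := by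
  rw [hG.dummy]
  have := hG.pts_left p hp
  unfold sqd
  nlinarith [mul_self_nonneg (G.Y G.m - p.2)]

/-- The dummy disk lies too far to the left to cover a point, so the covering place holds a disk
that was really chosen. -/
lemma CoveredBefore.exists_mem (hG : G.Admissible B) {tr : List (ℕ × ℕ)} {x : ℝ}
    (h : G.CoveredBefore tr x) {p : ℝ × ℝ} (hp : p ∈ G.pts) (h₁ : G.X (G.cur tr) ≤ p.1 + 1)
    (h₂ : p.1 + 1 < x) : ∃ q ∈ tr, sqd (G.X q.1) (G.Y q.1) p.1 p.2 ≤ 1 := by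
  obtain ⟨i, -, hi⟩ := h p hp h₁ h₂
  refine ⟨_, slot_mem (t := i % 4) (j := i / 4) fun hm => ?_, hi⟩
  unfold dig at hi
  rw [hm] at hi
  exact hi.not_gt (hG.dummy_far hp)

/-- Coverage of a point is tested by the addition that moves the sweep past `p.1 + 1`, the last
abscissa at which a disk can cover it. -/
lemma Good.covered (hG : G.Admissible B) {tr : List (ℕ × ℕ)} (h : G.Good tr) {p : ℝ × ℝ}
    (hp : p ∈ G.pts) (hx : p.1 + 1 < G.X (G.cur tr)) :
    ∃ q ∈ tr, sqd (G.X q.1) (G.Y q.1) p.1 p.2 ≤ 1 := by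
  induction h with
  | nil =>
    simp [cur, hG.dummy] at hx
    linarith [hG.pts_left p hp]
  | @cons tr d j hg ha ih =>
    rcases lt_or_ge (p.1 + 1) (G.X (G.cur tr)) with h | h
    · obtain ⟨q, hq, hc⟩ := ih h
      exact ⟨q, List.mem_cons_of_mem _ hq, hc⟩
    · obtain ⟨q, hq, hc⟩ := ha.covered.exists_mem hG hp h hx
      exact ⟨q, List.mem_cons_of_mem _ hq, hc⟩

/-- A complete partial solution covers all points of the strip. -/
lemma Good.covers (hG : G.Admissible B) {tr : List (ℕ × ℕ)} (h : G.Good tr)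
    (hB : G.CoveredBefore tr B) {p : ℝ × ℝ} (hp : p ∈ G.pts) :
    ∃ q ∈ tr, sqd (G.X q.1) (G.Y q.1) p.1 p.2 ≤ 1 := by
  rcases lt_or_ge (p.1 + 1) (G.X (G.cur tr)) with h' | h'
  · exact h.covered hG hp h'
  · exact hB.exists_mem hG hp h' (by linarith [hG.pts_right p hp])

/-! ### Completeness of the sweep -/

/-- A family of pairs (disk, colour), sorted from right to left, that solves the strip. -/
structure Solves (L : List (ℕ × ℕ)) : Prop where
  bounds : ∀ q ∈ L, q.1 < G.m ∧ q.2 < G.k ∧ G.lo - 1 ≤ G.Y q.1 ∧ G.Y q.1 ≤ G.lo + G.h + 1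
  sorted : L.Pairwise (fun a b => G.X b.1 ≤ G.X a.1)
  far : L.Pairwise (fun a b => a.2 = b.2 → 4 < sqd (G.X a.1) (G.Y a.1) (G.X b.1) (G.Y b.1))
  covers : ∀ p ∈ G.pts, ∃ q ∈ L, sqd (G.X q.1) (G.Y q.1) p.1 p.2 ≤ 1

/-- A disk covering a point is still remembered when the sweep has passed all disks that can cover
the point. -/
lemma exists_dig (hG : G.Admissible B) {tr : List (ℕ × ℕ)}
    (hb : ∀ q ∈ tr, q.1 < G.m ∧ q.2 < G.k ∧ G.lo - 1 ≤ G.Y q.1 ∧ G.Y q.1 ≤ G.lo + G.h + 1)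
    (hs : tr.Pairwise (fun a b => G.X b.1 ≤ G.X a.1))
    (hf : tr.Pairwise (fun a b => a.2 = b.2 → 4 < sqd (G.X a.1) (G.Y a.1) (G.X b.1) (G.Y b.1)))
    {p : ℝ × ℝ} (hp : p ∈ G.pts) (hx : ∀ q ∈ tr, G.X q.1 ≤ p.1 + 1) {q : ℕ × ℕ} (hq : q ∈ tr)
    (hc : sqd (G.X q.1) (G.Y q.1) p.1 p.2 ≤ 1) : ∃ i < 4 * G.k, G.dig tr i = q.1 := by
  obtain ⟨d, j⟩ := q
  obtain ⟨i, hi, hid⟩ := List.getElem_of_mem (mem_ofColor.2 hq)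
  have hs' : (ofColor tr j).Pairwise (fun a b => G.X b ≤ G.X a) :=
    ofColor_pairwise (hs.imp fun h _ _ => h)
  have hf' : (ofColor tr j).Pairwise (fun a b => 4 < sqd (G.X a) (G.Y a) (G.X b) (G.Y b)) :=
    ofColor_pairwise (hf.imp fun h h₁ h₂ => h (h₁.trans h₂.symm))
  have hb' : ∀ a ∈ ofColor tr j, _ := fun a ha => hb _ (mem_ofColor.1 ha)
  have hx' : ∀ a ∈ ofColor tr j, _ := fun a ha => hx _ (mem_ofColor.1 ha)
  rw [List.pairwise_iff_getElem] at hs' hf'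
  have hlt : i < G.A := by
    by_contra! hA
    have h3 := hG.three_le
    have m0 := List.getElem_mem (l := ofColor tr j) (n := 0) (by omega)
    have m1 := List.getElem_mem (l := ofColor tr j) (n := 1) (by omega)
    have m2 := List.getElem_mem (l := ofColor tr j) (n := 2) (by omega)
    have m4 := List.getElem_mem hi
    have s01 := hs' 0 1 (by omega) (by omega) (by omega)
    have s12 := hs' 1 2 (by omega) (by omega) (by omega)
    have f01 := hf' 0 1 (by omega) (by omega) (by omega)
    have f02 := hf' 0 2 (by omega) (by omega) (by omega)
    have f12 := hf' 1 2 (by omega) (by omega) (by omega)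
    have f0 := hf' 0 i (by omega) (by omega) (by omega)
    have f1 := hf' 1 i (by omega) (by omega) (by omega)
    have f2 := hf' 2 i (by omega) (by omega) (by omega)
    have s2 := hs' 2 i (by omega) (by omega) (by omega)
    have hlo := hG.pts_low p hp
    have hhi := hG.pts_high p hp
    rw [← hid] at hc
    rcases hG.mem with ⟨hA', hh⟩ | ⟨hA', hh⟩ <;> rw [hh] at hb' hhi
    -- Height `1/2`, three disks remembered: the disk and three later ones of its colour are the
    -- points of `four_points`, so the disk misses the point.
    · have e : G.lo + 1 / 2 + 1 = G.lo + 3 / 2 := by ring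
      rw [e] at hb'
      exact hc.not_gt (four_points s01 s12 s2 (hx' _ m0) (hb' _ m0).2.2 (hb' _ m1).2.2
        (hb' _ m2).2.2 (hb' _ m4).2.2 f01 f02 f0 f12 f1 f2 ⟨hlo, hhi⟩)
    -- Height `4/3`, four disks remembered: by `five_points` the disk lies more than `2` to the left
    -- of the last one, hence more than `1` to the left of the point.
    · have e : G.lo + 4 / 3 + 1 = (G.lo - 1) + 10 / 3 := by ring
      rw [e] at hb'
      have m3 := List.getElem_mem (l := ofColor tr j) (n := 3) (by omega)
      have s23 := hs' 2 3 (by omega) (by omega) (by omega)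
      have s3 := hs' 3 i (by omega) (by omega) (by omega)
      have f03 := hf' 0 3 (by omega) (by omega) (by omega)
      have f13 := hf' 1 3 (by omega) (by omega) (by omega)
      have f23 := hf' 2 3 (by omega) (by omega) (by omega)
      have f3 := hf' 3 i (by omega) (by omega) (by omega)
      have := five_points s01 s12 s23 s3 (hb' _ m0).2.2 (hb' _ m1).2.2
        (hb' _ m2).2.2 (hb' _ m3).2.2 (hb' _ m4).2.2 f01 f02 f03 f12 f13 f1 f23 f2 f3
      have hx0 := hx' _ m0
      unfold sqd at hc
      nlinarith [mul_self_nonneg (G.Y (ofColor tr j)[i] - p.2)]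
  have h4 := hG.le_four
  refine ⟨4 * j + i, by have := (hb _ hq).2.1; simp only at this; omega, ?_⟩
  unfold dig slot
  rw [show (4 * j + i) / 4 = j by omega, show (4 * j + i) % 4 = i by omega, if_pos hlt,
    List.getD_eq_getElem _ _ hi, hid]

/-- A disk covering a point with `p.1 + 1 < x` has abscissa below `x`, so it belongs to the left
part `tr`; no disk of `tr` is beyond the reach of the point, so `exists_dig` finds it among the
remembered ones. -/
lemma Solves.coveredBefore (hG : G.Admissible B) {pre tr : List (ℕ × ℕ)} {x : ℝ}
    (h : G.Solves (pre ++ tr)) (hpre : ∀ q ∈ pre, x ≤ G.X q.1) : G.CoveredBefore tr x := by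
  intro p hp h₁ h₂
  obtain ⟨q, hq, hc⟩ := h.covers p hp
  have hqx : G.X q.1 ≤ p.1 + 1 := by
    unfold sqd at hc
    by_contra! hcon
    nlinarith [mul_self_nonneg (G.Y q.1 - p.2)]
  have hs := (List.pairwise_append.1 h.sorted).2.1
  have hqt : q ∈ tr := by
    rcases List.mem_append.1 hq with hq | hq
    · linarith [hpre q hq]
    · exact hq
  have hcur : ∀ q ∈ tr, G.X q.1 ≤ p.1 + 1 := by
    cases tr with
    | nil => simp
    | cons a tr =>
      intro q hq
      refine le_trans ?_ h₁
      rcases List.mem_cons.1 hq with rfl | hq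
      · exact le_rfl
      · exact (List.pairwise_cons.1 hs).1 q hq
  obtain ⟨i, hi, hid⟩ := exists_dig hG (fun q hq => h.bounds q (List.mem_append_right _ hq)) hs
    (List.pairwise_append.1 h.far).2.1 hp hcur hqt hc
  exact ⟨i, hi, by rwa [hid]⟩

/-- Every initial part of a solution is found by the sweep. -/
lemma Solves.good (hG : G.Admissible B) {pre tr : List (ℕ × ℕ)} (h : G.Solves (pre ++ tr)) :
    G.Good tr := by
  induction tr generalizing pre with
  | nil => exact .nil
  | cons q tr ih =>
    obtain ⟨d, j⟩ := q
    have h' : G.Solves ((pre ++ [(d, j)]) ++ tr) := by simpa using h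
    have hb := h.bounds (d, j) (by simp)
    have hs := (List.pairwise_append.1 h.sorted)
    have hf := (List.pairwise_append.1 h.far).2.1
    refine .cons (ih h') ⟨hb.1, hb.2.1, hb.2.2.1, hb.2.2.2, ?_, h'.coveredBefore hG ?_, ?_⟩
    · cases tr with
      | nil =>
        simp only [cur, List.map_nil, List.headD_nil, hG.dummy]
        linarith [hG.left d hb.1]
      | cons a tr => exact (List.pairwise_cons.1 hs.2.1).1 a (by simp)
    · intro q hq
      rcases List.mem_append.1 hq with hq | hq
      · exact hs.2.2 q hq (d, j) (by simp)
      · simp only [List.mem_singleton] at hq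
        rw [hq]
    · intro t ht
      -- An unoccupied place holds the dummy, which is at least `10` to the left of every disk and
      -- passes the test for free.
      by_cases hm : G.slot tr j t = G.m
      · rw [hm, hG.dummy]
        have := hG.left d hb.1
        unfold sqd
        nlinarith [mul_self_nonneg (G.Y G.m - G.Y d)]
      · have := (List.pairwise_cons.1 hf).1 _ (slot_mem hm) rfl
        rwa [sqd_comm] at this

/-! ### The remembered disks determine the continuation -/

/-- The position of the sweep can be read off the remembered disks. -/
lemma Good.cur_eq_sup (hG : G.Admissible B) {tr : List (ℕ × ℕ)} (h : G.Good tr) :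
    (∀ j < G.k, G.X (G.slot tr j 0) ≤ G.X (G.cur tr)) ∧
      ∃ j < G.k, G.X (G.slot tr j 0) = G.X (G.cur tr) := by
  have h3 := hG.three_le
  induction h with
  | nil => exact ⟨fun j _ => by simp [slot_nil, cur], 0, hG.kpos, by simp [slot_nil, cur]⟩
  | @cons tr d j hg ha ih =>
    refine ⟨fun i hi => ?_, j, ha.color, ?_⟩
    · rw [slot_cons]
      split_ifs
      · rfl
      · omega
      · omega
      · exact (ih.1 i hi).trans ha.right
    · rw [slot_cons, if_pos rfl, if_pos (by omega), if_pos rfl]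
      rfl

lemma slot_eq_of_dig_eq (hG : G.Admissible B) {tr tr' : List (ℕ × ℕ)}
    (h : ∀ i < 4 * G.k, G.dig tr i = G.dig tr' i) {j t : ℕ} (hj : j < G.k) :
    G.slot tr j t = G.slot tr' j t := by
  by_cases ht : t < 4
  · have := h (4 * j + t) (by omega)
    unfold dig at this
    rwa [show (4 * j + t) / 4 = j by omega, show (4 * j + t) % 4 = t by omega] at this
  · have := hG.le_four
    simp [slot, show ¬ t < G.A by omega]

lemma cur_eq_of_dig_eq (hG : G.Admissible B) {tr tr' : List (ℕ × ℕ)} (hg : G.Good tr)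
    (hg' : G.Good tr') (h : ∀ i < 4 * G.k, G.dig tr i = G.dig tr' i) :
    G.X (G.cur tr) = G.X (G.cur tr') := by
  obtain ⟨h₁, j, hj, hj'⟩ := hg.cur_eq_sup hG
  obtain ⟨h₂, i, hi, hi'⟩ := hg'.cur_eq_sup hG
  apply le_antisymm
  · rw [← hj', slot_eq_of_dig_eq hG h hj]
    exact h₂ j hj
  · rw [← hi', ← slot_eq_of_dig_eq hG h hi]
    exact h₁ i hi

lemma CoveredBefore.congr (hG : G.Admissible B) {tr tr' : List (ℕ × ℕ)} (hg : G.Good tr)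
    (hg' : G.Good tr') (h : ∀ i < 4 * G.k, G.dig tr i = G.dig tr' i) {x : ℝ}
    (hc : G.CoveredBefore tr x) : G.CoveredBefore tr' x := by
  intro p hp h₁ h₂
  rw [← cur_eq_of_dig_eq hG hg hg' h] at h₁
  obtain ⟨i, hi, hi'⟩ := hc p hp h₁ h₂
  exact ⟨i, hi, by rwa [← h i hi]⟩

/-- All conditions on an addition refer to the remembered disks and the position of the sweep, and
the latter is the maximal abscissa among the most recent disks of the colours. Partial solutions
remembered alike are therefore interchangeable. -/
lemma Allowed.congr (hG : G.Admissible B) {tr tr' : List (ℕ × ℕ)} (hg : G.Good tr)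
    (hg' : G.Good tr') (h : ∀ i < 4 * G.k, G.dig tr i = G.dig tr' i) {d j : ℕ}
    (ha : G.Allowed tr d j) : G.Allowed tr' d j where
  disk := ha.disk
  color := ha.color
  low := ha.low
  high := ha.high
  right := by rw [← cur_eq_of_dig_eq hG hg hg' h]; exact ha.right
  covered := ha.covered.congr hG hg hg' h
  far t ht := by rw [← slot_eq_of_dig_eq hG h ha.color]; exact ha.far t ht

lemma dig_cons_congr (hG : G.Admissible B) {tr tr' : List (ℕ × ℕ)}
    (h : ∀ i < 4 * G.k, G.dig tr i = G.dig tr' i) {d j : ℕ} :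
    ∀ i < 4 * G.k, G.dig ((d, j) :: tr) i = G.dig ((d, j) :: tr') i := by
  intro i hi
  unfold dig
  rw [slot_cons, slot_cons]
  split_ifs with h₁
  · rfl
  · exact slot_eq_of_dig_eq hG h (by omega)
  · rfl
  · exact slot_eq_of_dig_eq hG h (by omega)

/-- A family of partial solutions closed under all allowed additions, up to what is remembered,
contains a complete one if the strip has a solution. -/
lemma Solves.exists_complete (hG : G.Admissible B) {T : List (List (ℕ × ℕ))} {L : List (ℕ × ℕ)}
    (hL : G.Solves L) (hgood : ∀ t ∈ T, G.Good t) (hnil : [] ∈ T)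
    (hclosed : ∀ t ∈ T, ∀ d j, G.Allowed t d j →
      ∃ t' ∈ T, ∀ i < 4 * G.k, G.dig t' i = G.dig ((d, j) :: t) i) :
    ∃ t ∈ T, G.CoveredBefore t B := by
  -- Induction along the construction of `tr`: each addition is also allowed for the representative
  -- in `T`, and the closure of `T` supplies a representative of the result.
  have key : ∀ tr, G.Good tr → ∃ t ∈ T, ∀ i < 4 * G.k, G.dig tr i = G.dig t i := by
    intro tr htr
    induction htr with
    | nil => exact ⟨[], hnil, fun _ _ => rfl⟩
    | @cons tr d j hg ha ih =>
      obtain ⟨t, ht, he⟩ := ih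
      obtain ⟨t', ht', he'⟩ := hclosed t ht d j (ha.congr hG hg (hgood t ht) he)
      exact ⟨t', ht', fun i hi => (dig_cons_congr hG he i hi).trans (he' i hi).symm⟩
  have hg : G.Good L := Solves.good (pre := []) hG (by simpa using hL)
  obtain ⟨t, ht, he⟩ := key L hg
  refine ⟨t, ht, CoveredBefore.congr hG hg (hgood t ht) he ?_⟩
  exact Solves.coveredBefore (pre := []) hG (by simpa using hL) (by simp)

end Strip

/-! ### Reasoning about programs -/

/-- Started in `σ`, the program `p` halts after at most `T` steps in a store satisfying `Q`. -/
def Ends (p : Prog) (σ : Store) (T : ℕ) (Q : Store → Prop) : Prop :=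
  ∃ t σ', t ≤ T ∧ Runs p σ t σ' ∧ Q σ'

infixr:60 ";;" => Prog.seq

/-- The instruction sequence `l`. -/
def block : List Instr → Prog
  -- There is no empty program; variable `99` is scratch space that no instruction of the algorithm
  -- reads.
  | [] => .instr (.intConst 99 0)
  | [i] => .instr i
  | i :: j :: l => .instr i ;; block (j :: l)

/-- Repeat `p`, counting the integer variable `c` down; variable `3` is supposed to hold `1`. -/
def repeatN (c : ℕ) (p : Prog) : Prog := .loop (.intLe 3 c) (p ;; .instr (.intSub c c 3))

def Instr.intTarget : Instr → List ℕ
  | .intConst x _ | .intAdd x _ _ | .intSub x _ _ | .intLoad x _ _ => [x]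
  | _ => []

def Instr.realTarget : Instr → List ℕ
  | .realConst x _ | .realAdd x _ _ | .realSub x _ _ | .realMul x _ _ | .realDiv x _ _
  | .realLoad x _ _ => [x]
  | _ => []

def Instr.intArrTarget : Instr → List ℕ
  | .intStore a _ _ => [a]
  | _ => []

def Instr.realArrTarget : Instr → List ℕ
  | .realStore a _ _ => [a]
  | _ => []

/-- The targets, in the sense of `f`, of the instructions of a program. -/
def Prog.targets (f : Instr → List ℕ) : Prog → List ℕ
  | .instr i => f i
  | .seq p q => p.targets f ++ q.targets f
  | .ite _ p q => p.targets f ++ q.targets f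
  | .loop _ p => p.targets f

/-! ### Frame conditions -/

/-- `σ'` agrees with `σ` outside of the listed integer and real variables and arrays. -/
structure Same (wi wr wa wb : List ℕ) (σ σ' : Store) : Prop where
  iv : ∀ x, x ∉ wi → σ'.intVar x = σ.intVar x
  rv : ∀ x, x ∉ wr → σ'.realVar x = σ.realVar x
  ia : ∀ x, x ∉ wa → σ'.intArr x = σ.intArr x
  ra : ∀ x, x ∉ wb → σ'.realArr x = σ.realArr x

/-- The program writes only to the listed integer and real variables and arrays. -/
structure Prog.Writes (p : Prog) (wi wr wa wb : List ℕ) : Prop where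
  i : p.targets Instr.intTarget ⊆ wi
  r : p.targets Instr.realTarget ⊆ wr
  a : p.targets Instr.intArrTarget ⊆ wa
  b : p.targets Instr.realArrTarget ⊆ wb

def Prog.writesB (p : Prog) (wi wr wa wb : List ℕ) : Bool :=
  ((p.targets Instr.intTarget).all fun x => wi.contains x) &&
  ((p.targets Instr.realTarget).all fun x => wr.contains x) &&
  ((p.targets Instr.intArrTarget).all fun x => wa.contains x) &&
  ((p.targets Instr.realArrTarget).all fun x => wb.contains x)

lemma Prog.writes_of {p : Prog} {wi wr wa wb : List ℕ} (h : p.writesB wi wr wa wb = true) :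
    p.Writes wi wr wa wb := by
  simp only [Prog.writesB, Bool.and_eq_true, List.all_eq_true, List.contains_iff_mem] at h
  exact ⟨h.1.1.1, h.1.1.2, h.1.2, h.2⟩

section

variable {wi wr wa wb : List ℕ} {σ σ₁ σ₂ : Store}

lemma Same.refl (σ : Store) : Same wi wr wa wb σ σ :=
  ⟨fun _ _ => rfl, fun _ _ => rfl, fun _ _ => rfl, fun _ _ => rfl⟩

lemma Same.trans (h : Same wi wr wa wb σ σ₁) (h' : Same wi wr wa wb σ₁ σ₂) :
    Same wi wr wa wb σ σ₂ :=
  ⟨fun x hx => (h'.iv x hx).trans (h.iv x hx), fun x hx => (h'.rv x hx).trans (h.rv x hx),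
    fun x hx => (h'.ia x hx).trans (h.ia x hx), fun x hx => (h'.ra x hx).trans (h.ra x hx)⟩

lemma Same.mono {wi' wr' wa' wb' : List ℕ} (h : Same wi wr wa wb σ σ₁) (hi : wi ⊆ wi')
    (hr : wr ⊆ wr') (ha : wa ⊆ wa') (hb : wb ⊆ wb') : Same wi' wr' wa' wb' σ σ₁ :=
  ⟨fun x hx => h.iv x fun hm => hx (hi hm), fun x hx => h.rv x fun hm => hx (hr hm),
    fun x hx => h.ia x fun hm => hx (ha hm), fun x hx => h.ra x fun hm => hx (hb hm)⟩

lemma Instr.same (i : Instr) (σ : Store) :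
    Same i.intTarget i.realTarget i.intArrTarget i.realArrTarget σ (i.exec σ) := by
  cases i <;> constructor <;> intro x hx <;>
    simp_all [Instr.exec, Instr.intTarget, Instr.realTarget, Instr.intArrTarget,
      Instr.realArrTarget, setEntry]

/-- What a run can change is bounded by the targets occurring in the program text, whatever the
course of the run. -/
lemma Runs.same {p : Prog} {t : ℕ} (h : Runs p σ t σ₁) (hw : p.Writes wi wr wa wb) :
    Same wi wr wa wb σ σ₁ := by
  induction h with
  | instr i σ => exact (i.same σ).mono hw.i hw.r hw.a hw.b
  | seq _ _ ih₁ ih₂ =>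
    obtain ⟨hi, hr, ha, hb⟩ := hw
    simp only [Prog.targets, List.append_subset] at hi hr ha hb
    exact (ih₁ ⟨hi.1, hr.1, ha.1, hb.1⟩).trans (ih₂ ⟨hi.2, hr.2, ha.2, hb.2⟩)
  | iteTrue _ _ ih =>
    obtain ⟨hi, hr, ha, hb⟩ := hw
    simp only [Prog.targets, List.append_subset] at hi hr ha hb
    exact ih ⟨hi.1, hr.1, ha.1, hb.1⟩
  | iteFalse _ _ ih =>
    obtain ⟨hi, hr, ha, hb⟩ := hw
    simp only [Prog.targets, List.append_subset] at hi hr ha hb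
    exact ih ⟨hi.2, hr.2, ha.2, hb.2⟩
  | loopDone _ => exact Same.refl _
  | loopStep _ _ _ ih₁ ih₂ => exact (ih₁ ⟨hw.i, hw.r, hw.a, hw.b⟩).trans (ih₂ hw)

end

/-! ### Proof rules with step bounds -/

namespace Ends

variable {p q : Prog} {σ : Store} {T T₁ T₂ : ℕ} {P Q : Store → Prop} {b : Test}

lemma mono (h : Ends p σ T₁ P) (hT : T₁ ≤ T) (hQ : ∀ σ', P σ' → Q σ') : Ends p σ T Q := by
  obtain ⟨t, σ', ht, hr, hp⟩ := h
  exact ⟨t, σ', ht.trans hT, hr, hQ σ' hp⟩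

/-- The side condition is a Boolean computed from the program text, so for concrete programs `rfl`
proves it. -/
lemma frame (h : Ends p σ T Q) {wi wr wa wb : List ℕ} (hw : p.writesB wi wr wa wb = true) :
    Ends p σ T (fun σ' => Same wi wr wa wb σ σ' ∧ Q σ') := by
  obtain ⟨t, σ', ht, hr, hp⟩ := h
  exact ⟨t, σ', ht, hr, hr.same (Prog.writes_of hw), hp⟩

lemma bind (h : Ends p σ T₁ P) (hq : ∀ σ', P σ' → Ends q σ' T₂ Q) (hT : T₁ + T₂ ≤ T) :
    Ends (p ;; q) σ T Q := by
  obtain ⟨t, σ', ht, hr, hp⟩ := h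
  obtain ⟨u, σ'', hu, hr', hq'⟩ := hq σ' hp
  exact ⟨t + u, σ'', by omega, .seq hr hr', hq'⟩

lemma instr {i : Instr} (h : Q (i.exec σ)) : Ends (.instr i) σ 1 Q := ⟨1, _, le_rfl, .instr i σ, h⟩

lemma block {l : List Instr} (hT : l.length ≤ T) (h1 : 1 ≤ T) (hl : l ≠ [])
    (h : Q (l.foldl Instr.exec σ)) : Ends (block l) σ T Q := by
  induction l generalizing σ T with
  | nil => exact absurd rfl hl
  | cons i l ih =>
    cases l with
    | nil => exact (Ends.instr h).mono h1 fun _ h => h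
    | cons j l =>
      refine Ends.bind (T₁ := 1) (T₂ := T - 1) (P := fun σ' => σ' = i.exec σ) (Ends.instr rfl) ?_
        (by omega)
      rintro _ rfl
      exact ih (by simp at hT ⊢; omega) (by simp at hT; omega) (by simp) h

lemma ite (hp : b.Holds σ → Ends p σ T₁ Q) (hq : ¬ b.Holds σ → Ends q σ T₁ Q) (hT : T₁ + 1 ≤ T) :
    Ends (.ite b p q) σ T Q := by
  by_cases h : b.Holds σ
  · obtain ⟨t, σ', ht, hr, hp⟩ := hp h
    exact ⟨t + 1, σ', by omega, .iteTrue h hr, hp⟩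
  · obtain ⟨t, σ', ht, hr, hp⟩ := hq h
    exact ⟨t + 1, σ', by omega, .iteFalse h hr, hp⟩

/-- Loops with an invariant that records the time left. -/
lemma loop (Inv : ℕ → Store → Prop) (h0 : Inv T σ) (hdone : ∀ r σ, Inv r σ → ¬ b.Holds σ → 1 ≤ r ∧ Q σ)
    (hstep : ∀ r σ, Inv r σ → b.Holds σ →
      ∃ T r', T + r' + 1 ≤ r ∧ Ends p σ T (Inv r')) : Ends (.loop b p) σ T Q := by
  induction T using Nat.strong_induction_on generalizing σ with
  | _ T ih =>
    by_cases h : b.Holds σ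
    · obtain ⟨T', r', hr, t, σ', ht, hrun, hinv⟩ := hstep T σ h0 h
      obtain ⟨u, σ'', hu, hrun', hQ⟩ := ih r' (by omega) hinv
      exact ⟨t + u + 1, σ'', by omega, .loopStep h hrun hrun', hQ⟩
    · exact ⟨1, σ, (hdone T σ h0 h).1, .loopDone h, (hdone T σ h0 h).2⟩

/-- Counted loops. -/
lemma repeatN {c N : ℕ} (Inv : ℕ → Store → Prop) (wi wr wa wb : List ℕ)
    (hw : (repeatN c p).writesB wi wr wa wb = true) (h3 : wi.contains 3 = false)
    (hcp : (p.targets Instr.intTarget).contains c = false)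
    (h1 : σ.intVar 3 = 1) (hc : σ.intVar c = N) (h0 : Inv 0 σ)
    (hInv : ∀ i σ v, Inv i σ → Inv i { σ with intVar := Function.update σ.intVar c v })
    (hstep : ∀ i < N, ∀ σ', Same wi wr wa wb σ σ' → Inv i σ' → Ends p σ' T₁ (Inv (i + 1)))
    (hT : N * (T₁ + 2) + 1 ≤ T) :
    Ends (repeatN c p) σ T (fun σ' => Same wi wr wa wb σ σ' ∧ Inv N σ') := by
  refine Ends.frame ?_ hw
  refine Ends.mono (T₁ := N * (T₁ + 2) + 1) (P := Inv N) ?_ hT fun _ h => h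
  have hW := Prog.writes_of hw
  have hc_mem : c ∈ wi := by
    apply hW.i
    simp [CDUDC.repeatN, Prog.targets, Instr.intTarget]
  -- A round costs the body, one test and one decrement, hence `T₁ + 2`; the final `1` is the
  -- failing test.
  refine Ends.loop (fun r σ' => ∃ i ≤ N, r = (N - i) * (T₁ + 2) + 1 ∧ Same wi wr wa wb σ σ' ∧
    Inv i σ' ∧ σ'.intVar c = N - i) ⟨0, by omega, by simp, Same.refl _, h0, by simpa using hc⟩ ?_ ?_
  · rintro r σ' ⟨i, hi, rfl, hs, hinv, hci⟩ hb
    refine ⟨by omega, ?_⟩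
    have := hs.iv 3 (by simpa using h3)
    simp only [Test.Holds, this, h1, hci] at hb
    rwa [show N = i by omega]
  · rintro r σ' ⟨i, hi, rfl, hs, hinv, hci⟩ hb
    have h3' := hs.iv 3 (by simpa using h3)
    simp only [Test.Holds, h3', h1, hci] at hb
    refine ⟨T₁ + 1, (N - (i + 1)) * (T₁ + 2) + 1, ?_, ?_⟩
    · obtain ⟨r, hr⟩ : ∃ r, N - i = r + 1 := ⟨N - i - 1, by omega⟩
      rw [hr, show N - (i + 1) = r by omega]
      ring_nf
      omega
    · obtain ⟨t, σ'', ht, hrun, hinv'⟩ := hstep i (by omega) σ' hs hinv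
      have hs' : Same (p.targets Instr.intTarget) (p.targets Instr.realTarget)
        (p.targets Instr.intArrTarget) (p.targets Instr.realArrTarget) σ' σ'' :=
        hrun.same ⟨List.Subset.refl _, List.Subset.refl _, List.Subset.refl _, List.Subset.refl _⟩
      have hrun' := Runs.seq hrun (.instr (.intSub c c 3) σ'')
      refine ⟨t + 1, _, by omega, hrun', i + 1, by omega, rfl, ?_, ?_, ?_⟩
      · exact hs.trans (hrun'.same ⟨hW.i, hW.r, hW.a, hW.b⟩)
      · exact hInv _ _ _ hinv'
      · have e1 : σ''.intVar c = N - i := by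
          rw [hs'.iv c (by simpa using hcp), hci]
        have e2 : σ''.intVar 3 = 1 := by
          have : Same wi wr wa wb σ' σ'' := hrun.same
            ⟨fun x hx => hW.i (by simp [CDUDC.repeatN, Prog.targets, hx]),
             fun x hx => hW.r (by simp [CDUDC.repeatN, Prog.targets, hx]),
             fun x hx => hW.a (by simp [CDUDC.repeatN, Prog.targets, hx]),
             fun x hx => hW.b (by simp [CDUDC.repeatN, Prog.targets, hx])⟩
          rw [this.iv 3 (by simpa using h3), h3', h1]
        simp [Instr.exec, e1, e2]
        omega

end Ends

lemma setEntry_apply {β : Type} (A : ℕ → ℕ → β) (a i : ℕ) (v : β) (a' i' : ℕ) :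
    setEntry A a i v a' i' = if a' = a ∧ i' = i then v else A a' i' := by
  unfold setEntry
  by_cases h : a' = a
  · subst h
    by_cases h' : i' = i <;> simp [h']
  · simp [h]

/-! ### The program: memory layout -/

notation "viN" => (0 : ℕ)
notation "viM" => (1 : ℕ)
notation "viK" => (2 : ℕ)
notation "viOne" => (3 : ℕ)
notation "viBase" => (4 : ℕ)
notation "viDigits" => (5 : ℕ)
notation "viFour" => (6 : ℕ)
notation "viClasses" => (7 : ℕ)
notation "viLong" => (8 : ℕ)
notation "viZero" => (9 : ℕ)
notation "viNearC" => (10 : ℕ)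
notation "viNearI" => (11 : ℕ)
notation "viFlag" => (12 : ℕ)
notation "viTmp" => (13 : ℕ)
notation "viPtsC" => (14 : ℕ)
notation "viPtsI" => (15 : ℕ)
notation "viOk" => (16 : ℕ)
notation "viPt" => (17 : ℕ)
notation "viDiskC" => (18 : ℕ)
notation "viDisk" => (19 : ℕ)
notation "viColC" => (20 : ℕ)
notation "viCol" => (21 : ℕ)
notation "viColFour" => (22 : ℕ)
notation "viCopyC" => (23 : ℕ)
notation "viSrc" => (24 : ℕ)
notation "viDst" => (25 : ℕ)
notation "viCode" => (27 : ℕ)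
notation "viRow" => (28 : ℕ)
notation "viHead" => (29 : ℕ)
notation "viHeadPos" => (30 : ℕ)
notation "viTail" => (31 : ℕ)
notation "viTailPos" => (32 : ℕ)
notation "viAcc" => (33 : ℕ)
notation "viStamp" => (34 : ℕ)
notation "viCount" => (35 : ℕ)
notation "viShift" => (36 : ℕ)
notation "viClass" => (37 : ℕ)
notation "viGo" => (38 : ℕ)
notation "viBack" => (39 : ℕ)
notation "viTmpA" => (40 : ℕ)
notation "viTmpB" => (41 : ℕ)
notation "viNext" => (42 : ℕ)

notation "vrTau" => (0 : ℕ)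
notation "vrOne" => (1 : ℕ)
notation "vrHeight" => (3 : ℕ)
notation "vrBound" => (4 : ℕ)
notation "vrBot" => (5 : ℕ)
notation "vrLast" => (6 : ℕ)
notation "vrTop" => (7 : ℕ)
notation "vrLow" => (8 : ℕ)
notation "vrHigh" => (9 : ℕ)
notation "vrCur" => (10 : ℕ)
notation "vrLim" => (11 : ℕ)
notation "vrUx" => (12 : ℕ)
notation "vrUy" => (13 : ℕ)
notation "vrRad" => (14 : ℕ)
notation "vrX" => (15 : ℕ)
notation "vrY" => (16 : ℕ)

notation "aiOut" => (0 : ℕ)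
notation "aiList" => (1 : ℕ)
notation "aiQueue" => (2 : ℕ)
notation "aiDisk" => (3 : ℕ)
notation "aiCol" => (4 : ℕ)
notation "aiParent" => (5 : ℕ)
notation "aiSeen" => (6 : ℕ)
notation "aiPow" => (7 : ℕ)

notation "arPx" => (0 : ℕ)
notation "arPy" => (1 : ℕ)
notation "arCx" => (2 : ℕ)
notation "arCy" => (3 : ℕ)

/-- The empty program. -/
def skip : Prog := block []

lemma Ends.skip {σ : Store} {T : ℕ} {Q : Store → Prop} (hT : 1 ≤ T)
    (h : Q { σ with intVar := Function.update σ.intVar 99 0 }) : Ends skip σ T Q :=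
  (Ends.instr h).mono hT fun _ h => h

/-! ### Distance and coverage tests -/

/-- Is one of the disks in the given part of the queue near to the given point? -/
def near : Prog :=
  block [.intConst viFlag 0] ;; repeatN viNearC (
    block [.intLoad viTmp aiQueue viNearI, .realLoad vrX arCx viTmp, .realLoad vrY arCy viTmp,
      .realSub vrX vrX vrUx, .realSub vrY vrY vrUy, .realMul vrX vrX vrX, .realMul vrY vrY vrY,
      .realAdd vrX vrX vrY, .intAdd viNearI viNearI viOne] ;;
    .ite (.realLe vrX vrRad) (block [.intConst viFlag 1]) skip)

lemma near_spec {σ : Store} {L a : ℕ} (h1 : σ.intVar viOne = 1) (hc : σ.intVar viNearC = L)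
    (ha : σ.intVar viNearI = a) :
    Ends near σ (13 * L + 2) (fun σ' =>
      Same [viFlag, viNearC, viNearI, viTmp, 99] [vrX, vrY] [] [] σ σ' ∧
      (1 ≤ σ'.intVar viFlag ↔ ∃ i < L, sqd (σ.realArr arCx (σ.intArr aiQueue (a + i)))
        (σ.realArr arCy (σ.intArr aiQueue (a + i))) (σ.realVar vrUx) (σ.realVar vrUy) ≤
          σ.realVar vrRad)) := by
  refine Ends.mono (Ends.frame (wi := [viFlag, viNearC, viNearI, viTmp, 99]) (wr := [vrX, vrY])
    (wa := []) (wb := []) (Ends.bind (T := 13 * L + 2) (T₁ := 1) (T₂ := 13 * L + 1)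
      (Ends.frame (wi := [viFlag]) (wr := []) (wa := []) (wb := [])
        (Ends.block (Q := fun σ' => σ'.intVar viFlag = 0) (by simp) (by simp) (by simp)
          (by simp [Instr.exec])) rfl) ?_ (by omega)) rfl) le_rfl fun _ h => h
  rintro σ₁ ⟨s, hf⟩
  refine Ends.mono (Ends.repeatN (N := L) (T₁ := 11) (fun i σ' => σ'.intVar viNearI = a + i ∧
    (1 ≤ σ'.intVar viFlag ↔ ∃ j < i, sqd (σ.realArr arCx (σ.intArr aiQueue (a + j)))
        (σ.realArr arCy (σ.intArr aiQueue (a + j))) (σ.realVar vrUx) (σ.realVar vrUy) ≤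
          σ.realVar vrRad)) [viFlag, viNearC, viNearI, viTmp, 99] [vrX, vrY] [] [] rfl rfl rfl
    ?_ ?_ ?_ ?_ ?_ le_rfl) (by omega) fun _ h => h.2.2
  · simp [s.iv, h1]
  · simp [s.iv, hc]
  · simp [s.iv, ha, hf]
  · intro i σ v h; simpa using h
  · rintro i hi σ₂ s₂ ⟨hx, hfl⟩
    refine Ends.bind (T₁ := 9) (T₂ := 2) (P := fun σ' => σ'.intVar viNearI = a + (i + 1) ∧
      σ'.intVar viFlag = σ₂.intVar viFlag ∧ σ'.realVar vrRad = σ.realVar vrRad ∧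
      σ'.realVar vrX = sqd (σ.realArr arCx (σ.intArr aiQueue (a + i)))
        (σ.realArr arCy (σ.intArr aiQueue (a + i))) (σ.realVar vrUx) (σ.realVar vrUy))
      (Ends.block (by simp) (by simp) (by simp) ?_) ?_ (by omega)
    · simp [Instr.exec, hx, s₂.iv, s₂.rv, s₂.ia, s₂.ra, s.iv, s.rv, s.ia,
        s.ra, h1, sqd]
      omega
    · rintro σ₃ ⟨h₁, h₂, h₃, h₄⟩
      refine Ends.ite (T₁ := 1) (fun hb => Ends.block (by simp) (by simp) (by simp) ?_)
        (fun hb => Ends.skip (by simp) ?_) (by omega)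
      · simp only [Test.Holds, h₃, h₄] at hb
        simpa [Instr.exec, h₁] using ⟨i, by omega, hb⟩
      · simp only [Test.Holds, h₃, h₄] at hb
        simp only [Nat.exists_lt_succ_right]
        simp [h₁, h₂, hfl, hb]

/-- Do the disks remembered at the head of the queue cover the points of the strip between the
current position and the given limit? -/
def checkPts : Prog :=
  block [.intConst viOk 1, .intAdd viPtsC viCount viZero, .intConst viPtsI 0] ;; repeatN viPtsC (
    block [.intLoad viPt aiList viPtsI, .intAdd viPtsI viPtsI viOne, .realLoad vrUx arPx viPt,
      .realLoad vrUy arPy viPt, .realAdd vrX vrUx vrOne] ;;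
    .ite (.realLe vrCur vrX) (.ite (.realLe vrLim vrX) skip (
      block [.intAdd viNearI viHeadPos viZero, .intAdd viNearC viDigits viZero,
        .realConst vrRad 1] ;; near ;; .ite (.intLe viOne viFlag) skip (block [.intConst viOk 0])))
      skip)

lemma checkPts_spec {σ : Store} {L cnt a : ℕ} (h1 : σ.intVar viOne = 1) (h0 : σ.intVar viZero = 0)
    (hr1 : σ.realVar vrOne = 1) (hc : σ.intVar viCount = cnt) (ha : σ.intVar viHeadPos = a)
    (hL : σ.intVar viDigits = L) :
    Ends checkPts σ (cnt * (13 * L + 16) + 4) (fun σ' =>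
      Same [viFlag, viNearC, viNearI, viTmp, 99, viOk, viPtsC, viPtsI, viPt]
        [vrX, vrY, vrUx, vrUy, vrRad] [] [] σ σ' ∧
      (1 ≤ σ'.intVar viOk ↔ ∀ i < cnt,
        σ.realVar vrCur ≤ σ.realArr arPx (σ.intArr aiList i) + 1 →
        σ.realArr arPx (σ.intArr aiList i) + 1 < σ.realVar vrLim →
        ∃ t < L, sqd (σ.realArr arCx (σ.intArr aiQueue (a + t)))
          (σ.realArr arCy (σ.intArr aiQueue (a + t))) (σ.realArr arPx (σ.intArr aiList i))
          (σ.realArr arPy (σ.intArr aiList i)) ≤ 1)) := by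
  refine Ends.frame (Ends.bind (T₁ := 3) (T₂ := cnt * (13 * L + 16) + 1)
      (Ends.frame (wi := [viOk, viPtsC, viPtsI]) (wr := []) (wa := []) (wb := [])
        (Ends.block (Q := fun σ' => σ'.intVar viOk = 1 ∧ σ'.intVar viPtsC = cnt ∧
          σ'.intVar viPtsI = 0) (by simp) (by simp) (by simp)
          (by simp [Instr.exec, hc, h0])) rfl) ?_ (by omega)) rfl
  rintro σ₁ ⟨s, hok, hcn, hix⟩
  refine Ends.mono (Ends.repeatN (N := cnt) (T₁ := 13 * L + 14) (fun i σ' =>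
    σ'.intVar viPtsI = i ∧ (1 ≤ σ'.intVar viOk ↔ ∀ i' < i,
        σ.realVar vrCur ≤ σ.realArr arPx (σ.intArr aiList i') + 1 →
        σ.realArr arPx (σ.intArr aiList i') + 1 < σ.realVar vrLim →
        ∃ t < L, sqd (σ.realArr arCx (σ.intArr aiQueue (a + t)))
          (σ.realArr arCy (σ.intArr aiQueue (a + t))) (σ.realArr arPx (σ.intArr aiList i'))
          (σ.realArr arPy (σ.intArr aiList i')) ≤ 1))
    [viFlag, viNearC, viNearI, viTmp, 99, viOk, viPtsC, viPtsI, viPt]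
        [vrX, vrY, vrUx, vrUy, vrRad] [] [] rfl rfl rfl ?_ hcn ?_ ?_ ?_ le_rfl) (le_of_eq (by ring))
        fun _ h => h.2.2
  · simp [s.iv, h1]
  · simp [hix, hok]
  · intro i σ v h; simpa using h
  · rintro i hi σ₂ s₂ ⟨hx, hfl⟩
    simp only [Nat.forall_lt_succ_right]
    set px := σ.realArr arPx (σ.intArr aiList i) with hpx
    set py := σ.realArr arPy (σ.intArr aiList i) with hpy
    refine Ends.bind (T₁ := 5) (T₂ := 13 * L + 9) (P := fun σ' =>
      Same [viPt, viPtsI] [vrUx, vrUy, vrX] [] [] σ₂ σ' ∧ σ'.intVar viPtsI = i + 1 ∧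
      σ'.realVar vrUx = px ∧ σ'.realVar vrUy = py ∧ σ'.realVar vrX = px + 1)
      (Ends.frame (Ends.block (by simp) (by simp) (by simp) ?_) rfl) ?_ (by omega)
    · simp [Instr.exec, hx, s₂.iv, s₂.rv, s₂.ia, s₂.ra, s.iv, s.rv, s.ia, s.ra, h1, hr1, hpx, hpy]
    · rintro σ₃ ⟨s₃, e₁, e₂, e₃, e₄⟩
      refine Ends.ite (T₁ := 13 * L + 8) (fun hb => ?_) (fun hb => ?_) (by omega)
      · simp [Test.Holds, e₄, s₃.rv, s₂.rv, s.rv] at hb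
        refine Ends.ite (T₁ := 13 * L + 7) (fun hb' => ?_) (fun hb' => ?_) (by omega)
        · simp [Test.Holds, e₄, s₃.rv, s₂.rv, s.rv] at hb'
          refine Ends.skip (by omega) ?_
          simp [e₁, s₃.iv, hfl, hb'.not_gt]
        · simp [Test.Holds, e₄, s₃.rv, s₂.rv, s.rv] at hb'
          refine Ends.bind (T₁ := 3) (T₂ := 13 * L + 4) (P := fun σ' =>
            Same [viNearI, viNearC] [vrRad] [] [] σ₃ σ' ∧ σ'.intVar viNearI = a ∧
              σ'.intVar viNearC = L ∧ σ'.realVar vrRad = 1)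
            (Ends.frame (Ends.block (by simp) (by simp) (by simp) ?_) rfl) ?_ (by omega)
          · simp [Instr.exec, s₃.iv, s₂.iv, s.iv, ha, hL, h0]
          rintro σ₄ ⟨s₄, f₁, f₂, f₃⟩
          refine Ends.bind (near_spec (L := L) (a := a) (by simp [s₄.iv, s₃.iv, s₂.iv, s.iv, h1]) f₂ f₁)
            (T₂ := 2) ?_ (by omega)
          rintro σ₅ ⟨s₅, hnear⟩
          simp only [f₃, s₄.ra, s₄.ia, s₃.ra, s₃.ia, s₂.ra, s₂.ia, s.ra, s.ia, List.not_mem_nil,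
            not_false_eq_true] at hnear
          rw [s₄.rv _ (by simp), s₄.rv _ (by simp), e₂, e₃] at hnear
          refine Ends.ite (T₁ := 1) (fun hb'' => Ends.skip le_rfl ?_)
            (fun hb'' => Ends.block (by simp) (by simp) (by simp) ?_) (by omega)
          · simp only [Test.Holds] at hb''
            rw [s₅.iv _ (by simp), s₄.iv _ (by simp), s₃.iv _ (by simp), s₂.iv _ (by simp),
              s.iv _ (by simp), h1, hnear] at hb''
            simp only [Function.update_apply]
            simp [s₅.iv, s₄.iv, e₁, s₃.iv, hfl, hb'']
          · simp only [Test.Holds] at hb''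
            rw [s₅.iv _ (by simp), s₄.iv _ (by simp), s₃.iv _ (by simp), s₂.iv _ (by simp),
              s.iv _ (by simp), h1, hnear] at hb''
            simp only [List.foldl, Instr.exec, Function.update_apply]
            simp [s₅.iv, s₄.iv, e₁, hb'', hb, hb']
      · simp [Test.Holds, e₄, s₃.rv, s₂.rv, s.rv] at hb
        refine Ends.skip (by omega) ?_
        simp [e₁, s₃.iv, hfl, hb.not_ge]

/-! ### The program: adding a state to the queue -/

/-- Copy the state at the head of the queue to the end. -/
def copyState : Prog :=
  block [.intAdd viSrc viHeadPos viZero, .intAdd viDst viTailPos viZero,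
    .intAdd viCopyC viDigits viZero] ;;
  repeatN viCopyC (block [.intLoad viTmp aiQueue viSrc, .intStore aiQueue viDst viTmp,
    .intAdd viSrc viSrc viOne, .intAdd viDst viDst viOne])

/-- By `a + L ≤ b` source and target do not overlap, so copying forwards never reads an overwritten
entry. -/
lemma copyState_spec {σ : Store} {L a b : ℕ} (h1 : σ.intVar viOne = 1) (h0 : σ.intVar viZero = 0)
    (ha : σ.intVar viHeadPos = a) (hb : σ.intVar viTailPos = b) (hL : σ.intVar viDigits = L)
    (hab : a + L ≤ b) :
    Ends copyState σ (6 * L + 4) (fun σ' =>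
      Same [viSrc, viDst, viCopyC, viTmp] [] [aiQueue] [] σ σ' ∧
      (∀ i < L, σ'.intArr aiQueue (b + i) = σ.intArr aiQueue (a + i)) ∧
      ∀ x < b, σ'.intArr aiQueue x = σ.intArr aiQueue x) := by
  refine Ends.frame (Ends.bind (T₁ := 3) (T₂ := 6 * L + 1)
      (Ends.frame (wi := [viSrc, viDst, viCopyC]) (wr := []) (wa := []) (wb := [])
        (Ends.block (Q := fun σ' => σ'.intVar viSrc = a ∧ σ'.intVar viDst = b ∧
          σ'.intVar viCopyC = L) (by simp) (by simp) (by simp)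
          (by simp [Instr.exec, ha, hb, hL, h0])) rfl) ?_ (by omega)) rfl
  rintro σ₁ ⟨s, e₁, e₂, e₃⟩
  refine Ends.mono (Ends.repeatN (N := L) (T₁ := 4) (fun i σ' =>
    σ'.intVar viSrc = a + i ∧ σ'.intVar viDst = b + i ∧
    (∀ i' < i, σ'.intArr aiQueue (b + i') = σ.intArr aiQueue (a + i')) ∧
      ∀ x < b, σ'.intArr aiQueue x = σ.intArr aiQueue x)
    [viSrc, viDst, viCopyC, viTmp] [] [aiQueue] [] rfl rfl rfl ?_ e₃ ?_ ?_ ?_ le_rfl)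
    (le_of_eq (by ring)) fun _ h => h.2.2.2
  · simp [s.iv, h1]
  · simp [e₁, e₂, s.ia]
  · intro i σ v h; simpa using h
  · rintro i hi σ₂ s₂ ⟨f₁, f₂, f₃, f₄⟩
    have o : σ₂.intVar 3 = 1 := by simp [s₂.iv, s.iv, h1]
    refine Ends.block (by simp) (by simp) (by simp) ⟨?_, ?_, ?_, ?_⟩
    · simp [Instr.exec, f₁, o]; omega
    · simp [Instr.exec, f₂, o]; omega
    · intro i' hi'
      simp only [List.foldl, Instr.exec, setEntry_apply, Function.update_apply]
      simp only [f₁, f₂]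
      by_cases h : i' = i
      · simp [h, f₄ (a + i) (by omega)]
      · simp [h, f₃ i' (by omega)]
    · intro x hx
      simp [Instr.exec, setEntry_apply, f₂, show x ≠ b + i by omega, f₄ x hx]

/-- Add the disk to the copied state. -/
def shiftState : Prog :=
  block [.intAdd viDst viTailPos viColFour, .intLoad viTmp aiQueue viDst,
    .intStore aiQueue viDst viDisk, .intAdd viDst viDst viOne, .intLoad viTmpA aiQueue viDst,
    .intStore aiQueue viDst viTmp, .intAdd viDst viDst viOne, .intLoad viTmpB aiQueue viDst,
    .intStore aiQueue viDst viTmpA, .intAdd viDst viDst viOne] ;;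
  .ite (.intLe viOne viLong) (block [.intStore aiQueue viDst viTmpB])
    (block [.intStore aiQueue viDst viM])

/-- Every colour owns four places whatever `A` is. If `A = 3`, `viLong` is `0` and the fourth place
is reset to the dummy index `m`, so that only three disks count. -/
lemma shiftState_spec {σ : Store} {b j4 : ℕ} (h1 : σ.intVar viOne = 1)
    (hb : σ.intVar viTailPos = b) (hj : σ.intVar viColFour = j4) :
    Ends shiftState σ 12 (fun σ' =>
      Same [viDst, viTmp, viTmpA, viTmpB] [] [aiQueue] [] σ σ' ∧
      ∀ x, σ'.intArr aiQueue x = if x = b + j4 then σ.intVar viDisk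
        else if x = b + j4 + 1 ∨ x = b + j4 + 2 then σ.intArr aiQueue (x - 1)
        else if x = b + j4 + 3 then
          (if 1 ≤ σ.intVar viLong then σ.intArr aiQueue (x - 1) else σ.intVar viM)
        else σ.intArr aiQueue x) := by
  refine Ends.frame (Ends.bind (T₁ := 10) (T₂ := 2)
      (Ends.frame (wi := [viDst, viTmp, viTmpA, viTmpB]) (wr := []) (wa := [aiQueue]) (wb := [])
        (Ends.block (Q := fun σ' => σ'.intVar viDst = b + j4 + 3 ∧
          σ'.intVar viTmpB = σ.intArr aiQueue (b + j4 + 2) ∧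
          ∀ x, σ'.intArr aiQueue x = if x = b + j4 then σ.intVar viDisk
            else if x = b + j4 + 1 ∨ x = b + j4 + 2 then σ.intArr aiQueue (x - 1)
            else σ.intArr aiQueue x) (by simp) (by simp) (by simp)
          ?_) rfl) ?_ (by omega)) rfl
  · simp [Instr.exec, hb, hj, h1, setEntry_apply]
    refine ⟨by omega, fun x => ?_⟩
    split_ifs with h₁ h₂ h₃ h₄ h₅ <;> first | omega | skip
    all_goals subst_vars; simp
  · rintro σ₁ ⟨s, e₁, e₂, e₃⟩
    refine Ends.ite (T₁ := 1) (fun hb => Ends.block (by simp) (by simp) (by simp) ?_)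
      (fun hb => Ends.block (by simp) (by simp) (by simp) ?_) (by omega)
    · simp [Test.Holds, s.iv, h1] at hb
      intro x
      simp only [List.foldl, Instr.exec, setEntry_apply, e₁, e₂, e₃, hb]
      split_ifs with h₁ h₂ h₃ h₄ h₅ <;> first | omega | skip
      all_goals simp_all
    · simp [Test.Holds, s.iv, h1] at hb
      intro x
      simp only [List.foldl, Instr.exec, setEntry_apply, e₁, e₃, hb]
      split_ifs with h₁ h₂ h₃ h₄ h₅ <;> first | omega | skip
      all_goals simp_all [s.iv]

/-- Compute the code of the state at the end of the queue. -/
def encode : Prog :=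
  block [.intConst viCode 0, .intConst viRow 0, .intAdd viSrc viTailPos viZero,
    .intAdd viCopyC viDigits viZero] ;;
  repeatN viCopyC (block [.intLoad viTmp aiQueue viSrc, .intAdd viTmp viTmp viRow,
    .intLoad viTmp aiPow viTmp, .intAdd viCode viCode viTmp, .intAdd viRow viRow viBase,
    .intAdd viSrc viSrc viOne])

/-- Integers cannot be multiplied on this machine: the product of a digit and a power of the base is
looked up in the table `aiPow`, where row `i` starts at `i * M`. -/
lemma encode_spec {σ : Store} {L b M : ℕ} (h1 : σ.intVar viOne = 1) (h0 : σ.intVar viZero = 0)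
    (hb : σ.intVar viTailPos = b) (hL : σ.intVar viDigits = L) (hM : σ.intVar viBase = M)
    (hpow : ∀ i < L, ∀ v < M, σ.intArr aiPow (i * M + v) = v * M ^ i)
    (hq : ∀ i < L, σ.intArr aiQueue (b + i) < M) :
    Ends encode σ (8 * L + 5) (fun σ' =>
      Same [viCode, viRow, viSrc, viCopyC, viTmp] [] [] [] σ σ' ∧
      σ'.intVar viCode = ∑ i ∈ Finset.range L, σ.intArr aiQueue (b + i) * M ^ i) := by
  refine Ends.frame (Ends.bind (T₁ := 4) (T₂ := 8 * L + 1)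
      (Ends.frame (wi := [viSrc, viCode, viRow, viCopyC]) (wr := []) (wa := []) (wb := [])
        (Ends.block (Q := fun σ' => σ'.intVar viSrc = b ∧ σ'.intVar viCode = 0 ∧
          σ'.intVar viRow = 0 ∧ σ'.intVar viCopyC = L) (by simp) (by simp) (by simp)
          (by simp [Instr.exec, hb, hL, h0])) rfl) ?_ (by omega)) rfl
  rintro σ₁ ⟨s, e₁, e₂, e₃, e₄⟩
  refine Ends.mono (Ends.repeatN (N := L) (T₁ := 6) (fun i σ' =>
    σ'.intVar viSrc = b + i ∧ σ'.intVar viRow = i * M ∧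
    σ'.intVar viCode = ∑ i' ∈ Finset.range i, σ.intArr aiQueue (b + i') * M ^ i')
    [viCode, viRow, viSrc, viCopyC, viTmp] [] [] [] rfl rfl rfl ?_ e₄ ?_ ?_ ?_ le_rfl)
    (le_of_eq (by ring)) fun _ h => h.2.2.2
  · simp [s.iv, h1]
  · simp [e₁, e₂, e₃]
  · intro i σ v h; simpa using h
  · rintro i hi σ₂ s₂ ⟨f₁, f₂, f₃⟩
    refine Ends.block (by simp) (by simp) (by simp) ?_
    have := hpow i hi _ (hq i hi)
    rw [add_comm] at this
    simp [Instr.exec, f₁, f₂, f₃, s₂.iv, s₂.ia, s.iv, s.ia, h1, hM, this, Finset.sum_range_succ]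
    constructor
    · omega
    · ring

/-! ### The program: one step of the search -/

/-- Uniqueness of digits in base `M`: reduce modulo `M` for the lowest digit, cancel `M`, and
continue. -/
lemma digits_injective {M L : ℕ} {f g : ℕ → ℕ} (hf : ∀ i < L, f i < M) (hg : ∀ i < L, g i < M)
    (h : ∑ i ∈ Finset.range L, f i * M ^ i = ∑ i ∈ Finset.range L, g i * M ^ i) :
    ∀ i < L, f i = g i := by
  induction L generalizing f g with
  | zero => simp
  | succ L ih =>
    have e : ∀ f : ℕ → ℕ, ∑ i ∈ Finset.range (L + 1), f i * M ^ i =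
        f 0 + M * ∑ i ∈ Finset.range L, f (i + 1) * M ^ i := by
      intro f
      rw [Finset.sum_range_succ', Finset.mul_sum, add_comm]
      simp only [pow_zero, mul_one, add_right_inj]
      exact Finset.sum_congr rfl fun i _ => by ring
    rw [e, e] at h
    have hM : 0 < M := lt_of_le_of_lt (Nat.zero_le _) (hf 0 (by omega))
    have h0 : f 0 = g 0 := by
      have := congrArg (· % M) h
      simpa [Nat.add_mul_mod_self_left, Nat.mod_eq_of_lt (hf 0 (by omega)),
        Nat.mod_eq_of_lt (hg 0 (by omega))] using this
    rw [h0] at h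
    have h' := Nat.eq_of_mul_eq_mul_left hM (Nat.add_left_cancel h)
    intro i hi
    cases i with
    | zero => exact h0
    | succ i =>
      exact ih (f := fun i => f (i + 1)) (g := fun i => g (i + 1)) (fun i hi => hf _ (by omega))
        (fun i hi => hg _ (by omega)) h' i (by omega)

/-- The code of what is remembered. -/
def Strip.code (G : Strip) (tr : List (ℕ × ℕ)) : ℕ :=
  ∑ i ∈ Finset.range (4 * G.k), G.dig tr i * (G.m + 1) ^ i

/-- The part of the store that does not change during the search in the strip `G`. -/
structure Setup (G : Strip) (B : ℝ) (cnt stamp : ℕ) (σ : Store) : Prop where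
  one : σ.intVar viOne = 1
  zero : σ.intVar viZero = 0
  m : σ.intVar viM = G.m
  k : σ.intVar viK = G.k
  base : σ.intVar viBase = G.m + 1
  digits : σ.intVar viDigits = 4 * G.k
  four : σ.intVar viFour = 4
  long : 1 ≤ σ.intVar viLong ↔ G.A = 4
  count : σ.intVar viCount = cnt
  stamp : σ.intVar viStamp = stamp
  rone : σ.realVar vrOne = 1
  bound : σ.realVar vrBound = B
  low : σ.realVar vrLow = G.lo - 1
  high : σ.realVar vrHigh = G.lo + G.h + 1
  X : σ.realArr arCx = G.X
  Y : σ.realArr arCy = G.Y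
  pts : G.pts = {p | ∃ i < cnt, p = (σ.realArr arPx (σ.intArr aiList i),
    σ.realArr arPy (σ.intArr aiList i))}
  pow : ∀ i < 4 * G.k, ∀ v < G.m + 1,
    σ.intArr aiPow (i * (G.m + 1) + v) = v * (G.m + 1) ^ i

/-- The four lists are the variables and arrays that `Setup` reads; that a program avoids them is
again decided by `rfl`. -/
lemma Setup.of_same {G : Strip} {B : ℝ} {cnt stamp : ℕ} {σ σ' : Store} (h : Setup G B cnt stamp σ)
    {wi wr wa wb : List ℕ} (s : Same wi wr wa wb σ σ')
    (hi : [3, 9, 1, 2, 4, 5, 6, 8, 35, 34].all (fun x => !wi.contains x) = true)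
    (hr : [1, 4, 8, 9].all (fun x => !wr.contains x) = true)
    (ha : [1, 7].all (fun x => !wa.contains x) = true)
    (hb : [0, 1, 2, 3].all (fun x => !wb.contains x) = true) : Setup G B cnt stamp σ' := by
  simp only [List.all_cons, List.all_nil, Bool.and_true, Bool.and_eq_true, Bool.not_eq_true',
    ← Bool.not_eq_true, List.contains_iff_mem] at hi hr ha hb
  constructor <;> first
    | (rw [s.iv _ (by tauto)]; cases h; assumption)
    | (rw [s.rv _ (by tauto)]; cases h; assumption)
    | (simp only [s.ra _ hb.1, s.ra _ hb.2.1, s.ra _ hb.2.2.1, s.ra _ hb.2.2.2, s.ia _ ha.1,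
        s.ia _ ha.2]; cases h; assumption)

/-- The contents of the queue: the partial solutions found so far. -/
structure QueueInv (G : Strip) (stamp : ℕ) (trs : List (List (ℕ × ℕ))) (σ : Store) : Prop where
  tail : σ.intVar viTail = trs.length
  tailPos : σ.intVar viTailPos = trs.length * (4 * G.k)
  queue : ∀ e < trs.length, ∀ i < 4 * G.k,
    σ.intArr aiQueue (e * (4 * G.k) + i) = G.dig (trs.getD e []) i
  disk : ∀ e < trs.length, σ.intArr aiDisk e = G.cur (trs.getD e [])
  first : trs.getD 0 [] = []
  ne_nil : trs ≠ []
  parent : ∀ e < trs.length, 1 ≤ e → σ.intArr aiParent e < e ∧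
    trs.getD e [] = (σ.intArr aiDisk e, σ.intArr aiCol e) :: trs.getD (σ.intArr aiParent e) []
  good : ∀ t ∈ trs, G.Good t
  -- The initial empty solution is never entered in the table, hence the tail here and the extra `1`
  -- in `QueueInv.length_le`.
  seen : ∀ c, σ.intArr aiSeen c = stamp ↔ ∃ t ∈ trs.tail, G.code t = c
  seen_le : ∀ c, σ.intArr aiSeen c ≤ stamp
  nodup : (trs.tail.map G.code).Nodup

/-- The arrays and variables in which the queue is kept. -/
lemma QueueInv.of_same {G : Strip} {stamp : ℕ} {trs : List (List (ℕ × ℕ))} {σ σ' : Store}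
    (h : QueueInv G stamp trs σ) {wi wr wa wb : List ℕ} (s : Same wi wr wa wb σ σ')
    (hi : [31, 32].all (fun x => !wi.contains x) = true)
    (ha : [3, 4, 5, 6].all (fun x => !wa.contains x) = true)
    (hq : ∀ x < trs.length * (4 * G.k), σ'.intArr aiQueue x = σ.intArr aiQueue x) :
    QueueInv G stamp trs σ' := by
  simp only [List.all_cons, List.all_nil, Bool.and_true, Bool.and_eq_true, Bool.not_eq_true',
    ← Bool.not_eq_true, List.contains_iff_mem] at hi ha
  obtain ⟨h₁, h₂, h₃, h₄, h₅, h₆, h₇, h₈, h₉, h₁₀, h₁₁⟩ := h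
  constructor <;> first
    | assumption
    | simp only [s.iv _ hi.1, s.iv _ hi.2, s.ia _ ha.1, s.ia _ ha.2.1, s.ia _ ha.2.2.1,
        s.ia _ ha.2.2.2]; assumption
    | skip
  intro e he i hi
  rw [hq _ ?_, h₃ e he i hi]
  have : (e + 1) * (4 * G.k) ≤ trs.length * (4 * G.k) := Nat.mul_le_mul_right _ he
  rw [add_mul] at this
  omega

/-- Enter the new state into the queue. -/
def append : Prog :=
  block [.intStore aiSeen viCode viStamp, .intStore aiDisk viTail viDisk,
    .intStore aiCol viTail viCol, .intStore aiParent viTail viHead, .intAdd viTail viTail viOne,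
    .intAdd viTailPos viTailPos viDigits]

/-- The code of the new state does not yet carry the current stamp, which is exactly what keeps the
codes in the queue distinct. -/
lemma append_spec {G : Strip} {B : ℝ} {cnt stamp : ℕ} {trs : List (List (ℕ × ℕ))} {σ : Store}
    {e d j : ℕ} (hS : Setup G B cnt stamp σ) (hQ : QueueInv G stamp trs σ)
    (hd : σ.intVar viDisk = d) (hj : σ.intVar viCol = j) (he : σ.intVar viHead = e)
    (hel : e < trs.length) (ha : G.Allowed (trs.getD e []) d j)
    (hq : ∀ i < 4 * G.k, σ.intArr aiQueue (trs.length * (4 * G.k) + i) =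
      G.dig ((d, j) :: trs.getD e []) i)
    (hcode : σ.intVar viCode = G.code ((d, j) :: trs.getD e []))
    (hnew : σ.intArr aiSeen (σ.intVar viCode) ≠ stamp) :
    Ends append σ 6 (fun σ' => Same [viTail, viTailPos] [] [aiSeen, aiDisk, aiCol, aiParent] [] σ σ' ∧
      QueueInv G stamp (trs ++ [(d, j) :: trs.getD e []]) σ') := by
  refine Ends.frame (Ends.block (by simp) (by simp) (by simp) ?_) rfl
  set t := (d, j) :: trs.getD e [] with ht
  have hne : trs ≠ [] := hQ.ne_nil
  have hpos : 0 < trs.length := List.length_pos_iff.2 hne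
  have hget : ∀ e' < trs.length, (trs ++ [t]).getD e' [] = trs.getD e' [] := by
    intro e' he'
    simp [List.getD, List.getElem?_append_left he']
  have hget' : (trs ++ [t]).getD trs.length [] = t := by simp [List.getD]
  have htail : (trs ++ [t]).tail = trs.tail ++ [t] := List.tail_append_of_ne_nil hne
  have hmem : trs.getD e [] ∈ trs := by
    rw [List.getD_eq_getElem _ _ hel]
    exact List.getElem_mem hel
  constructor
  · simp [Instr.exec, hQ.tail, hS.one]
  · simp [Instr.exec, hQ.tailPos, hS.digits]
    ring
  · intro e' he' i hi
    simp only [List.length_append, List.length_singleton] at he'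
    rcases Nat.lt_succ_iff_lt_or_eq.1 he' with h | rfl
    · rw [hget e' h, ← hQ.queue e' h i hi]
      simp [Instr.exec, setEntry_apply]
    · rw [hget', ← hq i hi]
      simp [Instr.exec, setEntry_apply]
  · intro e' he'
    simp only [List.length_append, List.length_singleton] at he'
    rcases Nat.lt_succ_iff_lt_or_eq.1 he' with h | rfl
    · rw [hget e' h, ← hQ.disk e' h]
      simp [Instr.exec, setEntry_apply, hQ.tail, h.ne]
    · rw [hget']
      simp [Instr.exec, setEntry_apply, hQ.tail, hd, ht, Strip.cur]
  · rw [hget 0 hpos, hQ.first]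
  · simp
  · intro e' he' h1
    simp only [List.length_append, List.length_singleton] at he'
    rcases Nat.lt_succ_iff_lt_or_eq.1 he' with h | rfl
    · have := hQ.parent e' h h1
      simp [Instr.exec, setEntry_apply, hQ.tail, h.ne, this, -List.getD_eq_getElem?_getD]
      rw [hget e' h, hget _ (by omega), this.2]
    · simp [Instr.exec, setEntry_apply, hQ.tail, hd, hj, he, hel, -List.getD_eq_getElem?_getD]
      rw [hget', hget _ hel, ht]
  · intro t' ht'
    rcases List.mem_append.1 ht' with h | h
    · exact hQ.good t' h
    · rw [List.mem_singleton.1 h]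
      exact .cons (hQ.good _ hmem) ha
  · intro c
    rw [htail]
    by_cases hc : c = σ.intVar viCode
    · simp [Instr.exec, setEntry_apply, hc, hS.stamp]
      exact Or.inr hcode.symm
    · simp only [List.foldl, Instr.exec, setEntry_apply, List.mem_append, List.mem_singleton]
      simp [hc, hQ.seen c]
      exact fun h => absurd (hcode.trans h).symm hc
  · intro c
    simp [Instr.exec, setEntry_apply]
    split_ifs
    · exact hS.stamp.le
    · exact hQ.seen_le c
  · rw [htail, List.map_append, List.nodup_append]
    refine ⟨hQ.nodup, by simp, ?_⟩
    intro c hc c' hc' hcc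
    simp only [List.map_cons, List.map_nil, List.mem_singleton] at hc'
    obtain ⟨t', ht', hct'⟩ := List.mem_map.1 hc
    refine hnew ((hQ.seen _).2 ⟨t', ht', ?_⟩)
    rw [hct', hcc, hc', hcode]

lemma Strip.dig_cons (G : Strip) (tr : List (ℕ × ℕ)) (d j i : ℕ) :
    G.dig ((d, j) :: tr) i = if i / 4 = j then
      (if i % 4 < G.A then (if i % 4 = 0 then d else G.slot tr j (i % 4 - 1)) else G.m)
      else G.dig tr i := by
  unfold Strip.dig
  rw [slot_cons]

/-- Enter the state obtained by adding the current disk with the current colour, unless it has been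
entered before. -/
def push : Prog :=
  copyState ;; shiftState ;; encode ;; block [.intLoad viTmp aiSeen viCode] ;;
    .ite (.intLe viStamp viTmp) skip append

lemma getD_mem {α : Type} {l : List α} {e : ℕ} {x : α} (h : e < l.length) : l.getD e x ∈ l := by
  rw [List.getD_eq_getElem _ _ h]
  exact List.getElem_mem h

section

variable {G : Strip} {B : ℝ} {cnt stamp : ℕ} {trs : List (List (ℕ × ℕ))} {σ : Store} {e d j : ℕ}

/-- Either the new state is appended, or its code is already stamped and an earlier partial solution
is remembered in the same way. The conclusion covers both cases: some entry represents the extended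
solution. -/
lemma push_spec (hG : G.Admissible B) (hS : Setup G B cnt stamp σ) (hQ : QueueInv G stamp trs σ)
    (hd : σ.intVar viDisk = d) (hj : σ.intVar viCol = j) (hj4 : σ.intVar viColFour = 4 * j)
    (he : σ.intVar viHead = e) (hep : σ.intVar viHeadPos = e * (4 * G.k))
    (hel : e < trs.length) (ha : G.Allowed (trs.getD e []) d j) :
    Ends push σ (14 * (4 * G.k) + 29) (fun σ' =>
      Same [viSrc, viDst, viCopyC, viTmp, viTmpA, viTmpB, viCode, viRow, viTail, viTailPos, 99] []
        [aiQueue, aiSeen, aiDisk, aiCol, aiParent] [] σ σ' ∧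
      ∃ trs', trs <+: trs' ∧ QueueInv G stamp trs' σ' ∧
        ∃ t ∈ trs', ∀ i < 4 * G.k, G.dig t i = G.dig ((d, j) :: trs.getD e []) i) := by
  have hlt : e * (4 * G.k) + 4 * G.k ≤ trs.length * (4 * G.k) := by
    have := Nat.mul_le_mul_right (4 * G.k) hel
    rwa [Nat.succ_mul] at this
  have hg : G.Good ((d, j) :: trs.getD e []) := .cons (hQ.good _ (getD_mem hel)) ha
  have hA3 := hG.three_le
  have hA4 := hG.le_four
  refine Ends.frame (Ends.bind (copyState_spec hS.one hS.zero hep hQ.tailPos hS.digits hlt) ?_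
    (T₂ := 8 * (4 * G.k) + 25) (by omega)) rfl
  rintro σ₁ ⟨s₁, hc₁, hc₂⟩
  have hS₁ := hS.of_same s₁ rfl rfl rfl rfl
  have hQ₁ := hQ.of_same s₁ rfl rfl hc₂
  refine Ends.bind (shiftState_spec (j4 := 4 * j) hS₁.one hQ₁.tailPos (by simp [s₁.iv, hj4])) ?_
    (T₂ := 8 * (4 * G.k) + 13) (by omega)
  rintro σ₂ ⟨s₂, hsh⟩
  have hS₂ := hS₁.of_same s₂ rfl rfl rfl rfl
  have hQ₂ := hQ₁.of_same s₂ rfl rfl (fun x hx => by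
    rw [hsh, if_neg (by omega), if_neg (by omega), if_neg (by omega)])
  have hq : ∀ i < 4 * G.k, σ₂.intArr aiQueue (trs.length * (4 * G.k) + i) =
      G.dig ((d, j) :: trs.getD e []) i := by
    intro i hi
    have old : ∀ i < 4 * G.k, σ₁.intArr aiQueue (trs.length * (4 * G.k) + i) =
        G.dig (trs.getD e []) i := fun i hi => by rw [hc₁ i hi, hQ.queue e hel i hi]
    have old' : ∀ t, t < 3 → σ₁.intArr aiQueue (trs.length * (4 * G.k) + (4 * j + t)) =
        G.slot (trs.getD e []) j t := fun t ht => by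
      have := ha.color
      rw [old _ (by omega), Strip.dig, show (4 * j + t) / 4 = j by omega,
        show (4 * j + t) % 4 = t by omega]
    rw [hsh, Strip.dig_cons]
    by_cases h : i / 4 = j
    · obtain ⟨t, ht, rfl⟩ : ∃ t < 4, i = 4 * j + t := ⟨i % 4, by omega, by omega⟩
      rw [if_pos h, show (4 * j + t) % 4 = t by omega]
      have hdisk : σ₁.intVar viDisk = d := by simp [s₁.iv, hd]
      have hm : σ₁.intVar viM = G.m := hS₁.m
      have hlong := hS₁.long
      interval_cases t
      · rw [if_pos (by omega), if_pos (by omega), if_pos rfl, hdisk]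
      · rw [if_neg (by omega), if_pos (by omega), if_pos (by omega), if_neg (by omega), ← old' 0]
        · congr 1
        · omega
      · rw [if_neg (by omega), if_pos (by omega), if_pos (by omega), if_neg (by omega), ← old' 1]
        · congr 1
        · omega
      · rw [if_neg (by omega), if_neg (by omega), if_pos (by omega)]
        by_cases h4 : G.A = 4
        · rw [if_pos (hlong.2 h4), if_pos (by omega), if_neg (by omega), ← old' 2]
          · congr 1
          · omega
        · rw [if_neg (fun h => h4 (hlong.1 h)), if_neg (by omega), hm]
    · rw [if_neg h, if_neg (by omega), if_neg (by omega), if_neg (by omega), old i hi]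
  refine Ends.bind (encode_spec (M := G.m + 1) (L := 4 * G.k) (b := trs.length * (4 * G.k)) hS₂.one
    hS₂.zero hQ₂.tailPos hS₂.digits hS₂.base hS₂.pow
    (fun i hi => by rw [hq i hi]; exact Nat.lt_succ_of_le (hg.slot_le _ _))) ?_ (T₂ := 8) (by omega)
  rintro σ₃ ⟨s₃, hcode⟩
  have hS₃ := hS₂.of_same s₃ rfl rfl rfl rfl
  have hQ₃ := hQ₂.of_same s₃ rfl rfl (fun x hx => by rw [s₃.ia _ (by simp)])
  replace hcode : σ₃.intVar viCode = G.code ((d, j) :: trs.getD e []) := by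
    rw [hcode, Strip.code]
    exact Finset.sum_congr rfl fun i hi => by rw [hq i (Finset.mem_range.1 hi)]
  refine Ends.bind (Ends.frame (wi := [viTmp]) (wr := []) (wa := []) (wb := [])
    (Ends.block (Q := fun σ' => σ'.intVar viTmp = σ₃.intArr aiSeen (σ₃.intVar viCode)) (T := 1)
    (by simp) (by simp) (by simp) (by simp [Instr.exec])) rfl) ?_ (T₂ := 7) (by omega)
  rintro σ₄ ⟨s₄, htmp⟩
  have hS₄ := hS₃.of_same s₄ rfl rfl rfl rfl
  have hQ₄ := hQ₃.of_same s₄ rfl rfl (fun x hx => by rw [s₄.ia _ (by simp)])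
  refine Ends.ite (T₁ := 6) (fun hb => Ends.skip (by omega) ?_) (fun hb => ?_) (by omega)
  · refine ⟨trs, List.prefix_refl _, hQ₄.of_same (wi := [99]) (wr := []) (wa := []) (wb := [])
      ⟨fun x hx => ?_, fun _ _ => rfl, fun _ _ => rfl, fun _ _ => rfl⟩ rfl rfl (fun x hx => rfl), ?_⟩
    · simp only [List.mem_singleton] at hx
      simp [hx]
    -- No entry of the table exceeds the current stamp, so the test `≤` amounts to equality.
    · simp only [Test.Holds, htmp, hS₄.stamp] at hb
      obtain ⟨t, ht, htc⟩ := (hQ₃.seen _).1 (le_antisymm (hQ₃.seen_le _) hb)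
      have ht' := List.mem_of_mem_tail ht
      refine ⟨t, ht', digits_injective (M := G.m + 1)
        (fun i hi => Nat.lt_succ_of_le ((hQ.good t ht').slot_le _ _))
        (fun i hi => Nat.lt_succ_of_le (hg.slot_le _ _)) (htc.trans hcode)⟩
  · simp only [Test.Holds, htmp, hS₄.stamp] at hb
    refine Ends.mono (append_spec (e := e) (d := d) (j := j) hS₄ hQ₄ ?_ ?_ ?_ hel ha ?_ ?_ ?_) le_rfl
      fun σ' h => ⟨_, List.prefix_append _ _, h.2, _, List.mem_append_right _
        (List.mem_singleton_self _), fun _ _ => rfl⟩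
    · simp [s₄.iv, s₃.iv, s₂.iv, s₁.iv, hd]
    · simp [s₄.iv, s₃.iv, s₂.iv, s₁.iv, hj]
    · simp [s₄.iv, s₃.iv, s₂.iv, s₁.iv, he]
    · intro i hi
      rw [s₄.ia _ (by simp), s₃.ia _ (by simp), hq i hi]
    · rw [s₄.iv _ (by simp), hcode]
    · rw [s₄.iv _ (by simp), s₄.ia _ (by simp)]
      omega

/-- Try to add the current disk with the current colour. -/
def tryColor : Prog :=
  block [.intAdd viNearI viHeadPos viColFour, .intAdd viNearC viFour viZero, .realConst vrRad 4,
    .realLoad vrUx arCx viDisk, .realLoad vrUy arCy viDisk] ;; near ;;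
  .ite (.intLe viOne viFlag) skip push

/-- The hypothesis `ha` says that everything except disjointness has been checked before, so the
four distance tests alone decide. -/
lemma tryColor_spec (hG : G.Admissible B) (hS : Setup G B cnt stamp σ) (hQ : QueueInv G stamp trs σ)
    (hd : σ.intVar viDisk = d) (hj : σ.intVar viCol = j) (hj4 : σ.intVar viColFour = 4 * j)
    (he : σ.intVar viHead = e) (hep : σ.intVar viHeadPos = e * (4 * G.k)) (hel : e < trs.length)
    (hjk : j < G.k) (ha : (∀ t < 4, 4 < sqd (G.X (G.slot (trs.getD e []) j t))
      (G.Y (G.slot (trs.getD e []) j t)) (G.X d) (G.Y d)) → G.Allowed (trs.getD e []) d j) :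
    Ends tryColor σ (56 * G.k + 89) (fun σ' =>
      Same [viSrc, viDst, viCopyC, viTmp, viTmpA, viTmpB, viCode, viRow, viTail, viTailPos, 99,
        viNearI, viNearC, viFlag] [vrRad, vrUx, vrUy, vrX, vrY]
        [aiQueue, aiSeen, aiDisk, aiCol, aiParent] [] σ σ' ∧
      ∃ trs', trs <+: trs' ∧ QueueInv G stamp trs' σ' ∧ (G.Allowed (trs.getD e []) d j →
        ∃ t ∈ trs', ∀ i < 4 * G.k, G.dig t i = G.dig ((d, j) :: trs.getD e []) i)) := by
  refine Ends.frame (Ends.bind (T₁ := 5) (T₂ := 56 * G.k + 84)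
      (Ends.frame (wi := [viNearI, viNearC]) (wr := [vrRad, vrUx, vrUy]) (wa := []) (wb := [])
        (Ends.block (Q := fun σ' => σ'.intVar viNearI = e * (4 * G.k) + 4 * j ∧
          σ'.intVar viNearC = 4 ∧ σ'.realVar vrRad = 4 ∧ σ'.realVar vrUx = G.X d ∧
          σ'.realVar vrUy = G.Y d) (by simp) (by simp) (by simp)
          (by simp [Instr.exec, hep, hj4, hS.four, hS.zero, hS.X, hS.Y, hd])) rfl) ?_
          (by omega)) rfl
  rintro σ₁ ⟨s₁, e₁, e₂, e₃, e₄, e₅⟩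
  have hS₁ := hS.of_same s₁ rfl rfl rfl rfl
  have hQ₁ := hQ.of_same s₁ rfl rfl (fun x hx => by rw [s₁.ia _ (by simp)])
  refine Ends.bind (near_spec hS₁.one e₂ e₁) ?_ (T₂ := 56 * G.k + 30) (by omega)
  rintro σ₂ ⟨s₂, hn⟩
  have hS₂ := hS₁.of_same s₂ rfl rfl rfl rfl
  have hQ₂ := hQ₁.of_same s₂ rfl rfl (fun x hx => by rw [s₂.ia _ (by simp)])
  rw [e₃, e₄, e₅, hS₁.X, hS₁.Y] at hn
  have hq : ∀ t < 4, σ₁.intArr aiQueue (e * (4 * G.k) + 4 * j + t) =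
      G.slot (trs.getD e []) j t := by
    intro t ht
    rw [add_assoc, hQ₁.queue e hel _ (by omega), Strip.dig, show (4 * j + t) / 4 = j by omega,
      show (4 * j + t) % 4 = t by omega]
  refine Ends.ite (T₁ := 56 * G.k + 29) (fun hb => Ends.skip (by omega) ?_) (fun hb => ?_) (by omega)
  · refine ⟨trs, List.prefix_refl _, hQ₂.of_same (wi := [99]) (wr := []) (wa := []) (wb := [])
      ⟨fun x hx => ?_, fun _ _ => rfl, fun _ _ => rfl, fun _ _ => rfl⟩ rfl rfl (fun x hx => rfl), ?_⟩
    · simp only [List.mem_singleton] at hx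
      simp [hx]
    · simp only [Test.Holds, hS₂.one, hn] at hb
      obtain ⟨t, ht, h⟩ := hb
      rw [hq t ht] at h
      exact fun ha => absurd (ha.far t ht) h.not_gt
  · simp only [Test.Holds, hS₂.one, hn] at hb
    push Not at hb
    have hall : G.Allowed (trs.getD e []) d j := ha fun t ht => by
      have := hb t ht
      rwa [hq t ht] at this
    refine Ends.mono (push_spec hG hS₂ hQ₂ ?_ ?_ ?_ ?_ ?_ hel hall) (by omega) ?_
    · simp [s₂.iv, s₁.iv, hd]
    · simp [s₂.iv, s₁.iv, hj]
    · simp [s₂.iv, s₁.iv, hj4]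
    · simp [s₂.iv, s₁.iv, he]
    · simp [s₂.iv, s₁.iv, hep]
    · rintro σ' ⟨-, trs', h₁, h₂, h₃⟩
      exact ⟨trs', h₁, h₂, fun _ => h₃⟩

end

/-! ### The program: the search in a strip -/

lemma same_update (σ : Store) (c v : ℕ) :
    Same [c] [] [] [] σ { σ with intVar := Function.update σ.intVar c v } :=
  ⟨fun x hx => by simp only [List.mem_singleton] at hx; simp [hx], fun _ _ => rfl, fun _ _ => rfl,
    fun _ _ => rfl⟩

lemma getD_of_prefix {α : Type} {l l' : List α} (h : l <+: l') {e : ℕ} (he : e < l.length) (x : α) :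
    l'.getD e x = l.getD e x := by
  obtain ⟨r, rfl⟩ := h
  simp [List.getD, List.getElem?_append_left he]

/-- Some listed partial solution is remembered like `t`. -/
def Strip.Found (G : Strip) (trs : List (List (ℕ × ℕ))) (t : List (ℕ × ℕ)) : Prop :=
  ∃ t' ∈ trs, ∀ i < 4 * G.k, G.dig t' i = G.dig t i

lemma Strip.Found.mono {G : Strip} {trs trs' : List (List (ℕ × ℕ))} {t : List (ℕ × ℕ)}
    (h : G.Found trs t) (hp : trs <+: trs') : G.Found trs' t := by
  obtain ⟨t', ht', h'⟩ := h
  exact ⟨t', hp.subset ht', h'⟩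

/-- Try to add the current disk with each colour. -/
def tryColors : Prog :=
  block [.intConst viCol 0, .intConst viColFour 0, .intAdd viColC viK viZero] ;;
  repeatN viColC (tryColor ;; block [.intAdd viCol viCol viOne,
    .intAdd viColFour viColFour viFour])

section

variable {G : Strip} {B : ℝ} {cnt stamp : ℕ} {trs : List (List (ℕ × ℕ))} {σ : Store} {e d j : ℕ}

lemma QueueInv.update (h : QueueInv G stamp trs σ) (c v : ℕ)
    (hi : [31, 32].all (fun x => !([c] : List ℕ).contains x) = true) :
    QueueInv G stamp trs { σ with intVar := Function.update σ.intVar c v } :=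
  h.of_same (same_update σ c v) hi rfl fun _ _ => rfl

/-- The list of partial solutions may grow with every colour. It grows at its end only, so entry
`e`, which is being extended, stays the same. -/
lemma tryColors_spec (hG : G.Admissible B) (hS : Setup G B cnt stamp σ)
    (hQ : QueueInv G stamp trs σ) (hd : σ.intVar viDisk = d)
    (he : σ.intVar viHead = e) (hep : σ.intVar viHeadPos = e * (4 * G.k)) (hel : e < trs.length)
    (ha : ∀ j < G.k, (∀ t < 4, 4 < sqd (G.X (G.slot (trs.getD e []) j t))
      (G.Y (G.slot (trs.getD e []) j t)) (G.X d) (G.Y d)) → G.Allowed (trs.getD e []) d j) :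
    Ends tryColors σ (G.k * (56 * G.k + 93) + 4) (fun σ' =>
      Same [viSrc, viDst, viCopyC, viTmp, viTmpA, viTmpB, viCode, viRow, viTail, viTailPos, 99,
        viNearI, viNearC, viFlag, viCol, viColFour, viColC] [vrRad, vrUx, vrUy, vrX, vrY]
        [aiQueue, aiSeen, aiDisk, aiCol, aiParent] [] σ σ' ∧
      ∃ trs', trs <+: trs' ∧ QueueInv G stamp trs' σ' ∧ ∀ j, G.Allowed (trs.getD e []) d j →
        G.Found trs' ((d, j) :: trs.getD e [])) := by
  refine Ends.frame (Ends.bind (T₁ := 3) (T₂ := G.k * (56 * G.k + 93) + 1)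
      (Ends.frame (wi := [viCol, viColFour, viColC]) (wr := []) (wa := []) (wb := [])
        (Ends.block (Q := fun σ' => σ'.intVar viCol = 0 ∧ σ'.intVar viColFour = 0 ∧
          σ'.intVar viColC = G.k) (by simp) (by simp) (by simp)
          (by simp [Instr.exec, hS.k, hS.zero])) rfl) ?_ (by omega)) rfl
  rintro σ₁ ⟨s₁, e₁, e₂, e₃⟩
  have hS₁ := hS.of_same s₁ rfl rfl rfl rfl
  have hQ₁ := hQ.of_same s₁ rfl rfl (fun x hx => by rw [s₁.ia _ (by simp)])
  refine Ends.mono (Ends.repeatN (N := G.k) (T₁ := 56 * G.k + 91) (fun j σ' =>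
    σ'.intVar viCol = j ∧ σ'.intVar viColFour = 4 * j ∧ ∃ trs', trs <+: trs' ∧
      QueueInv G stamp trs' σ' ∧ ∀ j' < j, G.Allowed (trs.getD e []) d j' →
        G.Found trs' ((d, j') :: trs.getD e []))
    [viSrc, viDst, viCopyC, viTmp, viTmpA, viTmpB, viCode, viRow, viTail, viTailPos, 99,
        viNearI, viNearC, viFlag, viCol, viColFour, viColC] [vrRad, vrUx, vrUy, vrX, vrY]
        [aiQueue, aiSeen, aiDisk, aiCol, aiParent] [] rfl rfl rfl hS₁.one e₃ ?_ ?_ ?_ le_rfl)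
        (le_of_eq (by ring)) ?_
  · exact ⟨e₁, by simpa using e₂, trs, List.prefix_refl _, hQ₁, by simp⟩
  · rintro j σ v ⟨h₁, h₂, trs', h₃, h₄, h₅⟩
    exact ⟨by simpa using h₁, by simpa using h₂, trs', h₃, h₄.update _ _ rfl, h₅⟩
  · rintro j hj σ₂ s₂ ⟨h₁, h₂, trs', hp, hQ₂, hall⟩
    have hS₂ := hS₁.of_same s₂ rfl rfl rfl rfl
    have hget := getD_of_prefix hp hel []
    refine Ends.bind (tryColor_spec (e := e) (d := d) hG hS₂ hQ₂ (by simp [s₂.iv, s₁.iv, hd]) h₁ h₂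
      (by simp [s₂.iv, s₁.iv, he]) (by simp [s₂.iv, s₁.iv, hep]) (hel.trans_le hp.length_le) hj
      (by rw [hget]; exact ha j hj)) ?_ (T₂ := 2) (by omega)
    rintro σ₃ ⟨s₃, trs'', hp', hQ₃, hf⟩
    rw [hget] at hf
    refine Ends.mono (Ends.frame (wi := [viCol, viColFour]) (wr := []) (wa := []) (wb := [])
      (Ends.block (Q := fun σ' => σ'.intVar viCol = j + 1 ∧ σ'.intVar viColFour = 4 * (j + 1))
      (by simp) (by simp) (by simp) ?_) rfl) le_rfl ?_
    · simp [Instr.exec, s₃.iv, h₁, h₂, hS₂.four, hS₂.one]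
      ring
    · rintro σ₄ ⟨s₄, f₁, f₂⟩
      refine ⟨f₁, f₂, trs'', hp.trans hp', hQ₃.of_same s₄ rfl rfl (fun x hx => by
        rw [s₄.ia _ (by simp)]), ?_⟩
      intro j' hj' hal
      rcases Nat.lt_succ_iff_lt_or_eq.1 hj' with h | rfl
      · exact (hall j' h hal).mono hp'
      · exact hf hal
  · rintro σ' ⟨-, -, -, trs', h₁, h₂, h₃⟩
    exact ⟨trs', h₁, h₂, fun j hj => h₃ j hj.color hj⟩

/-- Try to add the current disk. -/
def tryDisk : Prog :=
  block [.realLoad vrLim arCx viDisk, .realLoad vrY arCy viDisk] ;;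
  .ite (.realLe vrLow vrY) (.ite (.realLe vrY vrHigh) (.ite (.realLe vrCur vrLim)
    (checkPts ;; .ite (.intLe viOne viOk) tryColors skip) skip) skip) skip ;;
  block [.intAdd viDisk viDisk viOne]

/-- The result of `checkPts`. -/
lemma Setup.coveredBefore_iff (hS : Setup G B cnt stamp σ) (hQ : QueueInv G stamp trs σ)
    (hel : e < trs.length) {x : ℝ} : G.CoveredBefore (trs.getD e []) x ↔ ∀ i < cnt,
        G.X (G.cur (trs.getD e [])) ≤ σ.realArr arPx (σ.intArr aiList i) + 1 →
        σ.realArr arPx (σ.intArr aiList i) + 1 < x →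
        ∃ t < 4 * G.k, sqd (σ.realArr arCx (σ.intArr aiQueue (e * (4 * G.k) + t)))
          (σ.realArr arCy (σ.intArr aiQueue (e * (4 * G.k) + t)))
          (σ.realArr arPx (σ.intArr aiList i))
          (σ.realArr arPy (σ.intArr aiList i)) ≤ 1 := by
  have hq : ∀ px py : ℝ, (∃ t < 4 * G.k,
      sqd (σ.realArr arCx (σ.intArr aiQueue (e * (4 * G.k) + t)))
        (σ.realArr arCy (σ.intArr aiQueue (e * (4 * G.k) + t))) px py ≤ 1) ↔
      ∃ i < 4 * G.k, sqd (G.X (G.dig (trs.getD e []) i)) (G.Y (G.dig (trs.getD e []) i)) px py ≤ 1 := by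
    intro px py
    refine exists_congr fun t => and_congr_right fun ht => ?_
    rw [hQ.queue e hel t ht, hS.X, hS.Y]
  simp only [hq]
  unfold Strip.CoveredBefore
  constructor
  · intro h i hi
    exact h (_, _) (by rw [hS.pts]; exact ⟨i, hi, rfl⟩)
  · intro h p hp
    rw [hS.pts] at hp
    obtain ⟨i, hi, rfl⟩ := hp
    exact h i hi

/-- Position and coverage do not depend on the colour and are tested once per disk; this keeps the
time at `O(cnt * k + k²)`. -/
lemma tryDisk_spec (hG : G.Admissible B) (hS : Setup G B cnt stamp σ)
    (hQ : QueueInv G stamp trs σ) (hd : σ.intVar viDisk = d) (hdm : d < G.m)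
    (he : σ.intVar viHead = e) (hep : σ.intVar viHeadPos = e * (4 * G.k)) (hel : e < trs.length)
    (hcur : σ.realVar vrCur = G.X (G.cur (trs.getD e []))) :
    Ends tryDisk σ (cnt * (52 * G.k + 16) + G.k * (56 * G.k + 93) + 15) (fun σ' =>
      Same [viSrc, viDst, viCopyC, viTmp, viTmpA, viTmpB, viCode, viRow, viTail, viTailPos, 99,
        viNearI, viNearC, viFlag, viCol, viColFour, viColC, viDisk, viOk, viPtsC, viPtsI, viPt]
        [vrRad, vrUx, vrUy, vrX, vrY, vrLim]
        [aiQueue, aiSeen, aiDisk, aiCol, aiParent] [] σ σ' ∧ σ'.intVar viDisk = d + 1 ∧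
      ∃ trs', trs <+: trs' ∧ QueueInv G stamp trs' σ' ∧ ∀ j, G.Allowed (trs.getD e []) d j →
        G.Found trs' ((d, j) :: trs.getD e [])) := by
  refine Ends.frame (Ends.bind (T₁ := 2) (T₂ := cnt * (52 * G.k + 16) + G.k * (56 * G.k + 93) + 13)
      (Ends.frame (wi := []) (wr := [vrLim, vrY]) (wa := []) (wb := [])
        (Ends.block (Q := fun σ' => σ'.realVar vrLim = G.X d ∧ σ'.realVar vrY = G.Y d)
          (by simp) (by simp) (by simp) (by simp [Instr.exec, hS.X, hS.Y, hd])) rfl) ?_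
          (by omega)) rfl
  rintro σ₁ ⟨s₁, e₁, e₂⟩
  have hS₁ := hS.of_same s₁ rfl rfl rfl rfl
  have hQ₁ := hQ.of_same s₁ rfl rfl (fun x hx => by rw [s₁.ia _ (by simp)])
  refine Ends.bind (P := fun σ' => Same [viSrc, viDst, viCopyC, viTmp, viTmpA, viTmpB, viCode, viRow,
    viTail, viTailPos, 99, viNearI, viNearC, viFlag, viCol, viColFour, viColC, viOk, viPtsC, viPtsI,
    viPt] [vrRad, vrUx, vrUy, vrX, vrY] [aiQueue, aiSeen, aiDisk, aiCol, aiParent] [] σ₁ σ' ∧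
    ∃ trs', trs <+: trs' ∧ QueueInv G stamp trs' σ' ∧ ∀ j, G.Allowed (trs.getD e []) d j →
        G.Found trs' ((d, j) :: trs.getD e []))
    (T₁ := cnt * (52 * G.k + 16) + G.k * (56 * G.k + 93) + 12) (T₂ := 1)
    (Ends.frame ?_ rfl) ?_ (by omega)
  · have hskip : (∀ j, ¬ G.Allowed (trs.getD e []) d j) → ∀ T, 1 ≤ T → Ends skip σ₁ T (fun σ' =>
        ∃ trs', trs <+: trs' ∧ QueueInv G stamp trs' σ' ∧ ∀ j, G.Allowed (trs.getD e []) d j →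
        G.Found trs' ((d, j) :: trs.getD e [])) := fun hna T hT =>
      Ends.skip hT ⟨trs, List.prefix_refl _, hQ₁.update _ _ rfl, fun j hj => absurd hj (hna j)⟩
    refine Ends.ite (T₁ := cnt * (52 * G.k + 16) + G.k * (56 * G.k + 93) + 11) (fun hb₁ => ?_)
      (fun hb => hskip (fun j hj => hb ?_) _ (by omega)) (by omega)
    swap
    · simp only [Test.Holds, hS₁.low, e₂]; exact hj.low
    refine Ends.ite (T₁ := cnt * (52 * G.k + 16) + G.k * (56 * G.k + 93) + 10) (fun hb₂ => ?_)
      (fun hb => hskip (fun j hj => hb ?_) _ (by omega)) (by omega)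
    swap
    · simp only [Test.Holds, hS₁.high, e₂]; exact hj.high
    have hcur₁ : σ₁.realVar vrCur = G.X (G.cur (trs.getD e [])) := by
      rw [s₁.rv _ (by simp), hcur]
    refine Ends.ite (T₁ := cnt * (52 * G.k + 16) + G.k * (56 * G.k + 93) + 9) (fun hb₃ => ?_)
      (fun hb => hskip (fun j hj => hb ?_) _ (by omega)) (by omega)
    swap
    · simp only [Test.Holds, hcur₁, e₁]; exact hj.right
    simp only [Test.Holds, hS₁.low, hS₁.high, e₁, e₂, hcur₁] at hb₁ hb₂ hb₃
    refine Ends.bind (checkPts_spec hS₁.one hS₁.zero hS₁.rone hS₁.count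
      (a := e * (4 * G.k)) (by simp [s₁.iv, hep]) hS₁.digits)
      (T₂ := G.k * (56 * G.k + 93) + 5) ?_ (le_of_eq (by ring))
    rintro σ₂ ⟨s₂, hok⟩
    rw [e₁, hcur₁, ← hS₁.coveredBefore_iff hQ₁ hel] at hok
    have hS₂ := hS₁.of_same s₂ rfl rfl rfl rfl
    have hQ₂ := hQ₁.of_same s₂ rfl rfl (fun x hx => by rw [s₂.ia _ (by simp)])
    refine Ends.ite (T₁ := G.k * (56 * G.k + 93) + 4) (fun hb => ?_)
      (fun hb => Ends.skip (by omega) ⟨trs, List.prefix_refl _, hQ₂.update _ _ rfl, ?_⟩) (by omega)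
    · simp only [Test.Holds, hS₂.one, hok] at hb
      refine Ends.mono (tryColors_spec (e := e) (d := d) hG hS₂ hQ₂ (by simp [s₂.iv, s₁.iv, hd])
        (by simp [s₂.iv, s₁.iv, he]) (by simp [s₂.iv, s₁.iv, hep]) hel
        fun j hj hf => ⟨hdm, hj, hb₁, hb₂, hb₃, hb, hf⟩) le_rfl fun _ h => h.2
    · simp only [Test.Holds, hS₂.one, hok] at hb
      exact fun j hj => absurd hj.covered hb
  · rintro σ₂ ⟨s₂, trs', h₁, h₂, h₃⟩
    refine Ends.block (by simp) (by simp) (by simp) ⟨?_, trs', h₁, h₂.update _ _ rfl, h₃⟩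
    simp [Instr.exec, s₂.iv, s₁.iv, hd, hS.one]

end

/-! ### Processing the queue -/

/-- The number of states is bounded by the number of ways to choose the remembered disks. -/
lemma QueueInv.length_le {G : Strip} {B : ℝ} {stamp : ℕ} {trs : List (List (ℕ × ℕ))} {σ : Store}
    (hG : G.Admissible B) (h : QueueInv G stamp trs σ) :
    trs.length ≤ (G.m + 1) ^ (G.A * G.k) + 1 := by
  have hnd : trs.tail.Nodup := List.Nodup.of_map _ h.nodup
  have hA := hG.le_four
  -- The minimum only serves the type: a place never exceeds `m`. Places from `A` on hold the dummy
  -- in every state, so `A` per colour suffice to recover the code.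
  let F : List (ℕ × ℕ) → (Fin G.A × Fin G.k → Fin (G.m + 1)) := fun t x =>
    ⟨min (G.slot t x.2 x.1) G.m, Nat.lt_succ_of_le (min_le_right _ _)⟩
  have hinj : Set.InjOn F (trs.tail.toFinset : Set (List (ℕ × ℕ))) := by
    intro t ht t' ht' hF
    simp only [List.coe_toFinset, Set.mem_ofPred_eq] at ht ht'
    have hg := h.good t (List.mem_of_mem_tail ht)
    have hg' := h.good t' (List.mem_of_mem_tail ht')
    have hc : G.code t = G.code t' := by
      refine Finset.sum_congr rfl fun i hi => ?_
      rw [Finset.mem_range] at hi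
      congr 1
      unfold Strip.dig
      by_cases hlt : i % 4 < G.A
      · have := congrArg Fin.val (congrFun hF (⟨i % 4, hlt⟩, ⟨i / 4, by omega⟩))
        simpa [F, hg.slot_le, hg'.slot_le] using this
      · simp [Strip.slot, hlt]
    exact List.inj_on_of_nodup_map h.nodup ht ht' hc
  have hcard := Finset.card_le_card_of_injOn F (t := Finset.univ)
    (fun _ _ => Finset.mem_coe.2 (Finset.mem_univ _)) hinj
  rw [List.toFinset_card_of_nodup hnd] at hcard
  simp only [Finset.card_univ, Fintype.card_fun, Fintype.card_prod, Fintype.card_fin,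
    List.length_tail] at hcard
  omega

/-- Treat the state at the head of the queue. -/
def expand : Prog :=
  block [.intLoad viTmp aiDisk viHead, .realLoad vrCur arCx viTmp, .realMul vrLim vrBound vrOne] ;;
  checkPts ;; .ite (.intLe viOne viOk) (block [.intAdd viAcc viHead viZero]) skip ;;
  block [.intConst viDisk 0, .intAdd viDiskC viM viZero] ;; repeatN viDiskC tryDisk ;;
  block [.intAdd viHead viHead viOne, .intAdd viNext viNext viOne,
    .intAdd viHeadPos viHeadPos viDigits]

/-- A bound for the time to process a state. -/
def expandTime (m k cnt : ℕ) : ℕ :=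
  (m + 1) * (cnt * (52 * k + 16) + k * (56 * k + 93) + 17) + 12

section

variable {G : Strip} {B : ℝ} {cnt stamp : ℕ} {σ : Store}

/-- The state of the search when the first `e` entries of the queue have been processed. -/
structure SearchInv (G : Strip) (B : ℝ) (cnt stamp : ℕ) (trs : List (List (ℕ × ℕ))) (e : ℕ)
    (σ : Store) : Prop where
  setup : Setup G B cnt stamp σ
  inv : QueueInv G stamp trs σ
  head : σ.intVar viHead = e
  next : σ.intVar viNext = e + 1
  headPos : σ.intVar viHeadPos = e * (4 * G.k)
  le : e ≤ trs.length
  closed : ∀ e' < e, ∀ d j, G.Allowed (trs.getD e' []) d j →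
    G.Found trs ((d, j) :: trs.getD e' [])
  acc_lt : σ.intVar viAcc < trs.length
  acc : (∃ e' < e, G.CoveredBefore (trs.getD e' []) B) →
    G.CoveredBefore (trs.getD (σ.intVar viAcc) []) B

/-- The first coverage test has the limit `B`, which lies beyond the reach of all points, and so
recognises complete solutions; `viAcc` keeps the index of such a state. -/
lemma expand_spec (hG : G.Admissible B) {trs : List (List (ℕ × ℕ))} {e : ℕ}
    (h : SearchInv G B cnt stamp trs e σ) (hel : e < trs.length) :
    Ends expand σ (expandTime G.m G.k cnt) (fun σ' => ∃ trs',
      SearchInv G B cnt stamp trs' (e + 1) σ') := by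
  have hS := h.setup
  have hQ := h.inv
  refine Ends.bind (T₁ := 3)
    (T₂ := (cnt * (52 * G.k + 16) + 4) + (G.m * (cnt * (52 * G.k + 16) + G.k * (56 * G.k + 93) + 17) + 8))
      (Ends.frame (wi := [viTmp]) (wr := [vrCur, vrLim]) (wa := []) (wb := [])
        (Ends.block (Q := fun σ' => σ'.realVar vrCur = G.X (G.cur (trs.getD e [])) ∧
          σ'.realVar vrLim = B)
          (by simp) (by simp) (by simp) (by
            simp [Instr.exec, hS.X, h.head, hQ.disk e hel, hS.bound, hS.rone])) rfl) ?_
          (by unfold expandTime; nlinarith)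
  rintro σ₁ ⟨s₁, e₁, e₂⟩
  have hS₁ := hS.of_same s₁ rfl rfl rfl rfl
  have hQ₁ := hQ.of_same s₁ rfl rfl (fun x hx => by rw [s₁.ia _ (by simp)])
  refine Ends.bind (checkPts_spec hS₁.one hS₁.zero hS₁.rone hS₁.count
      (a := e * (4 * G.k)) (by simp [s₁.iv, h.headPos]) hS₁.digits)
      (T₂ := G.m * (cnt * (52 * G.k + 16) + G.k * (56 * G.k + 93) + 17) + 8) ?_ (by
        rw [show 13 * (4 * G.k) + 16 = 52 * G.k + 16 by ring])
  rintro σ₂ ⟨s₂, hok⟩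
  rw [e₁, e₂, ← hS₁.coveredBefore_iff hQ₁ hel] at hok
  have hS₂ := hS₁.of_same s₂ rfl rfl rfl rfl
  have hQ₂ := hQ₁.of_same s₂ rfl rfl (fun x hx => by rw [s₂.ia _ (by simp)])
  refine Ends.bind (P := fun σ' => Same [viAcc, 99] [] [] [] σ₂ σ' ∧
    σ'.intVar viAcc < trs.length ∧ ((∃ e' < e + 1, G.CoveredBefore (trs.getD e' []) B) →
    G.CoveredBefore (trs.getD (σ'.intVar viAcc) []) B)) (T₁ := 2)
    (T₂ := G.m * (cnt * (52 * G.k + 16) + G.k * (56 * G.k + 93) + 17) + 6)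
    (Ends.frame ?_ rfl) ?_ (by omega)
  · refine Ends.ite (T₁ := 1) (fun hb => Ends.block (by simp) (by simp) (by simp) ?_)
      (fun hb => Ends.skip (by simp) ?_) (by omega)
    · simp only [Test.Holds, hS₂.one, hok] at hb
      have : σ₂.intVar viHead = e := by simp [s₂.iv, s₁.iv, h.head]
      simp only [List.foldl, Instr.exec, Function.update_self, this, hS₂.zero]
      exact ⟨hel, fun _ => hb⟩
    · simp only [Test.Holds, hS₂.one, hok] at hb
      have : σ₂.intVar viAcc = σ.intVar viAcc := by simp [s₂.iv, s₁.iv]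
      simp only [Function.update_of_ne (show viAcc ≠ 99 by norm_num), this,
        Nat.exists_lt_succ_right, hb, or_false]
      exact ⟨h.acc_lt, h.acc⟩
  rintro σ₃ ⟨s₃, hacc₁, hacc₂⟩
  have hS₃ := hS₂.of_same s₃ rfl rfl rfl rfl
  have hQ₃ := hQ₂.of_same s₃ rfl rfl (fun x hx => by rw [s₃.ia _ (by simp)])
  refine Ends.bind (T₁ := 2)
    (T₂ := G.m * (cnt * (52 * G.k + 16) + G.k * (56 * G.k + 93) + 17) + 4)
    (Ends.frame (wi := [viDisk, viDiskC]) (wr := []) (wa := []) (wb := [])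
      (Ends.block (Q := fun σ' => σ'.intVar viDisk = 0 ∧ σ'.intVar viDiskC = G.m)
        (by simp) (by simp) (by simp) (by simp [Instr.exec, hS₃.m, hS₃.zero])) rfl) ?_ (by omega)
  rintro σ₄ ⟨s₄, f₁, f₂⟩
  have hS₄ := hS₃.of_same s₄ rfl rfl rfl rfl
  have hQ₄ := hQ₃.of_same s₄ rfl rfl (fun x hx => by rw [s₄.ia _ (by simp)])
  refine Ends.bind (Ends.repeatN (N := G.m)
    (T₁ := cnt * (52 * G.k + 16) + G.k * (56 * G.k + 93) + 15)
    (T := G.m * (cnt * (52 * G.k + 16) + G.k * (56 * G.k + 93) + 17) + 1)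
    (fun d σ' => σ'.intVar viDisk = d ∧ ∃ trs', trs <+: trs' ∧
      QueueInv G stamp trs' σ' ∧ ∀ d' < d, ∀ j, G.Allowed (trs.getD e []) d' j →
        G.Found trs' ((d', j) :: trs.getD e []))
    [viSrc, viDst, viCopyC, viTmp, viTmpA, viTmpB, viCode, viRow, viTail, viTailPos, 99,
        viNearI, viNearC, viFlag, viCol, viColFour, viColC, viDisk, viDiskC, viOk, viPtsC, viPtsI,
        viPt] [vrRad, vrUx, vrUy, vrX, vrY, vrLim]
        [aiQueue, aiSeen, aiDisk, aiCol, aiParent] [] rfl rfl rfl hS₄.one f₂ ?_ ?_ ?_ le_rfl)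
        ?_ (T₂ := 3) (by omega)
  · exact ⟨f₁, trs, List.prefix_refl _, hQ₄, by simp⟩
  · rintro j σ v ⟨h₂, trs', h₃, h₄, h₅⟩
    exact ⟨by simpa using h₂, trs', h₃, h₄.update _ _ rfl, h₅⟩
  · rintro d hd σ₅ s₅ ⟨h₂, trs', hp, hQ₅, hall⟩
    have hS₅ := hS₄.of_same s₅ rfl rfl rfl rfl
    have hget := getD_of_prefix hp hel []
    refine Ends.mono (tryDisk_spec (e := e) hG hS₅ hQ₅ h₂ hd
      (by simp [s₅.iv, s₄.iv, s₃.iv, s₂.iv, s₁.iv, h.head])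
      (by simp [s₅.iv, s₄.iv, s₃.iv, s₂.iv, s₁.iv, h.headPos]) (hel.trans_le hp.length_le) ?_)
      le_rfl ?_
    · rw [hget, ← e₁]
      simp [s₅.rv, s₄.rv, s₃.rv, s₂.rv]
    · rintro σ₆ ⟨-, g₁, trs'', hp', hQ₆, hf⟩
      refine ⟨g₁, trs'', hp.trans hp', hQ₆, fun d' hd' j ha => ?_⟩
      rw [hget] at hf
      rcases Nat.lt_succ_iff_lt_or_eq.1 hd' with hlt | rfl
      · exact (hall d' hlt j ha).mono hp'
      · exact hf j ha
  · rintro σ₅ ⟨s₅, -, trs', hp, hQ₅, hall⟩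
    have hS₅ := hS₄.of_same s₅ rfl rfl rfl rfl
    have i₁ : σ₅.intVar viHead = e := by
      simp [s₅.iv, s₄.iv, s₃.iv, s₂.iv, s₁.iv, h.head]
    have i₂ : σ₅.intVar viHeadPos = e * (4 * G.k) := by
      simp [s₅.iv, s₄.iv, s₃.iv, s₂.iv, s₁.iv, h.headPos]
    have i₃ : σ₅.intVar viNext = e + 1 := by
      simp [s₅.iv, s₄.iv, s₃.iv, s₂.iv, s₁.iv, h.next]
    have i₄ : σ₅.intVar viAcc = σ₃.intVar viAcc := by
      simp [s₅.iv, s₄.iv]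
    refine Ends.mono (Ends.frame (wi := [viHead, viNext, viHeadPos]) (wr := []) (wa := []) (wb := [])
      (Ends.block (Q := fun σ' => σ'.intVar viHead = e + 1 ∧ σ'.intVar viNext = e + 1 + 1 ∧
        σ'.intVar viHeadPos = (e + 1) * (4 * G.k))
        (by simp) (by simp) (by simp) ?_) rfl) le_rfl ?_
    · simp [Instr.exec, i₁, i₂, i₃, hS₅.one, hS₅.digits]
      ring
    · rintro σ₆ ⟨s₆, g₁, g₂, g₃⟩
      have hle := hp.length_le
      have i₅ : σ₆.intVar viAcc = σ₃.intVar viAcc := by rw [s₆.iv _ (by simp), i₄]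
      refine ⟨trs', hS₅.of_same s₆ rfl rfl rfl rfl,
        hQ₅.of_same s₆ rfl rfl (fun x hx => by rw [s₆.ia _ (by simp)]), g₁, g₂, g₃, by omega, ?_, ?_, ?_⟩
      · intro e' he' d j ha
        rw [getD_of_prefix hp (by omega)] at ha ⊢
        rcases Nat.lt_succ_iff_lt_or_eq.1 he' with hlt | rfl
        · exact (h.closed e' hlt d j ha).mono hp
        · exact hall d ha.disk j ha
      · rw [i₅]; omega
      · rintro ⟨e', he', hc⟩
        rw [getD_of_prefix hp (by omega)] at hc
        rw [i₅, getD_of_prefix hp hacc₁]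
        exact hacc₂ ⟨e', he', hc⟩

/-- Treat all states. -/
def search : Prog := .loop (.intLe viNext viTail) expand

/-- Each round moves the head forward, and the queue never holds more than `N` entries, so `N - e`
rounds at most are left. When the head meets the tail, the list is closed under allowed additions
and `Solves.exists_complete` applies. -/
lemma search_spec (hG : G.Admissible B) {trs : List (List (ℕ × ℕ))} {L : List (ℕ × ℕ)}
    (hL : G.Solves L) (h : SearchInv G B cnt stamp trs 0 σ) :
    Ends search σ (((G.m + 1) ^ (G.A * G.k) + 1) * (expandTime G.m G.k cnt + 1) + 1) (fun σ' =>
      ∃ trs, QueueInv G stamp trs σ' ∧ σ'.intVar viAcc < trs.length ∧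
        G.CoveredBefore (trs.getD (σ'.intVar viAcc) []) B) := by
  set N := (G.m + 1) ^ (G.A * G.k) + 1 with hN
  set T := expandTime G.m G.k cnt with hT
  refine Ends.loop (fun r σ' => ∃ trs e, SearchInv G B cnt stamp trs e σ' ∧
    r = (N - e) * (T + 1) + 1) ⟨trs, 0, h, by simp⟩ ?_ ?_
  · rintro r σ' ⟨trs, e, hI, rfl⟩ hb
    refine ⟨by omega, trs, hI.inv, hI.acc_lt, hI.acc ?_⟩
    simp only [Test.Holds, hI.next, hI.inv.tail] at hb
    obtain rfl : e = trs.length := le_antisymm hI.le (by omega)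
    have hpos : 0 < trs.length := List.length_pos_iff.2 hI.inv.ne_nil
    obtain ⟨t, ht, hc⟩ := hL.exists_complete hG hI.inv.good
      (by have := getD_mem (x := []) hpos; rwa [hI.inv.first] at this)
      (fun t ht d j ha => by
        obtain ⟨e, he, rfl⟩ := List.getElem_of_mem ht
        rw [← List.getD_eq_getElem _ [] he] at ha ⊢
        exact hI.closed e he d j ha)
    obtain ⟨e, he, rfl⟩ := List.getElem_of_mem ht
    exact ⟨e, he, by rwa [List.getD_eq_getElem _ [] he]⟩
  · rintro r σ' ⟨trs, e, hI, rfl⟩ hb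
    simp only [Test.Holds, hI.next, hI.inv.tail] at hb
    have := hI.inv.length_le hG
    refine ⟨T, (N - (e + 1)) * (T + 1) + 1, ?_, (expand_spec hG hI (by omega)).mono le_rfl ?_⟩
    · obtain ⟨r, hr⟩ : ∃ r, N - e = r + 1 := ⟨N - e - 1, by omega⟩
      rw [hr, show N - (e + 1) = r by omega]
      ring_nf
      omega
    · rintro σ'' ⟨trs', h'⟩
      exact ⟨trs', e + 1, h', rfl⟩

end

/-! ### Initialising the search and reading off the solution -/

/-- Start the search with the empty partial solution. -/
def initQueue : Prog :=
  block [.intConst viDst 0, .intAdd viCopyC viDigits viZero] ;;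
  repeatN viCopyC (block [.intStore aiQueue viDst viM, .intAdd viDst viDst viOne]) ;;
  block [.intStore aiDisk viZero viM, .intConst viTail 1, .intConst viHead 0, .intConst viNext 1,
    .intConst viHeadPos 0, .intAdd viTailPos viDigits viZero, .intConst viAcc 0]

section

variable {G : Strip} {B : ℝ} {cnt stamp : ℕ} {σ : Store}

/-- A stamp larger than all entries makes the table of codes count as empty, so it need not be
cleared between strips. -/
lemma initQueue_spec (hS : Setup G B cnt stamp σ) (hseen : ∀ c, σ.intArr aiSeen c < stamp) :
    Ends initQueue σ (16 * G.k + 10) (SearchInv G B cnt stamp [[]] 0) := by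
  refine Ends.bind (T₁ := 2) (T₂ := 16 * G.k + 8)
    (Ends.frame (wi := [viDst, viCopyC]) (wr := []) (wa := []) (wb := [])
      (Ends.block (Q := fun σ' => σ'.intVar viDst = 0 ∧ σ'.intVar viCopyC = 4 * G.k)
        (by simp) (by simp) (by simp) (by simp [Instr.exec, hS.digits, hS.zero])) rfl) ?_ (by omega)
  rintro σ₁ ⟨s₁, e₁, e₂⟩
  have hS₁ := hS.of_same s₁ rfl rfl rfl rfl
  refine Ends.bind (Ends.repeatN (N := 4 * G.k) (T₁ := 2) (T := 16 * G.k + 1) (fun i σ' =>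
    σ'.intVar viDst = i ∧ ∀ i' < i, σ'.intArr aiQueue i' = G.m)
    [viDst, viCopyC] [] [aiQueue] [] rfl rfl rfl hS₁.one e₂ ?_ ?_ ?_ (by omega)) ?_ (T₂ := 7)
    (by omega)
  · simp [e₁]
  · intro i σ v h; simpa using h
  · rintro i hi σ₂ s₂ ⟨h₁, h₂⟩
    have hS₂ := hS₁.of_same s₂ rfl rfl rfl rfl
    refine Ends.block (by simp) (by simp) (by simp) ⟨by simp [Instr.exec, h₁, hS₂.one], ?_⟩
    intro i' hi'
    rcases Nat.lt_succ_iff_lt_or_eq.1 hi' with h | rfl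
    · simp [Instr.exec, setEntry_apply, h₁, h.ne, h₂ i' h]
    · simp [Instr.exec, setEntry_apply, h₁, hS₂.m]
  · rintro σ₂ ⟨s₂, -, hq⟩
    have hS₂ := hS₁.of_same s₂ rfl rfl rfl rfl
    refine Ends.mono (Ends.frame (wi := [viTail, viHead, viNext, viHeadPos, viTailPos, viAcc])
      (wr := []) (wa := [aiDisk]) (wb := [])
      (Ends.block (Q := fun σ' => σ'.intVar viTail = 1 ∧ σ'.intVar viHead = 0 ∧
        σ'.intVar viNext = 1 ∧ σ'.intVar viHeadPos = 0 ∧ σ'.intVar viTailPos = 4 * G.k ∧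
        σ'.intVar viAcc = 0 ∧ σ'.intArr aiDisk 0 = G.m)
        (by simp) (by simp) (by simp)
        (by simp [Instr.exec, setEntry_apply, hS₂.zero, hS₂.m, hS₂.digits])) rfl) le_rfl ?_
    rintro σ₃ ⟨s₃, f₁, f₂, f₃, f₄, f₅, f₆, f₇⟩
    have hdig : ∀ i, G.dig [] i = G.m := fun i => Strip.slot_nil _ _
    have hseen' : ∀ c, σ₃.intArr aiSeen c < stamp := by
      intro c
      simpa [s₃.ia, s₂.ia, s₁.ia] using hseen c
    refine ⟨hS₂.of_same s₃ rfl rfl rfl rfl, ?_, f₂, f₃, by simpa using f₄, by simp, by simp,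
      by simp [f₆], by simp⟩
    constructor
    · simpa using f₁
    · simpa using f₅
    · intro e he i hi
      obtain rfl : e = 0 := by simpa using he
      rw [s₃.ia _ (by simp)]
      simpa [hdig] using hq i hi
    · intro e he
      obtain rfl : e = 0 := by simpa using he
      simpa [Strip.cur] using f₇
    · simp
    · simp
    · intro e he h
      simp at he
      omega
    · simpa using Strip.Good.nil
    · simpa using fun c => (hseen' c).ne
    · exact fun c => (hseen' c).le
    · simp

/-- Write the solution found to the output. -/
def backtrack : Prog :=
  block [.intAdd viBack viAcc viZero] ;; .loop (.intLe viOne viBack)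
    (block [.intLoad viTmp aiDisk viBack, .intLoad viTmpA aiCol viBack,
      .intAdd viTmpA viTmpA viShift, .intAdd viTmpA viTmpA viOne, .intStore aiOut viTmp viTmpA,
      .intLoad viBack aiParent viBack])

/-- The colours in `out'` arise from those in `out` by recolouring the disks of `tr`, with the
colours shifted by `s`. -/
def Recolors (tr : List (ℕ × ℕ)) (s : ℕ) (out out' : ℕ → ℕ) : Prop :=
  ∀ x, (out' x = out x ∧ ∀ j, (x, j) ∉ tr) ∨ ∃ j, (x, j) ∈ tr ∧ out' x = s + j + 1

/-- Parents have smaller indices, so the walk ends at entry `0`, the empty solution. A disk chosen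
with several colours is written several times and ends up with one of them, which is all that
`Recolors` claims. -/
lemma backtrack_spec {trs : List (List (ℕ × ℕ))} (h1 : σ.intVar viOne = 1)
    (h0 : σ.intVar viZero = 0) (hQ : QueueInv G stamp trs σ) (hacc : σ.intVar viAcc < trs.length) :
    Ends backtrack σ (7 * trs.length + 2) (fun σ' =>
      Same [viBack, viTmp, viTmpA] [] [aiOut] [] σ σ' ∧
      Recolors (trs.getD (σ.intVar viAcc) []) (σ.intVar viShift) (σ.intArr aiOut)
        (σ'.intArr aiOut)) := by
  set T := trs.getD (σ.intVar viAcc) [] with hT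
  refine Ends.frame (Ends.bind (T₁ := 1) (T₂ := 7 * trs.length + 1)
    (Ends.frame (wi := [viBack]) (wr := []) (wa := []) (wb := [])
      (Ends.block (Q := fun σ' => σ'.intVar viBack = σ.intVar viAcc)
        (by simp) (by simp) (by simp) (by simp [Instr.exec, h0])) rfl) ?_ (by omega)) rfl
  rintro σ₁ ⟨s₁, e₁⟩
  -- A disk not yet written can only occur in the part of `T` still ahead; the index `viBack` itself
  -- bounds the number of rounds left.
  refine Ends.loop (fun r σ' => Same [viBack, viTmp, viTmpA] [] [aiOut] [] σ σ' ∧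
    σ'.intVar viBack < trs.length ∧ 7 * σ'.intVar viBack + 1 ≤ r ∧
    (∀ q ∈ trs.getD (σ'.intVar viBack) [], q ∈ T) ∧
    ∀ x, (σ'.intArr aiOut x = σ.intArr aiOut x ∧
        ∀ j, (x, j) ∈ T → (x, j) ∈ trs.getD (σ'.intVar viBack) []) ∨
      ∃ j, (x, j) ∈ T ∧ σ'.intArr aiOut x = σ.intVar viShift + j + 1) ?_ ?_ ?_
  · refine ⟨s₁.mono (by simp) (by simp) (by simp) (by simp), by rwa [e₁], by rw [e₁]; omega,
      by rw [e₁]; exact fun q hq => hq, fun x => Or.inl ⟨by rw [s₁.ia _ (by simp)], ?_⟩⟩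
    rw [e₁]
    exact fun j hj => hj
  · rintro r σ' ⟨s, h₁, h₂, h₃, h₄⟩ hb
    simp only [Test.Holds, s.iv viOne (by simp), h1] at hb
    refine ⟨by omega, fun x => ?_⟩
    rcases h₄ x with ⟨h, h'⟩ | h
    · refine Or.inl ⟨h, fun j hj => ?_⟩
      have := h' j hj
      rw [show σ'.intVar viBack = 0 by omega, hQ.first] at this
      simp at this
    · exact Or.inr h
  · rintro r σ' ⟨s, h₁, h₂, h₃, h₄⟩ hb
    simp only [Test.Holds, s.iv viOne (by simp), h1] at hb
    obtain ⟨p₁, p₂⟩ := hQ.parent _ h₁ hb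
    refine ⟨6, 7 * σ.intArr aiParent (σ'.intVar viBack) + 1, by omega,
      Ends.mono (Ends.frame (wi := [viBack, viTmp, viTmpA]) (wr := []) (wa := [aiOut]) (wb := [])
        (Ends.block (Q := fun σ'' => σ''.intVar viBack = σ.intArr aiParent (σ'.intVar viBack) ∧
          ∀ x, σ''.intArr aiOut x = if x = σ.intArr aiDisk (σ'.intVar viBack) then
            σ.intVar viShift + σ.intArr aiCol (σ'.intVar viBack) + 1 else σ'.intArr aiOut x)
        (by simp) (by simp) (by simp) ?_) rfl) le_rfl ?_⟩
    · have q₁ := s.ia aiDisk (by simp)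
      have q₂ := s.ia aiCol (by simp)
      have q₃ := s.ia aiParent (by simp)
      have q₄ := s.iv viShift (by simp)
      have q₅ := s.iv viOne (by simp)
      simp [Instr.exec, setEntry_apply, q₁, q₂, q₃, q₄, q₅, h1, add_comm]
    · rintro σ'' ⟨s', g₁, g₂⟩
      rw [p₂] at h₃ h₄
      refine ⟨s.trans s', by rw [g₁]; omega, by rw [g₁], ?_, fun x => ?_⟩
      · rw [g₁]
        exact fun q hq => h₃ q (List.mem_cons_of_mem _ hq)
      · rw [g₁, g₂]
        by_cases hx : x = σ.intArr aiDisk (σ'.intVar viBack)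
        · rw [if_pos hx]
          exact Or.inr ⟨_, h₃ _ (by rw [hx]; exact List.mem_cons_self), rfl⟩
        · rw [if_neg hx]
          rcases h₄ x with ⟨h, h'⟩ | h
          · refine Or.inl ⟨h, fun j hj => ?_⟩
            rcases List.mem_cons.1 (h' j hj) with h'' | h''
            · exact absurd (congrArg Prod.fst h'') hx
            · exact h''
          · exact Or.inr h

/-- Solve the strip problem and write the solution to the output. -/
def solveStrip : Prog := initQueue ;; search ;; backtrack

/-- A bound for the time to solve a strip problem. -/
def solveTime (m k A cnt : ℕ) : ℕ :=
  ((m + 1) ^ (A * k) + 1) * (expandTime m k cnt + 8) + 16 * k + 13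

lemma solveStrip_spec (hG : G.Admissible B) {L : List (ℕ × ℕ)} (hL : G.Solves L)
    (hS : Setup G B cnt stamp σ) (hseen : ∀ c, σ.intArr aiSeen c < stamp) :
    Ends solveStrip σ (solveTime G.m G.k G.A cnt) (fun σ' =>
      Same [viSrc, viDst, viCopyC, viTmp, viTmpA, viTmpB, viCode, viRow, viTail, viTailPos, 99,
        viNearI, viNearC, viFlag, viCol, viColFour, viColC, viDisk, viDiskC, viOk, viPtsC, viPtsI,
        viPt, viHead, viNext, viHeadPos, viAcc, viBack] [vrRad, vrUx, vrUy, vrX, vrY, vrLim, vrCur]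
        [aiQueue, aiSeen, aiDisk, aiCol, aiParent, aiOut] [] σ σ' ∧
      (∀ c, σ'.intArr aiSeen c ≤ stamp) ∧
      ∃ tr, G.Good tr ∧ G.CoveredBefore tr B ∧
        Recolors tr (σ.intVar viShift) (σ.intArr aiOut) (σ'.intArr aiOut)) := by
  set N := (G.m + 1) ^ (G.A * G.k) + 1 with hN
  set E := expandTime G.m G.k cnt with hE
  refine Ends.frame (Ends.bind (T₂ := N * (E + 1) + 1 + (7 * N + 2))
    (Ends.frame (wi := [viSrc, viDst, viCopyC, viTmp, viTail, viTailPos, viHead, viNext, viHeadPos,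
      viAcc]) (wr := []) (wa := [aiQueue, aiDisk]) (wb := []) (initQueue_spec hS hseen) rfl) ?_ ?_) rfl
  · rintro σ₁ ⟨s₁, h₁⟩
    refine Ends.bind (T₂ := 7 * N + 2) (Ends.frame (wi := [viSrc, viDst, viCopyC, viTmp, viTmpA,
        viTmpB, viCode, viRow, viTail, viTailPos, 99,
        viNearI, viNearC, viFlag, viCol, viColFour, viColC, viDisk, viDiskC, viOk, viPtsC, viPtsI,
        viPt, viHead, viNext, viHeadPos, viAcc]) (wr := [vrRad, vrUx, vrUy, vrX, vrY, vrLim, vrCur])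
        (wa := [aiQueue, aiSeen, aiDisk, aiCol, aiParent]) (wb := [])
      (search_spec hG hL h₁) rfl) ?_ le_rfl
    rintro σ₂ ⟨s₂, trs, hQ, hacc, hcov⟩
    have hlen := hQ.length_le hG
    have hS₂ := h₁.setup.of_same s₂ rfl rfl rfl rfl
    refine Ends.mono (backtrack_spec hS₂.one hS₂.zero hQ hacc) (by omega) ?_
    rintro σ₃ ⟨s₃, hr⟩
    refine ⟨fun c => by rw [s₃.ia _ (by simp)]; exact hQ.seen_le c, _,
      hQ.good _ (getD_mem hacc), hcov, ?_⟩
    have q₁ : σ₂.intVar viShift = σ.intVar viShift := by simp [s₂.iv, s₁.iv]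
    have q₂ : σ₂.intArr aiOut = σ.intArr aiOut := by simp [s₂.ia, s₁.ia]
    rwa [q₁, q₂] at hr
  · unfold solveTime
    rw [← hN, ← hE]
    ring_nf
    omega

end

/-! ### The program: all strips -/

/-- Find the lowest point above the last strip. -/
def findBottom : Prog :=
  block [.realMul vrBot vrBound vrOne, .intAdd viPtsC viN viZero, .intConst viPt 0] ;;
  repeatN viPtsC (block [.realLoad vrUy arPy viPt, .intAdd viPt viPt viOne] ;;
    .ite (.realLe vrUy vrLast) skip (.ite (.realLe vrBot vrUy) skip
      (block [.realMul vrBot vrUy vrOne])))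

/-- The value `B` exceeds all ordinates of points, so it serves as the minimum over the empty set.
-/
lemma findBottom_spec {σ : Store} {n : ℕ} {B : ℝ} (h1 : σ.intVar viOne = 1)
    (h0 : σ.intVar viZero = 0) (hn : σ.intVar viN = n) (hr1 : σ.realVar vrOne = 1)
    (hB : σ.realVar vrBound = B) :
    Ends findBottom σ (7 * n + 4) (fun σ' =>
      Same [viPtsC, viPt, 99] [vrBot, vrUy] [] [] σ σ' ∧
      (σ'.realVar vrBot = B ∨ ∃ i < n, σ'.realVar vrBot = σ.realArr arPy i ∧
        σ.realVar vrLast < σ.realArr arPy i) ∧ σ'.realVar vrBot ≤ B ∧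
      ∀ i < n, σ.realVar vrLast < σ.realArr arPy i → σ'.realVar vrBot ≤ σ.realArr arPy i) := by
  refine Ends.frame (Ends.bind (T₁ := 3) (T₂ := 7 * n + 1)
      (Ends.frame (wi := [viPtsC, viPt]) (wr := [vrBot]) (wa := []) (wb := [])
        (Ends.block (Q := fun σ' => σ'.realVar vrBot = B ∧ σ'.intVar viPtsC = n ∧
          σ'.intVar viPt = 0) (by simp) (by simp) (by simp)
          (by simp [Instr.exec, hn, h0, hB, hr1])) rfl) ?_ (by omega)) rfl
  rintro σ₁ ⟨s, e₁, e₂, e₃⟩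
  refine Ends.mono (Ends.repeatN (N := n) (T₁ := 5) (fun i σ' => σ'.intVar viPt = i ∧
      (σ'.realVar vrBot = B ∨ ∃ i' < n, σ'.realVar vrBot = σ.realArr arPy i' ∧
        σ.realVar vrLast < σ.realArr arPy i') ∧ σ'.realVar vrBot ≤ B ∧
      ∀ i' < i, σ.realVar vrLast < σ.realArr arPy i' → σ'.realVar vrBot ≤ σ.realArr arPy i')
    [viPtsC, viPt, 99] [vrBot, vrUy] [] [] rfl rfl rfl ?_ e₂ ?_ ?_ ?_ le_rfl)
    (le_of_eq (by ring)) fun _ h => h.2.2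
  · simp [s.iv, h1]
  · simp [e₁, e₃]
  · intro i σ v h; simpa using h
  · rintro i hi σ₂ s₂ ⟨f₁, f₂, f₃, f₄⟩
    refine Ends.bind (T₁ := 2) (T₂ := 3) (Ends.frame (wi := [viPt]) (wr := [vrUy]) (wa := [])
      (wb := []) (Ends.block (Q := fun σ' => σ'.intVar viPt = i + 1 ∧
        σ'.realVar vrUy = σ.realArr arPy i) (by simp) (by simp) (by simp)
        (by simp [Instr.exec, f₁, s₂.iv, s.iv, s₂.ra, s.ra, h1])) rfl) ?_ (by omega)
    rintro σ₃ ⟨s₃, g₁, g₂⟩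
    have hbot : σ₃.realVar vrBot = σ₂.realVar vrBot := s₃.rv _ (by simp)
    have hlast : σ₃.realVar vrLast = σ.realVar vrLast := by simp [s₃.rv, s₂.rv, s.rv]
    simp only [Nat.forall_lt_succ_right]
    refine Ends.ite (T₁ := 2) (fun hb => Ends.skip (by simp) ?_) (fun hb => ?_) (by omega)
    · simp only [Test.Holds, g₂, hlast] at hb
      rw [← hbot] at f₂ f₃ f₄
      exact ⟨by simpa using g₁, f₂, f₃, f₄, fun h => absurd hb h.not_ge⟩
    · simp only [Test.Holds, g₂, hlast] at hb
      refine Ends.ite (T₁ := 1) (fun hb' => Ends.skip (by simp) ?_)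
        (fun hb' => Ends.block (by simp) (by simp) (by simp) ?_) (by omega)
      · simp only [Test.Holds, g₂] at hb'
        rw [← hbot] at f₂ f₃ f₄
        exact ⟨by simpa using g₁, f₂, f₃, f₄, fun h => hb'⟩
      · simp only [Test.Holds, g₂, hbot, not_le] at hb' hb
        have hr1' : σ₃.realVar vrOne = 1 := by simp [s₃.rv, s₂.rv, s.rv, hr1]
        simp only [List.foldl, Instr.exec, Function.update_self, g₂, hr1', mul_one]
        exact ⟨g₁, Or.inr ⟨i, hi, rfl, hb⟩, by linarith,
          fun i' hi' h => hb'.le.trans (f₄ i' hi' h), fun _ => le_rfl⟩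

/-- List the points of the strip. -/
def collect : Prog :=
  block [.realAdd vrTop vrBot vrHeight, .intConst viCount 0, .intAdd viPtsC viN viZero,
    .intConst viPt 0] ;;
  repeatN viPtsC (block [.realLoad vrUy arPy viPt] ;;
    .ite (.realLe vrBot vrUy) (.ite (.realLe vrUy vrTop)
      (block [.intStore aiList viCount viPt, .intAdd viCount viCount viOne]) skip) skip ;;
    block [.intAdd viPt viPt viOne])

open Classical in
lemma collect_spec {σ : Store} {n : ℕ} {lo h : ℝ} (h1 : σ.intVar viOne = 1)
    (h0 : σ.intVar viZero = 0) (hn : σ.intVar viN = n) (hlo : σ.realVar vrBot = lo)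
    (hh : σ.realVar vrHeight = h) :
    Ends collect σ (8 * n + 5) (fun σ' =>
      Same [viPtsC, viPt, viCount, 99] [vrTop, vrUy] [aiList] [] σ σ' ∧
      σ'.realVar vrTop = lo + h ∧
      σ'.intVar viCount = ((Finset.range n).filter fun i =>
        lo ≤ σ.realArr arPy i ∧ σ.realArr arPy i ≤ lo + h).card ∧
      (∀ c < σ'.intVar viCount, σ'.intArr aiList c < n ∧
        lo ≤ σ.realArr arPy (σ'.intArr aiList c) ∧ σ.realArr arPy (σ'.intArr aiList c) ≤ lo + h) ∧
      ∀ i < n, lo ≤ σ.realArr arPy i → σ.realArr arPy i ≤ lo + h →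
        ∃ c < σ'.intVar viCount, σ'.intArr aiList c = i) := by
  refine Ends.frame (Ends.bind (T₁ := 4) (T₂ := 8 * n + 1)
      (Ends.frame (wi := [viPtsC, viPt, viCount]) (wr := [vrTop]) (wa := []) (wb := [])
        (Ends.block (Q := fun σ' => σ'.realVar vrTop = lo + h ∧ σ'.intVar viPtsC = n ∧
          σ'.intVar viPt = 0 ∧ σ'.intVar viCount = 0) (by simp) (by simp) (by simp)
          (by simp [Instr.exec, hn, h0, hlo, hh])) rfl) ?_ (by omega)) rfl
  rintro σ₁ ⟨s, e₁, e₂, e₃, e₄⟩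
  refine Ends.mono (Ends.repeatN (N := n) (T₁ := 6) (fun i σ' => σ'.intVar viPt = i ∧
      σ'.intVar viCount = ((Finset.range i).filter fun i =>
        lo ≤ σ.realArr arPy i ∧ σ.realArr arPy i ≤ lo + h).card ∧
      (∀ c < σ'.intVar viCount, σ'.intArr aiList c < n ∧
        lo ≤ σ.realArr arPy (σ'.intArr aiList c) ∧ σ.realArr arPy (σ'.intArr aiList c) ≤ lo + h) ∧
      ∀ i' < i, lo ≤ σ.realArr arPy i' → σ.realArr arPy i' ≤ lo + h →
        ∃ c < σ'.intVar viCount, σ'.intArr aiList c = i')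
    [viPtsC, viPt, viCount, 99] [vrUy] [aiList] [] rfl rfl rfl ?_ e₂ ?_ ?_ ?_ le_rfl)
    (le_of_eq (by ring)) fun _ h => ⟨by rw [h.1.rv _ (by simp), e₁], h.2.2⟩
  · simp [s.iv, h1]
  · simp [e₃, e₄]
  · intro i σ v h; simpa using h
  · rintro i hi σ₂ s₂ ⟨f₁, f₂, f₃, f₄⟩
    have o : σ₂.intVar viOne = 1 := by simp [s₂.iv, s.iv, h1]
    refine Ends.bind (T₁ := 1) (T₂ := 5) (Ends.frame (wi := []) (wr := [vrUy]) (wa := [])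
      (wb := []) (Ends.block (Q := fun σ' => σ'.realVar vrUy = σ.realArr arPy i)
        (by simp) (by simp) (by simp)
        (by simp [Instr.exec, f₁, s₂.ra, s.ra])) rfl) ?_ (by omega)
    rintro σ₃ ⟨s₃, g₂⟩
    have hbot : σ₃.realVar vrBot = lo := by simp [s₃.rv, s₂.rv, s.rv, hlo]
    have htop : σ₃.realVar vrTop = lo + h := by simp [s₃.rv, s₂.rv, e₁]
    have hcnt : σ₃.intVar viCount = σ₂.intVar viCount := s₃.iv _ (by simp)
    have hpt : σ₃.intVar viPt = i := by rw [s₃.iv _ (by simp), f₁]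
    have hlist : σ₃.intArr aiList = σ₂.intArr aiList := s₃.ia _ (by simp)
    rw [← hcnt] at f₂ f₃ f₄
    rw [← hlist] at f₃ f₄
    refine Ends.bind (P := fun σ' => Same [viCount, 99] [] [aiList] [] σ₃ σ' ∧
      σ'.intVar viCount = ((Finset.range (i + 1)).filter fun i =>
        lo ≤ σ.realArr arPy i ∧ σ.realArr arPy i ≤ lo + h).card ∧
      (∀ c < σ'.intVar viCount, σ'.intArr aiList c < n ∧
        lo ≤ σ.realArr arPy (σ'.intArr aiList c) ∧ σ.realArr arPy (σ'.intArr aiList c) ≤ lo + h) ∧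
      ∀ i' < i + 1, lo ≤ σ.realArr arPy i' → σ.realArr arPy i' ≤ lo + h →
        ∃ c < σ'.intVar viCount, σ'.intArr aiList c = i') (T₁ := 4) (T₂ := 1)
        (Ends.frame ?_ rfl) ?_ (by omega)
    · have hskip : ¬ (lo ≤ σ.realArr arPy i ∧ σ.realArr arPy i ≤ lo + h) → ∀ T, 1 ≤ T →
          Ends skip σ₃ T (fun σ' => 
          σ'.intVar viCount = ((Finset.range (i + 1)).filter fun i =>
            lo ≤ σ.realArr arPy i ∧ σ.realArr arPy i ≤ lo + h).card ∧
          (∀ c < σ'.intVar viCount, σ'.intArr aiList c < n ∧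
            lo ≤ σ.realArr arPy (σ'.intArr aiList c) ∧
            σ.realArr arPy (σ'.intArr aiList c) ≤ lo + h) ∧
          ∀ i' < i + 1, lo ≤ σ.realArr arPy i' → σ.realArr arPy i' ≤ lo + h →
            ∃ c < σ'.intVar viCount, σ'.intArr aiList c = i') := by
        intro hno T hT
        refine Ends.skip hT ?_
        rw [Finset.range_add_one, Finset.filter_insert, if_neg hno]
        simp only [Nat.forall_lt_succ_right]
        exact ⟨f₂, f₃, f₄, fun h₁ h₂ => absurd ⟨h₁, h₂⟩ hno⟩
      refine Ends.ite (T₁ := 3) (fun hb => ?_) (fun hb => hskip (fun h' => hb ?_) _ (by omega))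
        (by omega)
      swap
      · simpa only [Test.Holds, hbot, g₂] using h'.1
      refine Ends.ite (T₁ := 2) (fun hb' => ?_) (fun hb => hskip (fun h' => hb ?_) _ (by omega))
        (by omega)
      swap
      · simpa only [Test.Holds, htop, g₂] using h'.2
      simp only [Test.Holds, hbot, htop, g₂] at hb hb'
      refine Ends.mono (Ends.block (T := 2) (Q := fun σ' => σ'.intVar viCount = σ₃.intVar viCount + 1 ∧
        ∀ c, σ'.intArr aiList c = if c = σ₃.intVar viCount then i else σ₃.intArr aiList c)
        (by simp) (by simp) (by simp) ?_) le_rfl ?_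
      · simp [Instr.exec, setEntry_apply, hpt, s₃.iv, o]
      · rintro σ₄ ⟨k₁, k₂⟩
        rw [k₁, Finset.range_add_one, Finset.filter_insert, if_pos ⟨hb, hb'⟩,
          Finset.card_insert_of_notMem (by simp), ← f₂]
        refine ⟨rfl, fun c hc => ?_, fun i' hi' h₁ h₂ => ?_⟩
        · rw [k₂]
          split_ifs with hcc
          · exact ⟨hi, hb, hb'⟩
          · exact f₃ c (by omega)
        · rcases Nat.lt_succ_iff_lt_or_eq.1 hi' with hlt | rfl
          · obtain ⟨c, hc, hcc⟩ := f₄ i' hlt h₁ h₂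
            exact ⟨c, by omega, by rw [k₂, if_neg hc.ne, hcc]⟩
          · exact ⟨σ₃.intVar viCount, by omega, by rw [k₂, if_pos rfl]⟩
    · rintro σ₄ ⟨s₄, k₁⟩
      refine Ends.block (by simp) (by simp) (by simp) ⟨?_, ?_⟩
      · simp [Instr.exec, s₄.iv, s₃.iv, f₁, o]
      · simpa [Instr.exec] using k₁

/-! ### The cyclic colouring of the strips -/

/-- The data of the problem as the program sees them: `n` points, `m` disks and a dummy disk, `k`
colours, the strip height `h`, the number `A` of remembered disks and the number `cls` of strip
classes. -/
structure Task where
  n : ℕ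
  m : ℕ
  k : ℕ
  A : ℕ
  cls : ℕ
  X : ℕ → ℝ
  Y : ℕ → ℝ
  PX : ℕ → ℝ
  PY : ℕ → ℝ
  h : ℝ
  B : ℝ

namespace Task

/-- The strip problem for the strip with lower boundary `lo`. -/
def strip (P : Task) (lo : ℝ) : Strip where
  k := P.k
  m := P.m
  A := P.A
  X := P.X
  Y := P.Y
  lo := lo
  h := P.h
  pts := {p | ∃ i < P.n, lo ≤ P.PY i ∧ P.PY i ≤ lo + P.h ∧ p = (P.PX i, P.PY i)}

structure Valid (P : Task) : Prop where
  kpos : 1 ≤ P.k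
  mem : (P.A = 3 ∧ P.h = 1 / 2 ∧ P.cls = 9) ∨ (P.A = 4 ∧ P.h = 4 / 3 ∧ P.cls = 4)
  dummy : P.X P.m = -P.B
  left : ∀ d < P.m, -P.B + 10 ≤ P.X d
  px : ∀ i < P.n, -P.B + 10 ≤ P.PX i ∧ P.PX i + 10 ≤ P.B
  py : ∀ i < P.n, -P.B + 10 ≤ P.PY i ∧ P.PY i + 10 ≤ P.B
  solvable : ∀ lo, ∃ L, (P.strip lo).Solves L

variable {P : Task}

lemma Valid.admissible (hP : P.Valid) (lo : ℝ) : (P.strip lo).Admissible P.B where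
  kpos := hP.kpos
  mem := hP.mem.imp (fun h => ⟨h.1, h.2.1⟩) (fun h => ⟨h.1, h.2.1⟩)
  dummy := hP.dummy
  left := hP.left
  pts_left := by rintro p ⟨i, hi, -, -, rfl⟩; exact (hP.px i hi).1
  pts_right := by rintro p ⟨i, hi, -, -, rfl⟩; exact (hP.px i hi).2
  pts_low := by rintro p ⟨i, hi, h, -, rfl⟩; exact h
  pts_high := by rintro p ⟨i, hi, -, h, rfl⟩; exact h

lemma Valid.half_le (hP : P.Valid) : 1 / 2 ≤ P.h := by
  rcases hP.mem with h | h <;> norm_num [h.2.1]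

/-- This is what fixes the number of classes: the bottoms of two strips of one class differ by more
than `4 + h`, while the centres used for a strip range over an interval of length `h + 2`. -/
lemma Valid.cls_mul (hP : P.Valid) : (P.cls : ℝ) * P.h = 4 + P.h := by
  rcases hP.mem with h | h <;> norm_num [h.2.1, h.2.2]

/-- The number of strips since class `c` was used, if class `cl` comes next. -/
def gap (P : Task) (cl c : ℕ) : ℕ := if c < cl then cl - c else cl + P.cls - c

/-- The colouring `out` is correct as far as the points up to height `last` are concerned; class
`cl` comes next. -/
structure Colored (P : Task) (last : ℝ) (cl : ℕ) (out : ℕ → ℕ) : Prop where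
  color : ∀ x, out x ≠ 0 → x < P.m ∧ ∃ c < P.cls, ∃ j < P.k, out x = c * P.k + j + 1 ∧
    P.Y x + P.gap cl c * P.h ≤ last + P.h + 1
  far : ∀ x x', x ≠ x' → out x ≠ 0 → out x = out x' → 4 < sqd (P.X x) (P.Y x) (P.X x') (P.Y x')
  cover : ∀ i < P.n, P.PY i ≤ last →
    ∃ x, out x ≠ 0 ∧ sqd (P.X x) (P.Y x) (P.PX i) (P.PY i) ≤ 1

/-- Counting cyclically, class `P.cls` is class `0`: the gap to any class `c < P.cls` is the same.
-/
lemma Colored.wrap {last : ℝ} {out : ℕ → ℕ} (h : P.Colored last P.cls out) :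
    P.Colored last 0 out where
  color x hx := by
    obtain ⟨hm, c, hc, j, hj, e, hy⟩ := h.color x hx
    refine ⟨hm, c, hc, j, hj, e, ?_⟩
    simpa [gap, hc] using hy
  far := h.far
  cover := h.cover

lemma eq_of_mul_add_eq {k c j c' j' : ℕ} (hj : j < k) (hj' : j' < k)
    (h : c * k + j = c' * k + j') : c = c' ∧ j = j' := by
  have h₁ : (c * k + j) / k = c := by
    rw [mul_comm, Nat.mul_add_div (by omega), Nat.div_eq_of_lt hj, add_zero]
  have h₂ : (c' * k + j') / k = c' := by
    rw [mul_comm, Nat.mul_add_div (by omega), Nat.div_eq_of_lt hj', add_zero]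
  have : c = c' := by rw [← h₁, h, h₂]
  subst this
  exact ⟨rfl, by omega⟩

/-- The new strip overwrites the colours of its disks. Points covered earlier stay covered, because
overwriting never deselects a disk; conflicts with older disks are excluded by their height. -/
lemma Colored.recolor (hP : P.Valid) {last lo : ℝ} {cl : ℕ} {out out' : ℕ → ℕ}
    {tr : List (ℕ × ℕ)} (h : P.Colored last cl out) (hcl : cl < P.cls) (hlo : last < lo)
    (hnext : ∀ i < P.n, last < P.PY i → lo ≤ P.PY i) (hg : (P.strip lo).Good tr)
    (hc : (P.strip lo).CoveredBefore tr P.B) (hr : Recolors tr (cl * P.k) out out') :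
    P.Colored (lo + P.h) (cl + 1) out' := by
  have hA := hP.admissible lo
  have hh := hP.half_le
  have hcls := hP.cls_mul
  have hb : ∀ q ∈ tr, q.1 < P.m ∧ q.2 < P.k ∧ lo - 1 ≤ P.Y q.1 ∧ P.Y q.1 ≤ lo + P.h + 1 := hg.bounds
  have hf := hg.far hA
  have hfar : ∀ {x x' j}, (x, j) ∈ tr → (x', j) ∈ tr → x ≠ x' →
      4 < sqd (P.X x) (P.Y x) (P.X x') (P.Y x') := by
    intro x x' j hx hx' hne
    have : Std.Symm (fun a b : ℕ × ℕ => a.2 = b.2 → 4 < sqd ((P.strip lo).X a.1)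
        ((P.strip lo).Y a.1) ((P.strip lo).X b.1) ((P.strip lo).Y b.1)) :=
      ⟨fun a b hab hba => by rw [sqd_comm]; exact hab hba.symm⟩
    exact hf.forall hx hx' (by simpa using hne) rfl
  -- An old disk with the same colour belongs to class `cl`, used `P.cls` strips ago: its centre is
  -- at most at `last - 3`, and the new one at least at `lo - 1 > last - 1`.
  have hmix : ∀ {x x' j}, (x, j) ∈ tr → out x' = cl * P.k + j + 1 →
      4 < sqd (P.X x) (P.Y x) (P.X x') (P.Y x') := by
    intro x x' j hx hx'
    obtain ⟨-, c, -, j', hj', e, hy⟩ := h.color x' (by omega)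
    obtain ⟨rfl, -⟩ := eq_of_mul_add_eq hj' (hb _ hx).2.1 (show c * P.k + j' = cl * P.k + j by omega)
    simp only [gap, lt_irrefl, if_false, Nat.add_sub_cancel_left] at hy
    rw [hcls] at hy
    have := (hb _ hx).2.2.1
    simp only at this
    unfold sqd
    nlinarith [mul_self_nonneg (P.X x - P.X x')]
  constructor
  · intro x hx
    rcases hr x with ⟨e, -⟩ | ⟨j, hj, e⟩
    · rw [e] at hx
      obtain ⟨hm, c, hc, j, hj, e', hy⟩ := h.color x hx
      refine ⟨hm, c, hc, j, hj, by rw [e, e'], ?_⟩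
      -- The gap grows by at most one, while the treated height grows from `last` to `lo + P.h`, by
      -- more than `P.h`.
      have : ((P.gap (cl + 1) c : ℕ) : ℝ) ≤ P.gap cl c + 1 := by
        norm_cast
        unfold gap
        split_ifs <;> omega
      nlinarith
    · have := hb _ hj
      refine ⟨this.1, cl, hcl, j, this.2.1, e, ?_⟩
      simp only [gap, Nat.lt_succ_self, if_true]
      simp only [add_tsub_cancel_left, Nat.cast_one]
      linarith [this.2.2.2]
  · intro x x' hne hx hxx
    rcases hr x with ⟨e, -⟩ | ⟨j, hj, e⟩ <;> rcases hr x' with ⟨e', -⟩ | ⟨j', hj', e'⟩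
    · exact h.far x x' hne (by rwa [← e]) (by rw [← e, ← e', hxx])
    · rw [sqd_comm]
      exact hmix hj' (by rw [← e, hxx, e'])
    · exact hmix hj (by rw [← e', ← hxx, e])
    · obtain rfl : j = j' := by omega
      exact hfar hj hj' hne
  · intro i hi hle
    rcases le_or_gt (P.PY i) last with h' | h'
    · obtain ⟨x, hx, hd⟩ := h.cover i hi h'
      refine ⟨x, ?_, hd⟩
      rcases hr x with ⟨e, -⟩ | ⟨j, hj, e⟩ <;> omega
    · obtain ⟨q, hq, hd⟩ := hg.covers hA hc (p := (P.PX i, P.PY i)) ⟨i, hi, hnext i hi h', hle, rfl⟩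
      refine ⟨q.1, ?_, hd⟩
      rcases hr q.1 with ⟨-, e⟩ | ⟨j, hj, e⟩
      · exact absurd hq (e q.2)
      · omega

/-! ### The number of strips -/

/-- The part of the disk with ordinate `y` that is still relevant. -/
def weight (P : Task) (last y : ℝ) : ℝ := min (2 + P.h) (max 0 (y + 1 + P.h - last))

def potential (P : Task) (last : ℝ) : ℝ := ∑ d ∈ Finset.range P.m, P.weight last (P.Y d)

lemma potential_nonneg (hP : P.Valid) (last : ℝ) : 0 ≤ P.potential last :=
  Finset.sum_nonneg fun _ _ => le_min (by linarith [hP.half_le]) (le_max_left _ _)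

/-- Each disk contributes at most `2 + h`, and `2 ≤ 4 * h` because `h ≥ 1/2`. -/
lemma potential_le (hP : P.Valid) (last : ℝ) : P.potential last ≤ (5 * P.m : ℕ) * P.h := by
  have := hP.half_le
  refine (Finset.sum_le_card_nsmul _ _ (2 + P.h) fun _ _ => min_le_left _ _).trans ?_
  simp only [Finset.card_range, nsmul_eq_mul]
  push_cast
  nlinarith [Nat.cast_nonneg (α := ℝ) P.m]

/-- Some disk covers the point at the bottom `lo` of the strip. Its weight falls to at most `y + 1 -
lo`, which is at most `2`, from at least that plus `h`; no other weight increases. -/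
lemma potential_add_le (hP : P.Valid) {last lo : ℝ} (hlo : last < lo) {i : ℕ} (hi : i < P.n)
    (hy : P.PY i = lo) : P.potential (lo + P.h) + P.h ≤ P.potential last := by
  have hh := hP.half_le
  obtain ⟨L, hL⟩ := hP.solvable lo
  obtain ⟨q, hq, hd⟩ := hL.covers (P.PX i, P.PY i) ⟨i, hi, hy.ge, by linarith, rfl⟩
  have hqm : q.1 < P.m := (hL.bounds q hq).1
  change sqd (P.X q.1) (P.Y q.1) (P.PX i) (P.PY i) ≤ 1 at hd
  rw [hy] at hd
  have h₁ : P.Y q.1 - lo ≤ 1 := by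
    by_contra! hcon
    unfold sqd at hd
    nlinarith [mul_self_nonneg (P.X q.1 - P.PX i)]
  have h₂ : lo - P.Y q.1 ≤ 1 := by
    by_contra! hcon
    unfold sqd at hd
    nlinarith [mul_self_nonneg (P.X q.1 - P.PX i)]
  have hq' := Finset.mem_range.2 hqm
  unfold potential
  rw [← Finset.add_sum_erase _ _ hq', ← Finset.add_sum_erase _ _ hq']
  have hsum : ∑ d ∈ (Finset.range P.m).erase q.1, P.weight (lo + P.h) (P.Y d) ≤
      ∑ d ∈ (Finset.range P.m).erase q.1, P.weight last (P.Y d) :=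
    Finset.sum_le_sum fun d _ => min_le_min le_rfl (max_le_max le_rfl (by linarith))
  have hone : P.weight (lo + P.h) (P.Y q.1) + P.h ≤ P.weight last (P.Y q.1) := by
    have : P.weight (lo + P.h) (P.Y q.1) ≤ P.Y q.1 + 1 - lo := by
      unfold weight
      refine (min_le_right _ _).trans (max_le ?_ ?_) <;> linarith
    unfold weight at this ⊢
    exact le_min (by linarith) (le_max_of_le_right (by linarith))
  linarith

end Task

/-- The part of the store that does not change while the strips are processed. -/
structure Memory (P : Task) (σ : Store) : Prop where
  n : σ.intVar viN = P.n
  m : σ.intVar viM = P.m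
  k : σ.intVar viK = P.k
  one : σ.intVar viOne = 1
  base : σ.intVar viBase = P.m + 1
  digits : σ.intVar viDigits = 4 * P.k
  four : σ.intVar viFour = 4
  classes : σ.intVar viClasses = P.cls
  long : 1 ≤ σ.intVar viLong ↔ P.A = 4
  zero : σ.intVar viZero = 0
  rone : σ.realVar vrOne = 1
  height : σ.realVar vrHeight = P.h
  bound : σ.realVar vrBound = P.B
  PX : σ.realArr arPx = P.PX
  PY : σ.realArr arPy = P.PY
  X : σ.realArr arCx = P.X
  Y : σ.realArr arCy = P.Y
  pow : ∀ i < 4 * P.k, ∀ v < P.m + 1,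
    σ.intArr aiPow (i * (P.m + 1) + v) = v * (P.m + 1) ^ i

lemma Memory.of_same {P : Task} {σ σ' : Store} (h : Memory P σ)
    {wi wr wa wb : List ℕ} (s : Same wi wr wa wb σ σ')
    (hi : [0, 1, 2, 3, 4, 5, 6, 7, 8, 9].all (fun x => !wi.contains x) = true)
    (hr : [1, 3, 4].all (fun x => !wr.contains x) = true)
    (ha : [7].all (fun x => !wa.contains x) = true)
    (hb : [0, 1, 2, 3].all (fun x => !wb.contains x) = true) : Memory P σ' := by
  simp only [List.all_cons, List.all_nil, Bool.and_true, Bool.and_eq_true, Bool.not_eq_true',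
    ← Bool.not_eq_true, List.contains_iff_mem] at hi hr ha hb
  constructor <;> first
    | (rw [s.iv _ (by tauto)]; cases h; assumption)
    | (rw [s.rv _ (by tauto)]; cases h; assumption)
    | (rw [s.ra _ (by tauto)]; cases h; assumption)
    | (simp only [s.ia _ ha]; cases h; assumption)

/-- Treat the next strip, if there is one. -/
def nextStrip : Prog :=
  findBottom ;; .ite (.realLe vrBound vrBot) (block [.intConst viGo 0]) (
    collect ;;
    block [.realSub vrLow vrBot vrOne, .realAdd vrHigh vrTop vrOne, .intAdd viStamp viStamp viOne] ;;
    solveStrip ;;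
    block [.realMul vrLast vrTop vrOne, .intAdd viShift viShift viK, .intAdd viClass viClass viOne] ;;
    .ite (.intLe viClasses viClass) (block [.intConst viShift 0, .intConst viClass 0]) skip)

/-- The state of the computation when all points up to height `y` have been treated. -/
structure StripsInv (P : Task) (y : ℝ) (σ : Store) : Prop where
  mem : Memory P σ
  seen : ∀ c, σ.intArr aiSeen c ≤ σ.intVar viStamp
  last : σ.realVar vrLast = y
  class_lt : σ.intVar viClass < P.cls
  shift : σ.intVar viShift = σ.intVar viClass * P.k
  colored : P.Colored y (σ.intVar viClass) (σ.intArr aiOut)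

open Classical in
/-- The number of points still to be treated. -/
def Task.remaining (P : Task) (last : ℝ) : ℕ :=
  ((Finset.range P.n).filter fun i => last < P.PY i).card

/-- Reducing to one point makes the total time additive in the numbers of points of the strips. -/
lemma solveTime_le (m k A : ℕ) {cnt : ℕ} (h : 1 ≤ cnt) :
    solveTime m k A cnt ≤ cnt * solveTime m k A 1 := by
  have h₁ : expandTime m k cnt + 8 ≤ cnt * (expandTime m k 1 + 8) := by
    unfold expandTime
    have : k * (56 * k + 93) + 17 ≤ cnt * (k * (56 * k + 93) + 17) := Nat.le_mul_of_pos_left _ h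
    nlinarith
  unfold solveTime
  have h₂ := Nat.mul_le_mul_left ((m + 1) ^ (A * k) + 1) h₁
  have h₃ : 16 * k + 13 ≤ cnt * (16 * k + 13) := Nat.le_mul_of_pos_left _ h
  nlinarith

-- The outcome is decided before the run: either no point is left, or the strip and its number of
-- points can be named, so that the time bound may refer to them.
open Classical in
lemma nextStrip_spec {P : Task} (hP : P.Valid) {last : ℝ} {σ : Store} (h : StripsInv P last σ)
    (hgo : σ.intVar viGo = 1) :
    Ends nextStrip σ (7 * P.n + 6) (fun σ' => σ'.intVar viGo = 0 ∧ P.remaining last = 0 ∧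
      StripsInv P last σ') ∨
    ∃ lo, ∃ i < P.n, P.PY i = lo ∧ last < lo ∧ ∃ cnt, 1 ≤ cnt ∧
      P.remaining (lo + P.h) + cnt ≤ P.remaining last ∧
      Ends nextStrip σ (15 * P.n + 20 + solveTime P.m P.k P.A cnt) (fun σ' =>
        σ'.intVar viGo = 1 ∧ StripsInv P (lo + P.h) σ') := by
  have hM := h.mem
  have hfb := findBottom_spec hM.one hM.zero hM.n hM.rone hM.bound
  rw [h.last, hM.PY] at hfb
  obtain ⟨t₁, σ₁, ht₁, hrun₁, s₁, hb₁, hb₂, hb₃⟩ := hfb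
  have hM₁ := hM.of_same s₁ rfl rfl rfl rfl
  have hh := hP.half_le
  by_cases hbot : P.B ≤ σ₁.realVar vrBot
  · left
    refine Ends.bind (T₁ := 7 * P.n + 4) (T₂ := 2) (P := fun σ' => σ' = σ₁)
      ⟨t₁, σ₁, ht₁, hrun₁, rfl⟩ ?_ (by omega)
    rintro _ rfl
    refine Ends.ite (T₁ := 1) (fun _ => ?_) (fun hb => absurd ?_ hb) (by omega)
    · refine Ends.mono (Ends.frame (wi := [viGo]) (wr := []) (wa := []) (wb := [])
        (Ends.block (Q := fun σ' => σ'.intVar viGo = 0) (by simp) (by simp) (by simp)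
        (by simp [Instr.exec])) rfl) le_rfl ?_
      rintro σ₂ ⟨s₂, g⟩
      refine ⟨g, ?_, hM₁.of_same s₂ rfl rfl rfl rfl, ?_, ?_, ?_, ?_, ?_⟩
      · unfold Task.remaining
        rw [Finset.card_eq_zero, Finset.filter_eq_empty_iff]
        intro i hi hlt
        rw [Finset.mem_range] at hi
        linarith [hb₃ i hi hlt, (hP.py i hi).2]
      · simpa [s₂.ia, s₁.ia, s₂.iv, s₁.iv] using h.seen
      · simpa [s₂.rv, s₁.rv] using h.last
      · simpa [s₂.iv, s₁.iv] using h.class_lt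
      · simpa [s₂.iv, s₁.iv] using h.shift
      · simpa [s₂.iv, s₁.iv, s₂.ia, s₁.ia] using h.colored
    · simpa only [Test.Holds, hM₁.bound] using hbot
  · right
    obtain ⟨i, hi, hy, hlast⟩ := hb₁.resolve_left fun e => hbot e.ge
    set lo := σ₁.realVar vrBot with hlo
    rw [← hy] at hlast
    set cnt := ((Finset.range P.n).filter fun i => lo ≤ P.PY i ∧ P.PY i ≤ lo + P.h).card with hcnt
    refine ⟨lo, i, hi, hy.symm, hlast, cnt, ?_, ?_, ?_⟩
    · exact Finset.card_pos.2 ⟨i, by simp [hi, ← hy]; linarith⟩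
    · unfold Task.remaining
      rw [hcnt, ← Finset.card_union_of_disjoint]
      · refine Finset.card_le_card fun i hi => ?_
        simp only [Finset.mem_union, Finset.mem_filter, Finset.mem_range] at hi ⊢
        rcases hi with hi | hi
        · exact ⟨hi.1, by linarith⟩
        · exact ⟨hi.1, by linarith⟩
      · rw [Finset.disjoint_filter]
        intro i _ h₁ h₂
        linarith
    · refine Ends.bind (T₁ := 7 * P.n + 4) (T₂ := 8 * P.n + 16 + solveTime P.m P.k P.A cnt)
        (P := fun σ' => σ' = σ₁) ⟨t₁, σ₁, ht₁, hrun₁, rfl⟩ ?_ (by omega)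
      rintro _ rfl
      refine Ends.ite (T₁ := 8 * P.n + 15 + solveTime P.m P.k P.A cnt) (fun hb => absurd hb ?_)
        (fun hb => ?_) (by omega)
      · simpa only [Test.Holds, hM₁.bound] using hbot
      refine Ends.bind (collect_spec hM₁.one hM₁.zero hM₁.n hlo.symm hM₁.height)
        (T₂ := 10 + solveTime P.m P.k P.A cnt) ?_ (by omega)
      rintro σ₂ ⟨s₂, c₁, c₂, c₃, c₄⟩
      rw [hM₁.PY] at c₂ c₃ c₄
      rw [← hcnt] at c₂
      have hM₂ := hM₁.of_same s₂ rfl rfl rfl rfl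
      refine Ends.bind (T₁ := 3) (Ends.frame (wi := [viStamp]) (wr := [vrLow, vrHigh]) (wa := [])
        (wb := []) (Ends.block (Q := fun σ' => σ'.intVar viStamp = σ.intVar viStamp + 1 ∧
          σ'.realVar vrLow = lo - 1 ∧ σ'.realVar vrHigh = lo + P.h + 1)
          (by simp) (by simp) (by simp) (by
            simp [Instr.exec, c₁, s₂.rv, ← hlo, hM₁.rone, s₂.iv, s₁.iv, hM.one])) rfl)
        (T₂ := 7 + solveTime P.m P.k P.A cnt) ?_ (by omega)
      rintro σ₃ ⟨s₃, d₁, d₂, d₃⟩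
      have hM₃ := hM₂.of_same s₃ rfl rfl rfl rfl
      have hlist : σ₃.intArr aiList = σ₂.intArr aiList := s₃.ia _ (by simp)
      have hcount : σ₃.intVar viCount = cnt := by rw [s₃.iv _ (by simp), c₂]
      have hS : Setup (P.strip lo) P.B cnt (σ.intVar viStamp + 1) σ₃ := by
        refine ⟨hM₃.one, hM₃.zero, hM₃.m, hM₃.k, hM₃.base, hM₃.digits, hM₃.four, hM₃.long,
          hcount, d₁, hM₃.rone, hM₃.bound, d₂, d₃, hM₃.X, hM₃.Y, ?_, hM₃.pow⟩
        rw [hM₃.PX, hM₃.PY, hlist]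
        ext p
        constructor
        · rintro ⟨i, hi, h₁, h₂, rfl⟩
          obtain ⟨c, hc, rfl⟩ := c₄ i hi h₁ h₂
          exact ⟨c, by rwa [← c₂], rfl⟩
        · rintro ⟨c, hc, rfl⟩
          obtain ⟨h₁, h₂, h₃⟩ := c₃ c (by rwa [c₂])
          exact ⟨_, h₁, h₂, h₃, rfl⟩
      obtain ⟨L, hL⟩ := hP.solvable lo
      refine Ends.bind (solveStrip_spec (hP.admissible lo) hL hS (fun c => ?_)) (T₂ := 7) ?_
        (by rw [add_comm]; exact le_rfl)
      · have := h.seen c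
        simp [s₃.ia, s₂.ia, s₁.ia]
        omega
      rintro σ₄ ⟨s₄, hseen, tr, hg, hcov, hrec⟩
      have hM₄ := hM₃.of_same s₄ rfl rfl rfl rfl
      have q₁ : σ₃.intVar viShift = σ.intVar viClass * P.k := by
        rw [← h.shift]; simp [s₃.iv, s₂.iv, s₁.iv]
      have q₂ : σ₃.intArr aiOut = σ.intArr aiOut := by simp [s₃.ia, s₂.ia, s₁.ia]
      have q₃ : σ₄.intVar viShift = σ.intVar viClass * P.k := by rw [s₄.iv _ (by simp), q₁]
      have q₄ : σ₄.intVar viClass = σ.intVar viClass := by simp [s₄.iv, s₃.iv, s₂.iv, s₁.iv]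
      have q₅ : σ₄.realVar vrTop = lo + P.h := by rw [← c₁]; simp [s₄.rv, s₃.rv]
      have q₆ : σ₄.intVar viStamp = σ.intVar viStamp + 1 := by rw [s₄.iv _ (by simp), d₁]
      have q₇ : σ₄.intVar viGo = 1 := by simp [s₄.iv, s₃.iv, s₂.iv, s₁.iv, hgo]
      rw [q₁, q₂] at hrec
      have hcol := h.colored.recolor hP h.class_lt hlast (fun i hi hl => hb₃ i hi hl) hg hcov hrec
      refine Ends.bind (T₁ := 3) (Ends.frame (wi := [viShift, viClass]) (wr := [vrLast]) (wa := [])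
        (wb := []) (Ends.block (Q := fun σ' => σ'.realVar vrLast = lo + P.h ∧
          σ'.intVar viShift = (σ.intVar viClass + 1) * P.k ∧
          σ'.intVar viClass = σ.intVar viClass + 1)
          (by simp) (by simp) (by simp) (by
            simp [Instr.exec, q₃, q₄, q₅, hM₄.rone, hM₄.one, hM₄.k, add_mul])) rfl)
        (T₂ := 4) ?_ (by omega)
      rintro σ₅ ⟨s₅, f₁, f₂, f₃⟩
      have hM₅ := hM₄.of_same s₅ rfl rfl rfl rfl
      have r₁ : σ₅.intArr aiOut = σ₄.intArr aiOut := s₅.ia _ (by simp)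
      have r₂ : ∀ c, σ₅.intArr aiSeen c ≤ σ₅.intVar viStamp := by
        intro c
        rw [s₅.ia _ (by simp), s₅.iv _ (by simp), q₆]
        exact hseen c
      have r₃ : σ₅.intVar viGo = 1 := by rw [s₅.iv _ (by simp), q₇]
      rw [← r₁] at hcol
      have hcl := h.class_lt
      refine Ends.ite (T₁ := 2) (fun hb => ?_) (fun hb => Ends.skip (by simp) ?_) (by omega)
      · simp only [Test.Holds, f₃, hM₅.classes] at hb
        obtain hcl' : σ.intVar viClass + 1 = P.cls := by omega
        rw [hcl'] at hcol
        refine Ends.mono (Ends.frame (wi := [viShift, viClass]) (wr := []) (wa := [])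
          (wb := []) (Ends.block (Q := fun σ' => σ'.intVar viShift = 0 ∧ σ'.intVar viClass = 0)
          (by simp) (by simp) (by simp) (by simp [Instr.exec])) rfl) le_rfl ?_
        rintro σ₆ ⟨s₆, g₁, g₂⟩
        refine ⟨by rw [s₆.iv _ (by simp), r₃], hM₅.of_same s₆ rfl rfl rfl rfl, ?_, ?_, ?_, ?_, ?_⟩
        · intro c
          rw [s₆.ia _ (by simp), s₆.iv _ (by simp)]
          exact r₂ c
        · rw [s₆.rv _ (by simp), f₁]
        · rw [g₂]; omega
        · rw [g₁, g₂, zero_mul]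
        · rw [g₂, s₆.ia _ (by simp)]
          exact hcol.wrap
      · simp only [Test.Holds, f₃, hM₅.classes] at hb
        have s₆ := same_update σ₅ 99 0
        refine ⟨by simpa using r₃, hM₅.of_same s₆ rfl rfl rfl rfl, ?_, ?_, ?_, ?_, ?_⟩
        · simpa using r₂
        · exact f₁
        · simp [f₃]; omega
        · simp [f₂, f₃]
        · simpa [f₃] using hcol

/-- Treat all strips. -/
def allStrips : Prog := .loop (.intLe viOne viGo) nextStrip

lemma allStrips_spec {P : Task} (hP : P.Valid) {last : ℝ} {σ : Store} (h : StripsInv P last σ)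
    (hgo : σ.intVar viGo = 1) :
    Ends allStrips σ (5 * P.m * (15 * P.n + 21) + P.remaining last * solveTime P.m P.k P.A 1 +
      (7 * P.n + 8)) (fun σ' => ∃ last' cl, P.remaining last' = 0 ∧
        P.Colored last' cl (σ'.intArr aiOut)) := by
  have hh := hP.half_le
  -- Here `s` bounds the number of strips to come through the potential, and the remaining points
  -- pay for the searches.
  refine Ends.loop (fun r σ' => ∃ last', StripsInv P last' σ' ∧
    ((σ'.intVar viGo = 0 ∧ P.remaining last' = 0 ∧ 1 ≤ r) ∨
    (σ'.intVar viGo = 1 ∧ ∃ s : ℕ, P.potential last' ≤ s * P.h ∧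
      s * (15 * P.n + 21) + P.remaining last' * solveTime P.m P.k P.A 1 + (7 * P.n + 8) ≤ r)))
    ⟨last, h, Or.inr ⟨hgo, 5 * P.m, Task.potential_le hP last, le_rfl⟩⟩ ?_ ?_
  · rintro r σ' ⟨last', hI, ⟨h₁, h₂, h₃⟩ | ⟨h₁, -⟩⟩ hb
    · exact ⟨h₃, last', _, h₂, hI.colored⟩
    · simp [Test.Holds, hI.mem.one, h₁] at hb
  · rintro r σ' ⟨last', hI, ⟨h₁, -⟩ | ⟨h₁, s, hs, hr⟩⟩ hb
    · simp [Test.Holds, hI.mem.one, h₁] at hb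
    · rcases nextStrip_spec hP hI h₁ with hE | ⟨lo, i, hi, hy, hlo, cnt, hc, hrem, hE⟩
      · refine ⟨_, 1, ?_, hE.mono le_rfl fun σ'' ⟨k₁, k₂, k₃⟩ =>
          ⟨last', k₃, Or.inl ⟨k₁, k₂, le_rfl⟩⟩⟩
        omega
      · have hpot := Task.potential_add_le hP hlo hi hy
        have hnn := Task.potential_nonneg hP (lo + P.h)
        have hs1 : 1 ≤ s := by
          by_contra! hcon
          obtain rfl : s = 0 := by omega
          simp at hs
          linarith
        obtain ⟨s', rfl⟩ : ∃ s', s = s' + 1 := ⟨s - 1, by omega⟩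
        refine ⟨_, s' * (15 * P.n + 21) + P.remaining (lo + P.h) * solveTime P.m P.k P.A 1 +
          (7 * P.n + 8), ?_, hE.mono le_rfl fun σ'' ⟨k₁, k₂⟩ =>
          ⟨lo + P.h, k₂, Or.inr ⟨k₁, s', ?_, le_rfl⟩⟩⟩
        · have h₁ := solveTime_le P.m P.k P.A hc
          have h₂ := Nat.mul_le_mul_right (solveTime P.m P.k P.A 1) hrem
          rw [add_mul] at h₂ hr
          omega
        · push_cast at hs
          linarith

/-! ### From the input to strip problems -/

lemma dist_sq_eq_sqd (c z : Plane) : dist z c ^ 2 = sqd (c 0) (c 1) (z 0) (z 1) := by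
  rw [EuclideanSpace.dist_eq, Real.sq_sqrt (by positivity)]
  simp only [Fin.sum_univ_two, Real.dist_eq, sq_abs, sqd]
  ring

lemma mem_unitDisk_iff (c z : Plane) : z ∈ unitDisk c ↔ sqd (c 0) (c 1) (z 0) (z 1) ≤ 1 := by
  rw [unitDisk, Metric.mem_closedBall, ← dist_sq_eq_sqd, sq_le_one_iff₀ dist_nonneg]

/-- If the centres are at distance at most `2`, their midpoint lies in both disks. -/
lemma disjoint_unitDisk_iff (c c' : Plane) :
    Disjoint (unitDisk c) (unitDisk c') ↔ 4 < sqd (c 0) (c 1) (c' 0) (c' 1) := by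
  rw [← dist_sq_eq_sqd, show (4 : ℝ) = 2 ^ 2 by norm_num,
    pow_lt_pow_iff_left₀ (by norm_num) dist_nonneg (by norm_num)]
  constructor
  · intro h
    by_contra! hd
    have hl : midpoint ℝ c c' ∈ unitDisk c := by
      rw [unitDisk, Metric.mem_closedBall, dist_midpoint_left, dist_comm c c']
      norm_num
      linarith
    have hr : midpoint ℝ c c' ∈ unitDisk c' := by
      rw [unitDisk, Metric.mem_closedBall, dist_midpoint_right, dist_comm c c']
      norm_num
      linarith
    exact Set.disjoint_left.1 h hl hr
  · intro h
    refine Metric.closedBall_disjoint_closedBall ?_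
    rw [dist_comm]
    linarith

lemma coords_of_lt {r : ℕ} (f : Fin r → Plane) (i : Fin 2) (j : Fin r) :
    coords f i j = f j i := by
  simp [coords]

open Classical in
/-- The task for the input `I`, with bound `B`. -/
def taskOf (τ : ℝ) (I : Input) (B : ℝ) : Task where
  n := I.n
  m := I.m
  k := I.k
  A := if 2 ≤ τ * τ then 4 else 3
  cls := if 2 ≤ τ * τ then 4 else 9
  X := Function.update (coords I.center 0) I.m (-B)
  Y := coords I.center 1
  PX := coords I.point 0
  PY := coords I.point 1
  h := if 2 ≤ τ * τ then 4 / 3 else 1 / 2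
  B := B

variable {τ B : ℝ} {I : Input}

lemma taskOf_X (j : Fin I.m) : (taskOf τ I B).X j = I.center j 0 := by
  simp [taskOf, Function.update_of_ne j.2.ne, coords_of_lt]

lemma taskOf_Y (j : Fin I.m) : (taskOf τ I B).Y j = I.center j 1 := coords_of_lt _ _ _

-- The given cover solves every strip: keep the disks within vertical reach, sort them from right to
-- left, and shift the colours to start at `0`.
open Classical in
lemma taskOf_solvable (hc : I.HasColorableCover I.k) (lo : ℝ) :
    ∃ L, ((taskOf τ I B).strip lo).Solves L := by
  obtain ⟨S, χ, hcov, hcol, hdis⟩ := hc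
  set G := (taskOf τ I B).strip lo with hG
  let r : ℕ × ℕ → ℕ × ℕ → Prop := fun a b => G.X b.1 ≤ G.X a.1
  have hr₁ : Std.Total r := ⟨fun a b => le_total _ _⟩
  have hr₂ : IsTrans (ℕ × ℕ) r := ⟨fun a b c h₁ h₂ => le_trans h₂ h₁⟩
  let L₀ : List (ℕ × ℕ) := ((List.finRange I.m).filter fun j : Fin I.m => j ∈ S ∧ G.lo - 1 ≤ G.Y j ∧
    G.Y j ≤ G.lo + G.h + 1).map fun j : Fin I.m => ((j : ℕ), χ j - 1)
  have hmem : ∀ q, q ∈ L₀.insertionSort r ↔ ∃ j : Fin I.m, (j ∈ S ∧ G.lo - 1 ≤ G.Y j ∧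
      G.Y j ≤ G.lo + G.h + 1) ∧ ((j : ℕ), χ j - 1) = q := by
    intro q
    rw [List.mem_insertionSort]
    simp [L₀]
  have hnd : (L₀.insertionSort r).Nodup := by
    rw [(List.perm_insertionSort r L₀).nodup_iff]
    refine List.Nodup.map (fun a b hab => ?_) ((List.nodup_finRange _).filter _)
    exact Fin.ext (congrArg Prod.fst hab)
  refine ⟨L₀.insertionSort r, ?_, List.pairwise_insertionSort r L₀, ?_, ?_⟩
  · intro q hq
    obtain ⟨j, ⟨hj, h₁, h₂⟩, rfl⟩ := (hmem q).1 hq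
    have := hcol j hj
    refine ⟨j.2, ?_, h₁, h₂⟩
    change χ j - 1 < I.k
    omega
  · refine List.Nodup.pairwise_of_forall_ne hnd ?_
    intro a ha b hb hab hcc
    obtain ⟨j, ⟨hj, -⟩, rfl⟩ := (hmem a).1 ha
    obtain ⟨j', ⟨hj', -⟩, rfl⟩ := (hmem b).1 hb
    have h₁ := hcol j hj
    have h₂ := hcol j' hj'
    simp only at hcc
    have hne : j ≠ j' := fun h => hab (by rw [h])
    have := (disjoint_unitDisk_iff _ _).1 (hdis j hj j' hj' hne (by omega))
    change 4 < sqd ((taskOf τ I B).X j) ((taskOf τ I B).Y j) ((taskOf τ I B).X j')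
      ((taskOf τ I B).Y j')
    rwa [taskOf_X, taskOf_X, taskOf_Y, taskOf_Y]
  · rintro p ⟨i, hi, hlo, hhi, rfl⟩
    obtain ⟨j, hj, hd⟩ := hcov ⟨i, hi⟩
    rw [mem_unitDisk_iff] at hd
    have e₁ : (taskOf τ I B).PX i = I.point ⟨i, hi⟩ 0 := coords_of_lt I.point 0 ⟨i, hi⟩
    have e₂ : (taskOf τ I B).PY i = I.point ⟨i, hi⟩ 1 := coords_of_lt I.point 1 ⟨i, hi⟩
    rw [← e₁, ← e₂, ← taskOf_X (τ := τ) (B := B), ← taskOf_Y (τ := τ) (B := B)] at hd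
    refine ⟨((j : ℕ), χ j - 1), (hmem _).2 ⟨j, ⟨hj, ?_, ?_⟩, rfl⟩, hd⟩
    · change lo - 1 ≤ (taskOf τ I B).Y j
      by_contra! hcon
      unfold sqd at hd
      nlinarith [mul_self_nonneg ((taskOf τ I B).X j - (taskOf τ I B).PX i)]
    · change (taskOf τ I B).Y j ≤ lo + (taskOf τ I B).h + 1
      by_contra! hcon
      unfold sqd at hd
      nlinarith [mul_self_nonneg ((taskOf τ I B).X j - (taskOf τ I B).PX i)]

lemma taskOf_valid (hk : 1 ≤ I.k) (hc : I.HasColorableCover I.k)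
    (hX : ∀ i < I.m, |coords I.center 0 i| + 19 ≤ B) (hPX : ∀ i < I.n, |coords I.point 0 i| + 19 ≤ B)
    (hPY : ∀ i < I.n, |coords I.point 1 i| + 19 ≤ B) : (taskOf τ I B).Valid where
  kpos := hk
  mem := by
    unfold taskOf
    by_cases h : 2 ≤ τ * τ <;> simp [h]
  dummy := by simp [taskOf]
  left d hd := by
    have h := hX d hd
    have : (taskOf τ I B).X d = coords I.center 0 d := by
      simp [taskOf, Function.update_of_ne (show d ≠ I.m from hd.ne)]
    rw [this]
    change -B + 10 ≤ _
    linarith [neg_abs_le (coords I.center 0 d)]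
  px i hi := by
    have h := hPX i hi
    change -B + 10 ≤ coords I.point 0 i ∧ coords I.point 0 i + 10 ≤ B
    constructor <;> linarith [neg_abs_le (coords I.point 0 i), le_abs_self (coords I.point 0 i)]
  py i hi := by
    have h := hPY i hi
    change -B + 10 ≤ coords I.point 1 i ∧ coords I.point 1 i + 10 ≤ B
    constructor <;> linarith [neg_abs_le (coords I.point 1 i), le_abs_self (coords I.point 1 i)]
  solvable := taskOf_solvable hc

/-- A correct colouring of the task is a coloured cover of the input. -/
lemma Task.Colored.isColoredCover {last : ℝ} {cl ρ : ℕ} {out : ℕ → ℕ} {σ : Store}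
    (h : (taskOf τ I B).Colored last cl out) (hrem : (taskOf τ I B).remaining last = 0)
    (hσ : σ.intArr 0 = out) (hρ : (taskOf τ I B).cls ≤ ρ) :
    I.IsColoredCover (ρ * I.k) (outDisks I σ) (outColor I σ) := by
  have hout : ∀ j : Fin I.m, outColor I σ j = out j := fun j => by rw [outColor, hσ]
  refine ⟨fun i => ?_, fun j hj => ?_, fun j hj j' hj' hne hcol => ?_⟩
  · have hle : (taskOf τ I B).PY i ≤ last := by
      unfold Task.remaining at hrem
      rw [Finset.card_eq_zero, Finset.filter_eq_empty_iff] at hrem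
      exact not_lt.1 (hrem (Finset.mem_range.2 i.2))
    obtain ⟨x, hx, hd⟩ := h.cover i i.2 hle
    have hxm : x < I.m := (h.color x hx).1
    refine ⟨⟨x, hxm⟩, ?_, ?_⟩
    · change outColor I σ ⟨x, hxm⟩ ≠ 0
      rwa [hout]
    · rw [mem_unitDisk_iff, ← taskOf_X (τ := τ) (B := B), ← taskOf_Y (τ := τ) (B := B),
        ← coords_of_lt I.point 0 i, ← coords_of_lt I.point 1 i]
      exact hd
  · change outColor I σ j ≠ 0 at hj
    rw [hout] at hj ⊢
    obtain ⟨-, c, hc, i, hi, e, -⟩ := h.color j hj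
    refine ⟨by omega, ?_⟩
    have h₁ : (c + 1) * I.k ≤ ρ * I.k := Nat.mul_le_mul_right _ (by omega)
    change i < I.k at hi
    change out j = c * I.k + i + 1 at e
    rw [add_mul] at h₁
    omega
  · change outColor I σ j ≠ 0 at hj
    rw [hout] at hj
    rw [hout, hout] at hcol
    rw [disjoint_unitDisk_iff]
    have := h.far j j' (fun h => hne (Fin.ext h)) hj hcol
    rwa [taskOf_X, taskOf_X, taskOf_Y, taskOf_Y] at this

/-! ### The program: preparations -/

/-- Give each disk its own colour. -/
def colorAll : Prog :=
  block [.intConst viDst 0, .intAdd viCopyC viM viZero] ;;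
  repeatN viCopyC (block [.intAdd viTmp viDst viOne, .intStore aiOut viDst viTmp,
    .intAdd viDst viDst viOne])

lemma colorAll_spec {σ : Store} {m : ℕ} (h1 : σ.intVar viOne = 1) (h0 : σ.intVar viZero = 0)
    (hm : σ.intVar viM = m) :
    Ends colorAll σ (5 * m + 3) (fun σ' => ∀ x < m, σ'.intArr aiOut x = x + 1) := by
  refine Ends.bind (T₁ := 2) (T₂ := 5 * m + 1)
      (Ends.frame (wi := [viDst, viCopyC]) (wr := []) (wa := []) (wb := [])
        (Ends.block (Q := fun σ' => σ'.intVar viDst = 0 ∧ σ'.intVar viCopyC = m)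
          (by simp) (by simp) (by simp) (by simp [Instr.exec, hm, h0])) rfl) ?_ (by omega)
  rintro σ₁ ⟨s, e₁, e₂⟩
  refine Ends.mono (Ends.repeatN (N := m) (T₁ := 3) (fun i σ' => σ'.intVar viDst = i ∧
    ∀ x < i, σ'.intArr aiOut x = x + 1)
    [viDst, viCopyC, viTmp] [] [aiOut] [] rfl rfl rfl ?_ e₂ ?_ ?_ ?_ le_rfl)
    (le_of_eq (by ring)) fun _ h => h.2.2
  · simp [s.iv, h1]
  · simp [e₁]
  · intro i σ v h; simpa using h
  · rintro i hi σ₂ s₂ ⟨f₁, f₂⟩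
    have o : σ₂.intVar 3 = 1 := by simp [s₂.iv, s.iv, h1]
    refine Ends.block (by simp) (by simp) (by simp) ⟨?_, ?_⟩
    · simp [Instr.exec, f₁, o]
    · intro x hx
      simp only [List.foldl, Instr.exec, setEntry_apply, Function.update_apply]
      by_cases h : x = i
      · simp [h, f₁, o]
      · simp [h, f₁, f₂ x (by omega)]

/-- Add the squares of the entries of the array `a` to the bound; the variable `c` holds their
number. -/
def addSquares (a c : ℕ) : Prog :=
  block [.intAdd viCopyC c viZero, .intConst viDst 0] ;;
  repeatN viCopyC (block [.realLoad vrX a viDst, .realMul vrX vrX vrX,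
    .realAdd vrBound vrBound vrX, .intAdd viDst viDst viOne])

/-- Sums of squares give a bound for all coordinates without absolute values or maxima. -/
lemma addSquares_spec {σ : Store} {a c N : ℕ} (h1 : σ.intVar viOne = 1) (h0 : σ.intVar viZero = 0)
    (hc : σ.intVar c = N) :
    Ends (addSquares a c) σ (6 * N + 3) (fun σ' =>
      Same [viDst, viCopyC] [vrX, vrBound] [] [] σ σ' ∧
      σ.realVar vrBound ≤ σ'.realVar vrBound ∧
      ∀ i < N, |σ.realArr a i| + (σ.realVar vrBound - 1) ≤ σ'.realVar vrBound) := by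
  refine Ends.frame (Ends.bind (T₁ := 2) (T₂ := 6 * N + 1)
      (Ends.frame (wi := [viDst, viCopyC]) (wr := []) (wa := []) (wb := [])
        (Ends.block (Q := fun σ' => σ'.intVar viDst = 0 ∧ σ'.intVar viCopyC = N)
          (by simp) (by simp) (by simp) (by simp [Instr.exec, hc, h0])) rfl) ?_ (by omega)) rfl
  rintro σ₁ ⟨s, e₁, e₂⟩
  refine Ends.mono (Ends.repeatN (N := N) (T₁ := 4) (fun i σ' => σ'.intVar viDst = i ∧
      σ.realVar vrBound ≤ σ'.realVar vrBound ∧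
      ∀ i' < i, |σ.realArr a i'| + (σ.realVar vrBound - 1) ≤ σ'.realVar vrBound)
    [viDst, viCopyC] [vrX, vrBound] [] [] rfl rfl rfl ?_ e₂ ?_ ?_ ?_ le_rfl)
    (le_of_eq (by ring)) fun _ h => h.2.2
  · simp [s.iv, h1]
  · simp [e₁, s.rv]
  · intro i σ v h; simpa using h
  · rintro i hi σ₂ s₂ ⟨f₁, f₂, f₃⟩
    have o : σ₂.intVar 3 = 1 := by simp [s₂.iv, s.iv, h1]
    have hra : σ₂.realArr a = σ.realArr a := by simp [s₂.ra, s.ra]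
    refine Ends.mono (Ends.block (T := 4) (Q := fun σ' => σ'.intVar viDst = i + 1 ∧
      σ'.realVar vrBound = σ₂.realVar vrBound + σ.realArr a i * σ.realArr a i)
      (by simp) (by simp) (by simp) (by simp [Instr.exec, f₁, o, hra])) le_rfl ?_
    rintro σ₃ ⟨g₁, g₂⟩
    have hsq := mul_self_nonneg (σ.realArr a i)
    simp only [Nat.forall_lt_succ_right]
    rw [g₂]
    refine ⟨g₁, by linarith, fun i' hi' => by linarith [f₃ i' hi'], ?_⟩
    -- From `|x| ≤ x² + 1`.
    rw [← abs_mul_abs_self (σ.realArr a i)]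
    nlinarith [sq_nonneg (|σ.realArr a i| - 1), abs_nonneg (σ.realArr a i)]

/-- Fill the table of the multiples of the powers of the base. -/
def powTable : Prog :=
  block [.intConst viRow 0, .intConst viCode 1, .intAdd viCopyC viDigits viZero] ;;
  repeatN viCopyC (
    block [.intConst viTmp 0, .intAdd viNearC viBase viZero] ;;
    repeatN viNearC (block [.intStore aiPow viRow viTmp, .intAdd viTmp viTmp viCode,
      .intAdd viRow viRow viOne]) ;;
    block [.intAdd viCode viTmp viZero])

/-- Row `i` is filled by repeated addition of `M ^ i`; after its `M` entries the running sum is `M ^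
(i + 1)`, the increment for the next row. -/
lemma powTable_spec {σ : Store} {L M : ℕ} (h1 : σ.intVar viOne = 1) (h0 : σ.intVar viZero = 0)
    (hL : σ.intVar viDigits = L) (hM : σ.intVar viBase = M) :
    Ends powTable σ (L * (5 * M + 6) + 4) (fun σ' =>
      Same [viRow, viCode, viCopyC, viTmp, viNearC] [] [aiPow] [] σ σ' ∧
      ∀ i < L, ∀ v < M, σ'.intArr aiPow (i * M + v) = v * M ^ i) := by
  refine Ends.frame (Ends.bind (T₁ := 3) (T₂ := L * (5 * M + 6) + 1)
      (Ends.frame (wi := [viRow, viCode, viCopyC]) (wr := []) (wa := []) (wb := [])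
        (Ends.block (Q := fun σ' => σ'.intVar viRow = 0 ∧ σ'.intVar viCode = 1 ∧
          σ'.intVar viCopyC = L)
          (by simp) (by simp) (by simp) (by simp [Instr.exec, hL, h0])) rfl) ?_ (by omega)) rfl
  rintro σ₁ ⟨s, e₁, e₂, e₃⟩
  refine Ends.mono (Ends.repeatN (N := L) (T₁ := 5 * M + 4) (fun i σ' =>
      σ'.intVar viRow = i * M ∧ σ'.intVar viCode = M ^ i ∧
      ∀ i' < i, ∀ v < M, σ'.intArr aiPow (i' * M + v) = v * M ^ i')
    [viRow, viCode, viCopyC, viTmp, viNearC] [] [aiPow] [] rfl rfl rfl ?_ e₃ ?_ ?_ ?_ le_rfl)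
    le_rfl fun _ h => h.2.2.2
  · simp [s.iv, h1]
  · simp [e₁, e₂]
  · intro i σ v h; simpa using h
  · rintro i hi σ₂ s₂ ⟨f₁, f₂, f₃⟩
    refine Ends.bind (T₁ := 2) (T₂ := 5 * M + 2)
      (Ends.frame (wi := [viTmp, viNearC]) (wr := []) (wa := []) (wb := [])
        (Ends.block (Q := fun σ' => σ'.intVar viTmp = 0 ∧ σ'.intVar viNearC = M)
          (by simp) (by simp) (by simp) (by simp [Instr.exec, s₂.iv, s.iv, hM, h0])) rfl) ?_
        (by omega)
    rintro σ₃ ⟨s₃, g₁, g₂⟩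
    refine Ends.bind (T₁ := 5 * M + 1) (T₂ := 1) (Ends.repeatN (N := M) (T₁ := 3) (fun v σ' =>
        σ'.intVar viRow = i * M + v ∧ σ'.intVar viTmp = v * M ^ i ∧
        (∀ i' < i, ∀ v < M, σ'.intArr aiPow (i' * M + v) = v * M ^ i') ∧
        ∀ v' < v, σ'.intArr aiPow (i * M + v') = v' * M ^ i)
      [viRow, viTmp, viNearC] [] [aiPow] [] rfl rfl rfl ?_ g₂ ?_ ?_ ?_
      (le_of_eq (by ring))) ?_ (by omega)
    · simp [s₃.iv, s₂.iv, s.iv, h1]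
    · simpa [s₃.iv, s₃.ia, f₁, g₁] using f₃
    · intro i σ v h; simpa using h
    · rintro v hv σ₄ s₄ ⟨k₁, k₂, k₃, k₄⟩
      have o : σ₄.intVar 3 = 1 := by simp [s₄.iv, s₃.iv, s₂.iv, s.iv, h1]
      have hcode : σ₄.intVar viCode = M ^ i := by simp [s₄.iv, s₃.iv, f₂]
      refine Ends.block (by simp) (by simp) (by simp) ⟨?_, ?_, ?_, ?_⟩
      · simp [Instr.exec, k₁, o, add_assoc]
      · simp [Instr.exec, k₂, hcode, add_mul]
      · intro i' hi' v' hv'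
        have : (i' + 1) * M ≤ i * M := Nat.mul_le_mul_right _ hi'
        rw [add_mul] at this
        simp [Instr.exec, setEntry_apply, k₁, show i' * M + v' ≠ i * M + v by omega, k₃ i' hi' v' hv']
      · intro v' hv'
        by_cases h : v' = v
        · simp [Instr.exec, setEntry_apply, k₁, k₂, h]
        · simp [Instr.exec, setEntry_apply, k₁, h, k₄ v' (by omega)]
    · rintro σ₄ ⟨s₄, k₁, k₂, k₃, k₄⟩
      have hz : σ₄.intVar viZero = 0 := by simp [s₄.iv, s₃.iv, s₂.iv, s.iv, h0]
      refine Ends.block (by simp) (by simp) (by simp) ⟨?_, ?_, ?_⟩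
      · simp [Instr.exec, k₁, add_mul]
      · simp [Instr.exec, k₂, hz, pow_succ']
      · simpa only [List.foldl, Instr.exec, Nat.forall_lt_succ_right] using ⟨k₃, k₄⟩

/-- Choose the parameters according to the grid width. -/
def setParams : Prog :=
  block [.intAdd viBase viM viOne, .intAdd viDigits viK viK, .intAdd viDigits viDigits viDigits,
    .intConst viFour 4, .realConst vrOne 1, .realConst vrBound 20, .intConst viGo 1,
    .realMul vrX vrTau vrTau, .realConst vrY 2] ;;
  .ite (.realLe vrY vrX)
    (block [.realConst vrHeight (4 / 3), .intConst viClasses 4, .intConst viLong 1])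
    (block [.realConst vrHeight (1 / 2), .intConst viClasses 9, .intConst viLong 0])

open Classical in
lemma setParams_spec {σ : Store} {m k : ℕ} {τ : ℝ} (h1 : σ.intVar viOne = 1)
    (hm : σ.intVar viM = m) (hk : σ.intVar viK = k) (hτ : σ.realVar vrTau = τ) :
    Ends setParams σ 13 (fun σ' =>
      Same [viBase, viDigits, viFour, viGo, viClasses, viLong] [vrOne, vrBound, vrX, vrY, vrHeight]
        [] [] σ σ' ∧
      σ'.intVar viBase = m + 1 ∧ σ'.intVar viDigits = 4 * k ∧ σ'.intVar viFour = 4 ∧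
      σ'.intVar viGo = 1 ∧ σ'.realVar vrOne = 1 ∧ σ'.realVar vrBound = 20 ∧
      σ'.realVar vrHeight = (if 2 ≤ τ * τ then 4 / 3 else 1 / 2) ∧
      σ'.intVar viClasses = (if 2 ≤ τ * τ then 4 else 9) ∧
      (1 ≤ σ'.intVar viLong ↔ (if 2 ≤ τ * τ then 4 else 3) = 4)) := by
  refine Ends.frame (Ends.bind (T₁ := 9) (T₂ := 4)
      (Ends.block (Q := fun σ' => σ'.intVar viBase = m + 1 ∧ σ'.intVar viDigits = 4 * k ∧
        σ'.intVar viFour = 4 ∧ σ'.intVar viGo = 1 ∧ σ'.realVar vrOne = 1 ∧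
        σ'.realVar vrBound = 20 ∧ σ'.realVar vrX = τ * τ ∧ σ'.realVar vrY = 2)
        (by simp) (by simp) (by simp) ?_) ?_ (by omega)) rfl
  · simp [Instr.exec, hm, hk, h1, hτ]
    omega
  · rintro σ₁ ⟨e₁, e₂, e₃, e₄, e₅, e₆, e₇, e₈⟩
    refine Ends.ite (T₁ := 3) (fun hb => Ends.block (by simp) (by simp) (by simp) ?_)
      (fun hb => Ends.block (by simp) (by simp) (by simp) ?_) (by omega)
    · simp only [Test.Holds, e₇, e₈] at hb
      simp [Instr.exec, e₁, e₂, e₃, e₄, e₅, e₆, hb]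
    · simp only [Test.Holds, e₇, e₈] at hb
      simp [Instr.exec, e₁, e₂, e₃, e₄, e₅, e₆, hb]

/-- Prepare the memory for the treatment of the strips. -/
def prepare : Prog :=
  setParams ;; addSquares arPx viN ;; addSquares arPy viN ;; addSquares arCx viM ;;
  block [.realConst vrX 0, .realSub vrX vrX vrBound, .realStore arCx viM vrX,
    .realMul vrLast vrX vrOne] ;; powTable

/-- The bound starts at `20`, so every coordinate satisfies `|x| + 19 ≤ B`. Starting with `last =
-B`, below all points, makes the empty colouring correct. -/
lemma prepare_spec {τ : ℝ} {I : Input} (hk : 1 ≤ I.k) (hc : I.HasColorableCover I.k) {σ : Store}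
    (s₀ : Same [viOne] [] [] [] (initStore τ I) σ) (h1 : σ.intVar viOne = 1) :
    Ends prepare σ (12 * I.n + 6 * I.m + 4 * I.k * (5 * I.m + 11) + 30) (fun σ' => ∃ B,
      (taskOf τ I B).Valid ∧ StripsInv (taskOf τ I B) (-B) σ' ∧ σ'.intVar viGo = 1) := by
  have hn : σ.intVar viN = I.n := by simp [s₀.iv, initStore]
  have hm : σ.intVar viM = I.m := by simp [s₀.iv, initStore]
  have hkk : σ.intVar viK = I.k := by simp [s₀.iv, initStore]
  have h0 : σ.intVar viZero = 0 := by simp [s₀.iv, initStore]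
  refine Ends.bind (setParams_spec (τ := τ) h1 hm hkk (by simp [s₀.rv, initStore])) ?_
    (T₂ := 12 * I.n + 6 * I.m + 4 * I.k * (5 * I.m + 11) + 17) (by omega)
  rintro σ₁ ⟨s₁, e₁, e₂, e₃, e₄, e₅, e₆, e₇, e₈, e₉⟩
  refine Ends.bind (addSquares_spec (N := I.n) (by simp [s₁.iv, h1]) (by simp [s₁.iv, h0])
    (by simp [s₁.iv, hn])) ?_
    (T₂ := 6 * I.n + 6 * I.m + 4 * I.k * (5 * I.m + 11) + 14) (by omega)
  rintro σ₂ ⟨s₂, f₁, f₂⟩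
  refine Ends.bind (addSquares_spec (N := I.n) (by simp [s₂.iv, s₁.iv, h1])
    (by simp [s₂.iv, s₁.iv, h0]) (by simp [s₂.iv, s₁.iv, hn])) ?_
    (T₂ := 6 * I.m + 4 * I.k * (5 * I.m + 11) + 11) (by omega)
  rintro σ₃ ⟨s₃, g₁, g₂⟩
  refine Ends.bind (addSquares_spec (N := I.m) (by simp [s₃.iv, s₂.iv, s₁.iv, h1])
    (by simp [s₃.iv, s₂.iv, s₁.iv, h0]) (by simp [s₃.iv, s₂.iv, s₁.iv, hm])) ?_
    (T₂ := 4 * I.k * (5 * I.m + 11) + 8) (by omega)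
  rintro σ₄ ⟨s₄, k₁, k₂⟩
  set B := σ₄.realVar vrBound with hB
  have px : σ₁.realArr arPx = coords I.point 0 := by simp [s₁.ra, s₀.ra, initStore]
  have py : σ₂.realArr arPy = coords I.point 1 := by simp [s₂.ra, s₁.ra, s₀.ra, initStore]
  have cx : σ₃.realArr arCx = coords I.center 0 := by
    simp [s₃.ra, s₂.ra, s₁.ra, s₀.ra, initStore]
  rw [px, e₆] at f₂
  rw [py] at g₂
  rw [cx] at k₂
  rw [e₆] at f₁
  have hV : (taskOf τ I B).Valid := taskOf_valid hk hc (fun i hi => by linarith [k₂ i hi])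
    (fun i hi => by linarith [f₂ i hi]) (fun i hi => by linarith [g₂ i hi])
  have r1 : σ₄.realVar vrOne = 1 := by simp [s₄.rv, s₃.rv, s₂.rv, e₅]
  have m₄ : σ₄.intVar viM = I.m := by simp [s₄.iv, s₃.iv, s₂.iv, s₁.iv, hm]
  have x₄ : σ₄.realArr arCx = coords I.center 0 := by rw [s₄.ra _ (by simp), cx]
  refine Ends.bind (T₁ := 4) (T₂ := 4 * I.k * (5 * I.m + 11) + 4)
    (Ends.frame (wi := []) (wr := [vrX, vrLast]) (wa := []) (wb := [arCx])
      (Ends.block (Q := fun σ' => σ'.realVar vrLast = -B ∧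
        σ'.realArr arCx = (taskOf τ I B).X) (by simp) (by simp) (by simp) ?_) rfl) ?_ (by omega)
  · simp [Instr.exec, setEntry, r1, m₄, x₄, taskOf, ← hB]
  rintro σ₅ ⟨s₅, l₁, l₂⟩
  refine Ends.mono (powTable_spec (L := 4 * I.k) (M := I.m + 1)
    (by simp [s₅.iv, s₄.iv, s₃.iv, s₂.iv, s₁.iv, h1])
    (by simp [s₅.iv, s₄.iv, s₃.iv, s₂.iv, s₁.iv, h0])
    (by simp [s₅.iv, s₄.iv, s₃.iv, s₂.iv, e₂])
    (by simp [s₅.iv, s₄.iv, s₃.iv, s₂.iv, e₁])) (le_of_eq (by ring)) ?_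
  rintro σ₆ ⟨s₆, hpow⟩
  have out : σ₆.intArr aiOut = fun _ => 0 := by
    simp [s₆.ia, s₅.ia, s₄.ia, s₃.ia, s₂.ia, s₁.ia, s₀.ia, initStore]
  have cl : σ₆.intVar viClass = 0 := by
    simp [s₆.iv, s₅.iv, s₄.iv, s₃.iv, s₂.iv, s₁.iv, s₀.iv, initStore]
  refine ⟨B, hV, ⟨?_, ?_, ?_, ?_, ?_, ?_⟩, ?_⟩
  · constructor
    · simp [s₆.iv, s₅.iv, s₄.iv, s₃.iv, s₂.iv, s₁.iv, hn, taskOf]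
    · simp [s₆.iv, s₅.iv, m₄, taskOf]
    · simp [s₆.iv, s₅.iv, s₄.iv, s₃.iv, s₂.iv, s₁.iv, hkk, taskOf]
    · simp [s₆.iv, s₅.iv, s₄.iv, s₃.iv, s₂.iv, s₁.iv, h1]
    · simp [s₆.iv, s₅.iv, s₄.iv, s₃.iv, s₂.iv, e₁, taskOf]
    · simp [s₆.iv, s₅.iv, s₄.iv, s₃.iv, s₂.iv, e₂, taskOf]
    · simp [s₆.iv, s₅.iv, s₄.iv, s₃.iv, s₂.iv, e₃]
    · simp [s₆.iv, s₅.iv, s₄.iv, s₃.iv, s₂.iv, e₈, taskOf]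
    · rw [s₆.iv _ (by simp), s₅.iv _ (by simp), s₄.iv _ (by simp), s₃.iv _ (by simp),
        s₂.iv _ (by simp)]
      exact e₉
    · simp [s₆.iv, s₅.iv, s₄.iv, s₃.iv, s₂.iv, s₁.iv, h0]
    · simp [s₆.rv, s₅.rv, r1]
    · rw [s₆.rv _ (by simp), s₅.rv _ (by simp), s₄.rv _ (by simp), s₃.rv _ (by simp),
        s₂.rv _ (by simp)]
      exact e₇
    · rw [s₆.rv _ (by simp), s₅.rv _ (by simp)]
      rfl
    · simp [s₆.ra, s₅.ra, s₄.ra, s₃.ra, s₂.ra, px, taskOf]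
    · simp [s₆.ra, s₅.ra, s₄.ra, s₃.ra, py, taskOf]
    · rw [s₆.ra _ (by simp), l₂]
    · simp [s₆.ra, s₅.ra, s₄.ra, s₃.ra, s₂.ra, s₁.ra, s₀.ra, initStore, taskOf]
    · exact hpow
  · intro c
    simp [s₆.ia, s₅.ia, s₄.ia, s₃.ia, s₂.ia, s₁.ia, s₀.ia, initStore]
  · rw [s₆.rv _ (by simp), l₁]
  · rw [cl]
    rcases hV.mem with h | h <;> omega
  · rw [cl, zero_mul]
    simp [s₆.iv, s₅.iv, s₄.iv, s₃.iv, s₂.iv, s₁.iv, s₀.iv, initStore]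
  · rw [out]
    refine ⟨fun x hx => absurd rfl hx, fun x x' _ hx => absurd rfl hx, fun i hi hle => ?_⟩
    have := (hV.py i hi).1
    change -B + 10 ≤ _ at this
    linarith
  · simp [s₆.iv, s₅.iv, s₄.iv, s₃.iv, s₂.iv, e₄]

/-! ### The exponent and the approximation factor -/

/-- The machine has no roots; the program compares `τ * τ` with `2` instead. -/
lemma sqrt_two_le_iff {τ : ℝ} (h : 1 ≤ τ) : √2 ≤ τ ↔ 2 ≤ τ * τ := by
  rw [Real.sqrt_le_left (by linarith), sq]

/-- Lower bounds by explicit configurations: `f` lists the centres, `g` points common to the disks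
and the cell. -/
lemma IsPackingNumber.le {τ : ℝ} {a c : ℕ} (h : IsPackingNumber τ a) (f : Fin c → Plane)
    (hf : ∀ i j, i < j → 4 < sqd (f i 0) (f i 1) (f j 0) (f j 1))
    (g : Fin c → Plane) (hg : ∀ i, g i ∈ unitDisk (f i) ∧ g i ∈ cell τ) : c ≤ a := by
  have hne : ∀ i j, i ≠ j → 4 < sqd (f i 0) (f i 1) (f j 0) (f j 1) := by
    intro i j hij
    rcases lt_or_gt_of_ne hij with h | h
    · exact hf i j h
    · rw [sqd_comm]
      exact hf j i h
  have hinj : Function.Injective f := by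
    intro i j hij
    by_contra hcon
    have := hne i j hcon
    rw [hij] at this
    simp [sqd] at this
    linarith
  refine h.2 ⟨Finset.univ.map ⟨f, hinj⟩, by simp, ?_, ?_⟩
  · intro x hx y hy hxy
    simp only [Finset.coe_map, Function.Embedding.coeFn_mk, Finset.coe_univ, Set.image_univ,
      Set.mem_range] at hx hy
    obtain ⟨i, rfl⟩ := hx
    obtain ⟨j, rfl⟩ := hy
    exact (disjoint_unitDisk_iff _ _).2 (hne i j fun hij => hxy (by rw [hij]))
  · intro z hz
    simp only [Finset.mem_map, Finset.mem_univ, Function.Embedding.coeFn_mk, true_and] at hz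
    obtain ⟨i, rfl⟩ := hz
    exact ⟨g i, hg i⟩

/-- Four disks touch the cell at the midpoints of its sides; neighbouring centres are at distance
`√2 * (1 + τ/2) ≥ 3/√2 > 2`. -/
lemma IsPackingNumber.four_le {τ : ℝ} {a : ℕ} (h : IsPackingNumber τ a) (hτ : 1 ≤ τ) : 4 ≤ a := by
  refine h.le ![!₂[-1, τ / 2], !₂[τ + 1, τ / 2], !₂[τ / 2, -1], !₂[τ / 2, τ + 1]] ?_
    ![!₂[0, τ / 2], !₂[τ, τ / 2], !₂[τ / 2, 0], !₂[τ / 2, τ]] ?_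
  · intro i j hij
    fin_cases i <;> fin_cases j <;> simp [sqd] at hij ⊢ <;> nlinarith
  · intro i
    rw [mem_unitDisk_iff]
    fin_cases i <;> simp [sqd, cell] <;> constructor <;> (try constructor) <;> linarith

/-- One disk in the middle and one touching each corner, displaced by `(±3/5, ±4/5)`; from the
middle the squared distance is at least `(7/5)² + (8/5)² > 4`. -/
lemma IsPackingNumber.five_le {τ : ℝ} {a : ℕ} (h : IsPackingNumber τ a) (hτ : 8 / 5 ≤ τ) :
    5 ≤ a := by
  refine h.le ![!₂[τ / 2, τ / 2], !₂[-(3 / 5), -(4 / 5)], !₂[τ + 3 / 5, -(4 / 5)],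
    !₂[-(3 / 5), τ + 4 / 5], !₂[τ + 3 / 5, τ + 4 / 5]] ?_
    ![!₂[τ / 2, τ / 2], !₂[0, 0], !₂[τ, 0], !₂[0, τ], !₂[τ, τ]] ?_
  · intro i j hij
    fin_cases i <;> fin_cases j <;> simp [sqd] at hij ⊢ <;> nlinarith
  · intro i
    rw [mem_unitDisk_iff]
    fin_cases i <;> simp [sqd, cell] <;> norm_num <;> (try constructor) <;> linarith

-- Tabulated values are inspected. At the other widths, `τ ≥ √2` forces `τ > 8/5`, where five disks
-- fit; below `√2` four disks suffice.
open Classical in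
lemma IsExponent.lt {τ : ℝ} {α : ℕ} (h : IsExponent τ α) (hτ : 1 ≤ τ) :
    (if 2 ≤ τ * τ then 4 else 3) < α := by
  split_ifs with h2
  · rcases h with ⟨rfl, -⟩ | ⟨-, -, rfl⟩ | ⟨-, rfl⟩ | ⟨-, rfl⟩ | ⟨-, rfl⟩ | ⟨-, rfl⟩ | ⟨ht, h⟩
    · norm_num at h2
    all_goals try norm_num
    refine h.five_le ?_
    by_contra! hcon
    exact ht (Or.inr (Or.inl ⟨(sqrt_two_le_iff hτ).2 h2, hcon.le⟩))
  · rcases h with ⟨-, rfl⟩ | ⟨-, -, rfl⟩ | ⟨-, rfl⟩ | ⟨-, rfl⟩ | ⟨-, rfl⟩ | ⟨-, rfl⟩ | ⟨ht, h⟩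
    all_goals try norm_num
    exact h.four_le hτ

open Classical in
lemma le_rho {τ : ℝ} (hτ : 1 ≤ τ) : (if 2 ≤ τ * τ then 4 else 9) ≤ rho τ := by
  unfold rho
  split_ifs with h <;> first | omega | skip
  all_goals refine absurd ?_ h
  · nlinarith
  · nlinarith
  · exact (sqrt_two_le_iff hτ).1 ‹_›

lemma one_le_rho (τ : ℝ) : 1 ≤ rho τ := by
  unfold rho
  split_ifs <;> norm_num

/-! ### The running time -/

/-- `(1 + 1/m) ^ k ≤ (1 + 1/m) ^ m ≤ e < 3`; thus the dummy, which makes the base `m + 1`, costs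
only a constant factor. -/
lemma succ_pow_le {m k : ℕ} (h : k ≤ m) : (m + 1) ^ k ≤ 3 * m ^ k := by
  rcases Nat.eq_zero_or_pos m with rfl | hm
  · obtain rfl : k = 0 := by omega
    norm_num
  have hm' : (0 : ℝ) < m := by exact_mod_cast hm
  have h₁ : (1 + 1 / (m : ℝ)) ^ k ≤ 3 := by
    calc (1 + 1 / (m : ℝ)) ^ k ≤ (Real.exp (1 / m)) ^ k := by
          refine pow_le_pow_left₀ (by positivity) ?_ _
          rw [add_comm]
          exact Real.add_one_le_exp _
      _ ≤ (Real.exp (1 / m)) ^ m :=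
          pow_le_pow_right₀ (Real.one_le_exp (by positivity)) h
      _ = Real.exp 1 := by
          rw [← Real.exp_nat_mul]
          congr 1
          field_simp
      _ ≤ 3 := by linarith [Real.exp_one_lt_d9]
  have h₂ : ((m : ℝ) + 1) ^ k ≤ 3 * (m : ℝ) ^ k := by
    have : ((m : ℝ) + 1) = (1 + 1 / (m : ℝ)) * m := by field_simp
    rw [this, mul_pow]
    exact mul_le_mul_of_nonneg_right h₁ (by positivity)
  exact_mod_cast h₂

/-- The polynomial cost of a state is absorbed by one more factor `m ^ k`, which raises the exponent
from `A * k` to `(A + 1) * k`. -/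
lemma sq_mul_le_pow {m k : ℕ} (h : k < m) (hk : 1 ≤ k) : m * (k * k) ≤ 2 * m ^ k := by
  obtain rfl | rfl | hk : k = 1 ∨ k = 2 ∨ 3 ≤ k := by omega
  · simp; omega
  · nlinarith
  · calc m * (k * k) ≤ m * (m * m) := Nat.mul_le_mul_left _ (Nat.mul_le_mul h.le h.le)
      _ = m ^ 3 := by ring
      _ ≤ m ^ k := Nat.pow_le_pow_right (by omega) hk
      _ ≤ 2 * m ^ k := by omega

lemma solveTime_one_le {m k A : ℕ} (h : k < m) (hk : 1 ≤ k) (hA : A ≤ 4) :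
    solveTime m k A 1 ≤ 164621 * m ^ ((A + 1) * k) := by
  have h₁ : (m + 1) ^ (A * k) ≤ 81 * m ^ (A * k) := by
    calc (m + 1) ^ (A * k) = ((m + 1) ^ k) ^ A := by rw [← pow_mul, mul_comm]
      _ ≤ (3 * m ^ k) ^ A := Nat.pow_le_pow_left (succ_pow_le h.le) _
      _ = 3 ^ A * m ^ (A * k) := by rw [mul_pow, ← pow_mul, mul_comm k]
      _ ≤ 3 ^ 4 * m ^ (A * k) := Nat.mul_le_mul_right _ (Nat.pow_le_pow_right (by norm_num) hA)
      _ = 81 * m ^ (A * k) := by norm_num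
  have h₂ : expandTime m k 1 + 8 ≤ 508 * (m * (k * k)) := by
    unfold expandTime
    have e₁ : k ≤ k * k := Nat.le_mul_of_pos_left _ hk
    have e₂ : 1 * (52 * k + 16) + k * (56 * k + 93) + 17 ≤ 234 * (k * k) := by nlinarith
    have e₃ : (m + 1) * (1 * (52 * k + 16) + k * (56 * k + 93) + 17) ≤ (2 * m) * (234 * (k * k)) :=
      Nat.mul_le_mul (by omega) e₂
    have e₄ : 1 ≤ m * (k * k) := Nat.mul_pos (by omega) (by omega)
    nlinarith
  have h₃ := sq_mul_le_pow h hk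
  have h₄ : 1 ≤ (m + 1) ^ (A * k) := Nat.one_le_pow _ _ (by omega)
  have h₅ : m ≤ m ^ ((A + 1) * k) := Nat.le_self_pow (by positivity) _
  unfold solveTime
  calc ((m + 1) ^ (A * k) + 1) * (expandTime m k 1 + 8) + 16 * k + 13
      ≤ (162 * m ^ (A * k)) * (1016 * m ^ k) + 29 * m ^ ((A + 1) * k) := by
        have : ((m + 1) ^ (A * k) + 1) * (expandTime m k 1 + 8) ≤
          (162 * m ^ (A * k)) * (1016 * m ^ k) := Nat.mul_le_mul (by omega) (by omega)
        omega
    _ = 164621 * m ^ ((A + 1) * k) := by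
        rw [add_mul, one_mul, pow_add]
        ring

/-- The searches dominate. The remaining terms are at most of order `m * n + m²`, and `m² ≤ m ^ ((A
+ 1) * k)` since the exponent is at least `2`. -/
lemma total_le {n m k A : ℕ} (h : k < m) (hk : 1 ≤ k) (hn : 1 ≤ n) (hA : A ≤ 4) (hA' : 1 ≤ A) :
    12 * n + 6 * m + 4 * k * (5 * m + 11) + 30 + (5 * m * (15 * n + 21) +
      n * solveTime m k A 1 + (7 * n + 8)) + 2 ≤ 165000 * (m ^ ((A + 1) * k) * n) := by
  set W := m ^ ((A + 1) * k) with hW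
  have h₁ : n * solveTime m k A 1 ≤ n * (164621 * W) :=
    Nat.mul_le_mul_left _ (solveTime_one_le h hk hA)
  have h₂ : m * m ≤ W := by
    rw [← sq]
    exact Nat.pow_le_pow_right (by omega) (by nlinarith)
  have h₃ : m ≤ m * m := Nat.le_mul_of_pos_left _ (by omega)
  have h₄ : k * m ≤ m * m := Nat.mul_le_mul_right _ h.le
  have h₅ : W ≤ W * n := Nat.le_mul_of_pos_right _ hn
  have h₆ : m * n ≤ W * n := Nat.mul_le_mul_right _ (by omega)
  have h₇ : n ≤ W * n := Nat.le_mul_of_pos_left _ (by omega)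
  nlinarith

/-! ### The algorithm -/

/-- The whole algorithm. -/
def algorithm : Prog :=
  block [.intConst viOne 1] ;; .ite (.intLe viM viK) colorAll (prepare ;; allStrips)

lemma Input.HasColorableCover.one_le {I : Input} {c : ℕ} (h : I.HasColorableCover c)
    (hn : 1 ≤ I.n) : 1 ≤ I.m := by
  obtain ⟨S, χ, hcov, -⟩ := h
  obtain ⟨j, -⟩ := hcov ⟨0, hn⟩
  exact j.pos

lemma isColoredCover_of_distinct {I : Input} {c d : ℕ} (h : I.HasColorableCover d) {σ : Store}
    (hσ : ∀ x < I.m, σ.intArr aiOut x = x + 1) (hm : I.m ≤ c) :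
    I.IsColoredCover c (outDisks I σ) (outColor I σ) := by
  have hout : ∀ j : Fin I.m, outColor I σ j = j + 1 := fun j => hσ j j.2
  refine ⟨fun i => ?_, fun j _ => ?_, fun j _ j' _ hne hc => ?_⟩
  · obtain ⟨S, χ, hcov, -⟩ := h
    obtain ⟨j, -, hj⟩ := hcov i
    refine ⟨j, ?_, hj⟩
    change outColor I σ j ≠ 0
    rw [hout]
    omega
  · rw [hout]
    have := j.2
    omega
  · rw [hout, hout] at hc
    exact absurd (Fin.ext (by omega)) hne

-- The case `m ≤ k` is treated apart because the estimates of the running time need `k < m`; there,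
-- distinct colours for all disks stay within `k` colours, and all disks together cover because some
-- of them do.
open Classical in
lemma algorithm_spec {τ : ℝ} {α : ℕ} (hτ : 1 ≤ τ) (hα : IsExponent τ α) {I : Input}
    (hn : 1 ≤ I.n) (hk : 1 ≤ I.k) (hc : I.HasColorableCover I.k) :
    Ends algorithm (initStore τ I) (165000 * (I.m ^ (α * I.k) * I.n)) (fun σ =>
      I.IsColoredCover (rho τ * I.k) (outDisks I σ) (outColor I σ)) := by
  have hm := hc.one_le hn
  have hlt := hα.lt hτ
  have hbind : ∀ {T : ℕ} {Q : Store → Prop},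
      (∀ σ, Same [viOne] [] [] [] (initStore τ I) σ → σ.intVar viOne = 1 →
        Ends (.ite (.intLe viM viK) colorAll (prepare ;; allStrips)) σ T Q) →
      Ends algorithm (initStore τ I) (T + 1) Q := by
    intro T Q h
    refine Ends.bind (T₁ := 1) (T₂ := T) (Ends.frame (wi := [viOne]) (wr := []) (wa := [])
      (wb := []) (Ends.block (Q := fun σ' => σ'.intVar viOne = 1)
        (by simp) (by simp) (by simp) (by simp [Instr.exec])) rfl) ?_ (by omega)
    rintro σ ⟨s, h1⟩
    exact h σ s h1
  rcases Nat.lt_or_ge I.k I.m with hkm | hkm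
  · set A := if 2 ≤ τ * τ then 4 else 3 with hA
    have hA₁ : A ≤ 4 := by rw [hA]; split_ifs <;> omega
    have hA₂ : 1 ≤ A := by rw [hA]; split_ifs <;> omega
    refine Ends.mono (T₁ := 12 * I.n + 6 * I.m + 4 * I.k * (5 * I.m + 11) + 30 +
      (5 * I.m * (15 * I.n + 21) + I.n * solveTime I.m I.k A 1 + (7 * I.n + 8)) + 1 + 1)
      (hbind fun σ s h1 => ?_) ?_ fun _ h => h
    · refine Ends.ite (T₁ := 12 * I.n + 6 * I.m + 4 * I.k * (5 * I.m + 11) + 30 +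
        (5 * I.m * (15 * I.n + 21) + I.n * solveTime I.m I.k A 1 + (7 * I.n + 8)))
        (fun hb => ?_) (fun _ => ?_) le_rfl
      · simp [Test.Holds, s.iv, initStore] at hb
        omega
      · refine Ends.bind (prepare_spec hk hc s h1) ?_ le_rfl
        rintro σ₁ ⟨B, hV, hI, hgo⟩
        refine Ends.mono (allStrips_spec hV hI hgo) ?_ ?_
        · have hr : (taskOf τ I B).remaining (-B) ≤ I.n :=
            (Finset.card_filter_le _ _).trans (Finset.card_range _).le
          have := Nat.mul_le_mul_right (solveTime I.m I.k A 1) hr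
          change 5 * I.m * (15 * I.n + 21) + (taskOf τ I B).remaining (-B) *
            solveTime I.m I.k A 1 + (7 * I.n + 8) ≤ _
          omega
        · rintro σ₂ ⟨last, cl, hrem, hcol⟩
          exact hcol.isColoredCover hrem rfl (le_rho hτ)
    · refine (total_le hkm hk hn hA₁ hA₂).trans ?_
      gcongr
      · omega
  · refine Ends.mono (T₁ := 5 * I.m + 3 + 1 + 1) (hbind fun σ s h1 => ?_) ?_ fun _ h => h
    · refine Ends.ite (T₁ := 5 * I.m + 3) (fun _ => ?_) (fun hb => absurd ?_ hb) le_rfl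
      · refine Ends.mono (colorAll_spec (m := I.m) h1 (by simp [s.iv, initStore])
          (by simp [s.iv, initStore])) le_rfl fun σ₁ h => ?_
        exact isColoredCover_of_distinct hc h
          (hkm.trans (Nat.le_mul_of_pos_left _ (one_le_rho τ)))
      · simpa [Test.Holds, s.iv, initStore] using hkm
    · have h₁ : I.m ≤ I.m ^ (α * I.k) :=
        Nat.le_self_pow (Nat.mul_pos (by omega) (by omega)).ne' _
      have h₂ : I.m ^ (α * I.k) ≤ I.m ^ (α * I.k) * I.n := Nat.le_mul_of_pos_right _ hn
      omega

end CDUDC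

end

theorem mainTheorem3 :
    ∃ (prog : CDUDC.Prog) (C : ℝ),
      ∀ (τ : ℝ) (α : ℕ), 1 ≤ τ → τ ≤ 5 → CDUDC.IsExponent τ α →
      ∀ I : CDUDC.Input, 1 ≤ I.n → 1 ≤ I.k → I.HasColorableCover I.k →
        ∃ (t : ℕ) (σ : CDUDC.Store),
          CDUDC.Runs prog (CDUDC.initStore τ I) t σ ∧
          (t : ℝ) ≤ C * ((I.m : ℝ) ^ (α * I.k) * (I.n : ℝ) * Real.log ((I.k : ℝ) + 1)) ∧
          I.IsColoredCover (CDUDC.rho τ * I.k) (CDUDC.outDisks I σ) (CDUDC.outColor I σ) := by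
  refine ⟨CDUDC.algorithm, 330000, fun τ α hτ _ hα I hn hk hc => ?_⟩
  obtain ⟨t, σ, ht, hrun, hcov⟩ := CDUDC.algorithm_spec hτ hα hn hk hc
  refine ⟨t, σ, hrun, ?_, hcov⟩
  -- The logarithm is bounded below by `log 2 > 1/2`; doubling the constant `165000` pays for this.
  have hlog : 1 / 2 ≤ Real.log ((I.k : ℝ) + 1) := by
    have hk' : (1 : ℝ) ≤ I.k := by exact_mod_cast hk
    have := Real.log_le_log (x := 2) (y := (I.k : ℝ) + 1) (by norm_num) (by linarith)
    linarith [Real.log_two_gt_d9]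
  have ht' : (t : ℝ) ≤ 165000 * ((I.m : ℝ) ^ (α * I.k) * I.n) := by exact_mod_cast ht
  have hW : (0 : ℝ) ≤ (I.m : ℝ) ^ (α * I.k) * I.n := by positivity
  nlinarith [mul_le_mul_of_nonneg_left hlog hW]
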